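/- Setting. A schema is a finite set of relations with distinct names; each attribute of a relation has an abstract domain, which is a nonempty set of constants together with a name; the set is either finite or the (infinite) set of all constants, and each such set is available under infinitely many names (so different domains may overlap, and attributes may share a domain). An instance is a finite set of well-typed facts over the schema, and a configuration is a subset of an instance. An access method on a relation $R$ has a set of input attributes of $R$ and is either dependent or independent. An access is an access method together with a binding of its input attributes to values of their domains; it is well-formed at a configuration $\mathrm{Conf}$ if its method is independent, or if it is dependent and each value of the binding occurs in $\mathrm{Conf}$ in an attribute with the same abstract domain. On an instance $I\supseteq\mathrm{Conf}$, a well-formed access leads from $\mathrm{Conf}$ to any configuration obtained by adding to $\mathrm{Conf}$ some subset (the response) of the facts of $I$ over $R$ that agree with the binding. A configuration is reachable from $\mathrm{Conf}$ if, for some instance $I\supseteq\mathrm{Conf}$, a finite sequence of well-formed accesses on $I$ leads to it. Boolean positive queries (PQs) are closed first-order formulas built from relational atoms by $\wedge,\vee,\exists$; Boolean conjunctive queries (CQs) are those without $\vee$. Each variable ranges over attributes with a single abstract domain, and each constant of a query occurs in the configuration in question, in the appropriate domain. A Boolean query is certain at a configuration if it is true in every instance that contains the configuration. Containment. Given a schema,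 a finite set of access methods, a configuration $\mathrm{Conf}$ and Boolean queries $Q_1,Q_2$, decide whether $Q_2$ is true in every configuration reachable from $\mathrm{Conf}$ in which $Q_1$ is true. Long-term relevance. Given a schema, a finite set of access methods, a configuration $\mathrm{Conf}$, an access $a$ that is well-formed at $\mathrm{Conf}$, and a Boolean query $Q$, decide whether there are an instance $I\supseteq\mathrm{Conf}$ and a finite sequence of well-formed accesses with responses on $I$, starting from $\mathrm{Conf}$ and beginning with $a$, such that $Q$ is certain at the configuration reached by the sequence but not at the one reached by its truncation, or conversely. Here the truncation is obtained by deleting the first access with its response and then keeping the longest initial part of the remaining sequence in which every access, with its response, is well-formed at the configuration reached from $\mathrm{Conf}$ by the earlier ones. Proposition. There is a many-one reduction, computable in polynomial time (by a Turing machine, in the length of the encoded input), from containment of Boolean CQs to the complement of long-term relevance of an access for a Boolean CQ; and likewise from containment of Boolean PQs to the complement of long-term relevance of an access for a Boolean PQ. For PQs the reduction can be chosen so that the configuration of the output is that of the input. -/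

import Mathlib

namespace LimitedAccess

/-! ### Data sources -/

/-- Constants are bit strings. -/
abbrev Const := List Bool

/-- Names (of relations, variables and abstract domains) are bit strings. -/
abbrev Name := List Bool

/-- Abstract domains. There are infinitely many infinite domains (told apart by their tags), and
for every finite nonempty list of constants infinitely many domains with exactly these values.
Different domains may overlap. -/
inductive Domain where
  | infinite (tag : Name)
  | finite (tag : Name) (c : Const) (cs : List Const)

/-- The set of values of an abstract domain. -/
def Domain.values : Domain → Set Const
  | .infinite _ => Set.univ
  | .finite _ c cs => {d | d ∈ c :: cs}

/-- A relation of a schema: its name and the abstract domains of its attributes, in order. -/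
structure Rel where
  name : Name
  doms : List Domain

/-- A fact `R(c₁, …, cₖ)`. -/
@[ext] structure Fact where
  rel : Rel
  args : List Const

/-- The tuple of the fact has the arity of the relation and values in the domains of its
attributes. -/
def Fact.WellTyped (f : Fact) : Prop :=
  List.Forall₂ (fun c D => c ∈ Domain.values D) f.args f.rel.doms

/-- An access method on a relation. The `i`-th entry of `inputs` says whether the `i`-th attribute
is an input attribute; the method is either dependent or independent. -/
structure Method where
  rel : Rel
  inputs : List Bool
  dependent : Bool

/-- The entries of a list at the positions marked in a mask: projection of a tuple onto a set of
attributes. -/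
def select {α : Type} (mask : List Bool) (l : List α) : List α :=
  ((mask.zip l).filter (fun p => p.1)).map (fun p => p.2)

/-- An access: a method, and a binding that gives values for its input attributes, in order. -/
structure Access where
  method : Method
  bind : List Const

/-- The abstract domains of the input attributes of an access. -/
def Access.inputDoms (a : Access) : List Domain :=
  select a.method.inputs a.method.rel.doms

/-- The relations of a schema have distinct names. -/
def IsSchema (sch : List Rel) : Prop :=
  (sch.map Rel.name).Nodup

/-- The methods in `acs` are access methods over the schema `sch`. -/
def AreMethods (sch : List Rel) (acs : List Method) : Prop :=
  ∀ m ∈ acs, m.rel ∈ sch ∧ m.inputs.length = m.rel.doms.length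

/-- Database instances for a schema: finite sets of well-typed facts over its relations. -/
def IsInstance (sch : List Rel) (I : Set Fact) : Prop :=
  I.Finite ∧ ∀ f ∈ I, f.rel ∈ sch ∧ f.WellTyped

/-- The active domain of a configuration: its constants, each with the abstract domain of the
attribute in which it appears. -/
def adom (C : Set Fact) : Set (Const × Domain) :=
  {p | ∃ f ∈ C, p ∈ f.args.zip f.rel.doms}

/-- The access is well-formed at the configuration `C`: its method is available, its binding is
well-typed, and if the method is dependent then each value of the binding, with the domain of its
attribute, is in the active domain of `C`. -/
def WellFormedAccess (acs : List Method) (C : Set Fact) (a : Access) : Prop :=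
  a.method ∈ acs ∧
  List.Forall₂ (fun c D => c ∈ Domain.values D) a.bind a.inputDoms ∧
  (a.method.dependent = true → ∀ p ∈ a.bind.zip a.inputDoms, p ∈ adom C)

/-- The facts of `I` over the accessed relation that agree with the binding. Any subset of it is a
possible (sound) response to the access on `I`. -/
def matching (I : Set Fact) (a : Access) : Set Fact :=
  {f | f ∈ I ∧ f.rel = a.method.rel ∧ select a.method.inputs f.args = a.bind}

/-- A sequence of accesses with their responses. -/
abbrev Path := List (Access × Set Fact)

/-- The configuration reached from `C` by adding the responses of a path. -/
def run : Set Fact → Path → Set Fact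
  | C, [] => C
  | C, (_, r) :: p => run (C ∪ r) p

/-- The path is a sequence of accesses on the instance `I`, starting from `C`, each of them
well-formed at the configuration reached before it and with a response that is sound for `I`. -/
def IsPath (acs : List Method) (I : Set Fact) : Set Fact → Path → Prop
  | _, [] => True
  | C, (a, r) :: p => WellFormedAccess acs C a ∧ r ⊆ matching I a ∧ IsPath acs I (C ∪ r) p

open Classical in
/-- The longest initial part of a sequence of accesses with responses in which every access is
well-formed at the configuration reached from `C` by the earlier ones. -/
noncomputable def truncate (acs : List Method) : Set Fact → Path → Path
  | _, [] => []
  | C, (a, r) :: p => if WellFormedAccess acs C a then (a, r) :: truncate acs (C ∪ r) p else []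

/-- `C'` is reachable from `C` with respect to the instance `I`. -/
def Reachable (acs : List Method) (I C C' : Set Fact) : Prop :=
  ∃ p : Path, IsPath acs I C p ∧ run C p = C'

/-! ### Queries -/

inductive Term where
  | var (x : Name)
  | const (c : Const)

/-- Positive queries: first-order formulas built from relational atoms by conjunction,
disjunction and existential quantification. -/
inductive Query where
  | atom (R : Rel) (args : List Term)
  | and (φ ψ : Query)
  | or (φ ψ : Query)
  | ex (x : Name) (φ : Query)

def Term.value (v : Name → Const) : Term → Const
  | .var x => v x
  | .const c => c

/-- Truth of a formula in a set of facts, under a valuation of the free variables. -/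
def Query.Eval (I : Set Fact) : (Name → Const) → Query → Prop
  | v, .atom R ts => (⟨R, ts.map (Term.value v)⟩ : Fact) ∈ I
  | v, .and φ ψ => φ.Eval I v ∧ ψ.Eval I v
  | v, .or φ ψ => φ.Eval I v ∨ ψ.Eval I v
  | v, .ex x φ => ∃ c : Const, φ.Eval I (Function.update v x c)

def Query.freeVars : Query → Set Name
  | .atom _ ts => {x | Term.var x ∈ ts}
  | .and φ ψ => φ.freeVars ∪ ψ.freeVars
  | .or φ ψ => φ.freeVars ∪ ψ.freeVars
  | .ex x φ => φ.freeVars \ {x}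

/-- Truth of a Boolean query in a set of facts (there are no free variables, so that the
valuation is irrelevant). -/
def Query.Holds (φ : Query) (I : Set Fact) : Prop :=
  φ.Eval I (fun _ => [])

/-- The formula is over the schema `sch`, each variable occurs only in attributes with one and the
same domain (`Γ` gives the domains of the free variables), and each constant is present in the
configuration `C`, in the appropriate domain. -/
def Query.WellTyped (sch : List Rel) (C : Set Fact) : (Name → Domain) → Query → Prop
  | Γ, .atom R ts => R ∈ sch ∧
      List.Forall₂ (fun t D => match t with
        | Term.var x => Γ x = D
        | Term.const c => (c, D) ∈ adom C) ts R.doms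
  | Γ, .and φ ψ => φ.WellTyped sch C Γ ∧ ψ.WellTyped sch C Γ
  | Γ, .or φ ψ => φ.WellTyped sch C Γ ∧ ψ.WellTyped sch C Γ
  | Γ, .ex x φ => ∃ D : Domain, φ.WellTyped sch C (Function.update Γ x D)

/-- Boolean positive queries over a schema, with constants from the configuration `C`. -/
def Query.IsBooleanPQ (sch : List Rel) (C : Set Fact) (φ : Query) : Prop :=
  φ.freeVars = ∅ ∧ ∃ Γ : Name → Domain, φ.WellTyped sch C Γ

/-- No disjunction occurs in the formula. -/
def Query.IsConjunctive : Query → Prop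
  | .atom _ _ => True
  | .and φ ψ => φ.IsConjunctive ∧ ψ.IsConjunctive
  | .or _ _ => False
  | .ex _ φ => φ.IsConjunctive

/-- The two query languages. -/
inductive QueryLanguage where
  | CQ
  | PQ

/-- Membership of a positive query in a query language. -/
def QueryLanguage.Mem : QueryLanguage → Query → Prop
  | .CQ, φ => φ.IsConjunctive
  | .PQ, _ => True

/-- The Boolean query is certain at the configuration `C`. -/
def Certain (sch : List Rel) (φ : Query) (C : Set Fact) : Prop :=
  ∀ I : Set Fact, IsInstance sch I → C ⊆ I → φ.Holds I

/-! ### The two decision problems -/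

/-- Inputs of the problem of containment under access limitations. Finite sets of relations,
methods and facts are given by lists. -/
@[ext] structure ContainmentInput (L : QueryLanguage) where
  sch : List Rel
  acs : List Method
  conf : List Fact
  q₁ : Query
  q₂ : Query
  isSchema : IsSchema sch
  areMethods : AreMethods sch acs
  isConf : IsInstance sch {f | f ∈ conf}
  q₁_boolean : q₁.IsBooleanPQ sch {f | f ∈ conf}
  q₂_boolean : q₂.IsBooleanPQ sch {f | f ∈ conf}
  q₁_mem : L.Mem q₁
  q₂_mem : L.Mem q₂

/-- `q₁` is contained in `q₂` under the access methods, starting from the configuration. -/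
def ContainmentInput.Contained {L : QueryLanguage} (x : ContainmentInput L) : Prop :=
  ∀ I : Set Fact, IsInstance x.sch I → {f | f ∈ x.conf} ⊆ I →
    ∀ C' : Set Fact, Reachable x.acs I {f | f ∈ x.conf} C' → x.q₁.Holds C' → x.q₂.Holds C'

/-- Inputs of the problem of long-term relevance: a query, a configuration and an access that is
well-formed at the configuration. -/
@[ext] structure RelevanceInput (L : QueryLanguage) where
  sch : List Rel
  acs : List Method
  conf : List Fact
  access : Access
  q : Query
  isSchema : IsSchema sch
  areMethods : AreMethods sch acs
  isConf : IsInstance sch {f | f ∈ conf}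
  access_wellFormed : WellFormedAccess acs {f | f ∈ conf} access
  q_boolean : q.IsBooleanPQ sch {f | f ∈ conf}
  q_mem : L.Mem q

/-- The access is long-term relevant for the query at the configuration: on some instance
consistent with the configuration there is a path that begins with the access, such that the
certain answers after the path and after its truncation differ. The truncation drops the first
access and keeps the longest initial part of the rest that is well-formed without it. -/
def RelevanceInput.LongTermRelevant {L : QueryLanguage} (y : RelevanceInput L) : Prop :=
  ∃ I : Set Fact, IsInstance y.sch I ∧ {f | f ∈ y.conf} ⊆ I ∧
    ∃ (r : Set Fact) (p : Path), IsPath y.acs I {f | f ∈ y.conf} ((y.access, r) :: p) ∧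
      ¬ (Certain y.sch y.q (run {f | f ∈ y.conf} ((y.access, r) :: p)) ↔
          Certain y.sch y.q (run {f | f ∈ y.conf} (truncate y.acs {f | f ∈ y.conf} p)))

/-! ### Encoding by words over a finite alphabet, and polynomial time -/

/-- The alphabet. -/
inductive Sym where
  | zero | one | nil | cons | infinite | finite | var | const | atom | conj | disj | ex | period
  deriving DecidableEq

instance : Fintype Sym where
  elems := {.zero, .one, .nil, .cons, .infinite, .finite, .var, .const, .atom, .conj, .disj, .ex,
    .period}
  complete x := by cases x <;> decide

/-- Encodings by words over the alphabet that are uniquely decodable from left to right. -/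
class Encoded (α : Type) where
  enc : α → List Sym
  prefixFree : ∀ a b s t, enc a ++ s = enc b ++ t → a = b ∧ s = t

open Encoded

theorem enc_injective (α : Type) [Encoded α] : Function.Injective (enc : α → List Sym) := by
  intro a b h
  exact (prefixFree a b [] [] (by rw [h])).1

/-- Encoding of the objects of a type by the encoding of their data. -/
@[reducible] def Encoded.ofInjective {α β : Type} [Encoded β] (g : α → β)
    (hg : Function.Injective g) : Encoded α where
  enc a := enc (g a)
  prefixFree a b s t h := ⟨hg (prefixFree _ _ s t h).1, (prefixFree _ _ s t h).2⟩

instance : Encoded Bool where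
  enc b := if b then [Sym.one] else [Sym.zero]
  prefixFree a b s t h := by cases a <;> cases b <;> simp_all

instance {α β : Type} [Encoded α] [Encoded β] : Encoded (α × β) where
  enc p := enc p.1 ++ enc p.2
  prefixFree _ _ _ _ h := by
    simp only [List.append_assoc] at h
    obtain ⟨h1, h⟩ := prefixFree _ _ _ _ h
    obtain ⟨h2, h⟩ := prefixFree _ _ _ _ h
    exact ⟨Prod.ext h1 h2, h⟩

/-- A list is written as its entries, each preceded by `cons`, with a final `nil`. -/
def encList {α : Type} [Encoded α] : List α → List Sym
  | [] => [Sym.nil]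
  | a :: l => Sym.cons :: (enc a ++ encList l)

instance {α : Type} [Encoded α] : Encoded (List α) where
  enc := encList
  prefixFree a b s t h := by
    induction a generalizing b with
    | nil => cases b <;> simp_all [encList]
    | cons x a ih =>
      cases b with
      | nil => simp [encList] at h
      | cons y b =>
        simp only [encList, List.cons_append, List.append_assoc, List.cons.injEq, true_and] at h
        obtain ⟨h1, h⟩ := prefixFree _ _ _ _ h
        obtain ⟨h2, h⟩ := ih b h
        exact ⟨by rw [h1, h2], h⟩

instance : Encoded Domain where
  enc
    | .infinite n => Sym.infinite :: enc n
    | .finite n c cs => Sym.finite :: enc (n, c, cs)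
  prefixFree a b s t h := by
    cases a <;> cases b <;>
      simp only [List.cons_append, List.cons.injEq, true_and, reduceCtorEq, false_and] at h
    · obtain ⟨h1, h⟩ := prefixFree _ _ _ _ h
      exact ⟨by rw [h1], h⟩
    · obtain ⟨h1, h⟩ := prefixFree _ _ _ _ h
      exact ⟨by simpa using h1, h⟩

instance : Encoded Rel :=
  .ofInjective (fun R => (R.name, R.doms)) (by rintro ⟨⟩ ⟨⟩ h; simpa using h)

instance : Encoded Fact :=
  .ofInjective (fun f => (f.rel, f.args)) (by rintro ⟨⟩ ⟨⟩ h; simpa using h)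

instance : Encoded Method :=
  .ofInjective (fun m => (m.rel, m.inputs, m.dependent)) (by rintro ⟨⟩ ⟨⟩ h; simpa using h)

instance : Encoded Access :=
  .ofInjective (fun a => (a.method, a.bind)) (by rintro ⟨⟩ ⟨⟩ h; simpa using h)

instance : Encoded Term where
  enc
    | .var x => Sym.var :: enc x
    | .const c => Sym.const :: enc c
  prefixFree a b s t h := by
    cases a <;> cases b <;>
      simp only [List.cons_append, List.cons.injEq, true_and, reduceCtorEq, false_and] at h <;>
    · obtain ⟨h1, h⟩ := prefixFree _ _ _ _ h
      exact ⟨by rw [h1], h⟩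

/-- Formulas in prefix notation. -/
def encQuery : Query → List Sym
  | .atom R ts => Sym.atom :: enc (R, ts)
  | .and φ ψ => Sym.conj :: (encQuery φ ++ encQuery ψ)
  | .or φ ψ => Sym.disj :: (encQuery φ ++ encQuery ψ)
  | .ex x φ => Sym.ex :: (enc x ++ encQuery φ)

theorem encQuery_prefixFree (a b : Query) (s t : List Sym)
    (h : encQuery a ++ s = encQuery b ++ t) : a = b ∧ s = t := by
  induction a generalizing b s t with
  | atom R ts =>
    cases b <;> simp only [encQuery, List.cons_append, List.cons.injEq, true_and, reduceCtorEq,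
      false_and] at h
    obtain ⟨h1, h⟩ := prefixFree _ _ _ _ h
    exact ⟨by simpa using h1, h⟩
  | and φ ψ ih1 ih2 =>
    cases b <;> simp only [encQuery, List.cons_append, List.cons.injEq, true_and, reduceCtorEq,
      false_and, List.append_assoc] at h
    obtain ⟨h1, h⟩ := ih1 _ _ _ h
    obtain ⟨h2, h⟩ := ih2 _ _ _ h
    exact ⟨by rw [h1, h2], h⟩
  | or φ ψ ih1 ih2 =>
    cases b <;> simp only [encQuery, List.cons_append, List.cons.injEq, true_and, reduceCtorEq,
      false_and, List.append_assoc] at h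
    obtain ⟨h1, h⟩ := ih1 _ _ _ h
    obtain ⟨h2, h⟩ := ih2 _ _ _ h
    exact ⟨by rw [h1, h2], h⟩
  | ex x φ ih =>
    cases b <;> simp only [encQuery, List.cons_append, List.cons.injEq, true_and, reduceCtorEq,
      false_and, List.append_assoc] at h
    obtain ⟨h1, h⟩ := prefixFree _ _ _ _ h
    obtain ⟨h2, h⟩ := ih _ _ _ h
    exact ⟨by rw [h1, h2], h⟩

instance : Encoded Query where
  enc φ := encQuery φ ++ [Sym.period]
  prefixFree _ _ _ _ h := by
    simp only [List.append_assoc] at h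
    obtain ⟨h1, h⟩ := encQuery_prefixFree _ _ _ _ h
    exact ⟨h1, by simpa using h⟩

instance (L : QueryLanguage) : Encoded (ContainmentInput L) :=
  .ofInjective (fun x => (x.sch, x.acs, x.conf, x.q₁, x.q₂)) (by
    intro x y h
    simp only [Prod.mk.injEq] at h
    exact ContainmentInput.ext h.1 h.2.1 h.2.2.1 h.2.2.2.1 h.2.2.2.2)

instance (L : QueryLanguage) : Encoded (RelevanceInput L) :=
  .ofInjective (fun y => (y.sch, y.acs, y.conf, y.access, y.q)) (by
    intro x y h
    simp only [Prod.mk.injEq] at h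
    exact RelevanceInput.ext h.1 h.2.1 h.2.2.1 h.2.2.2.1 h.2.2.2.2)

/-- The function is computed by a Turing machine in time polynomial in the length of the encoding
of its argument. -/
def PolyTime {α β : Type} [Encoded α] [Encoded β] (f : α → β) : Prop :=
  Nonempty (Turing.TM2ComputableInPolyTime (enc : α → List Sym) (enc : β → List Sym) f)

/-- `f` is a polynomial-time many-one reduction from containment to the complement of long-term
relevance. -/
def IsReduction {L : QueryLanguage} (f : ContainmentInput L → RelevanceInput L) : Prop :=
  PolyTime f ∧ ∀ x : ContainmentInput L, x.Contained ↔ ¬ (f x).LongTermRelevant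

end LimitedAccess

namespace LimitedAccess

open Encoded
open Function (update)

/-! Positive queries are monotone, so a query is certain at a finite configuration iff it is true
there. If moreover the responses to the first access enable no further access, then truncation
removes nothing but that response. Hence the access is relevant iff some reachable `C` and some
response `r` make the query true at `C ∪ r` but false at `C`
(`RelevanceInput.longTermRelevant_iff`). Both reductions build a query for which this says that `q₁`
holds and `q₂` fails.

For PQs, a nullary relation `A` with an independent method is added, and the query is `(A() ∧ q₁) ∨
q₂`. Where `A()` has not been accessed, its response makes a false query true exactly if `q₁` holds
and `q₂` fails.

For CQs the disjunction is simulated. Every relation gets a flag, and a `dummy` fact with flag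
`zero` whose values are all the new constant `zero`; thus each CQ is true with flag `zero`. A
disjunction of CQs becomes the conjunction of these CQs with variable flags, together with the
assertion, by a stored table of `∨`, that one of the flags or the accessed flag is `one`. Accesses
may however reveal facts with flag `zero` whose values then serve as inputs for facts with flag
`one`, which has no counterpart in the given problem. Therefore there are further disjuncts,
`sharedQueries`, that are true if facts with different flags share a value. If that happens in `C`,
the query is true at `C` as soon as its `q₁` part is, and the access changes nothing. Otherwise the
facts with flag `one` decode to a path of the given problem (`exists_path_dec`), by an injection
that undoes the renaming of the constants that matter.

For the time bound, structured commands on four stacks are compiled to Turing machines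
(`Exec.iterate`), and the class `Comp` of functions is shown to be closed under composition,
pairing, case distinction and folds with polynomially bounded values. Formulas are handled as lists
of tokens in prefix notation, so that translating a formula is a map over a list and not a recursion
on trees. -/

/-! ### A structured language for stack machines -/

/-- The stacks: the main stack, two scratch stacks, and a stack for saved values. -/
inductive Stk where
  | m | a | b | s
  deriving DecidableEq

instance : Fintype Stk where
  elems := {.m, .a, .b, .s}
  complete x := by cases x <;> decide

/-- Structured commands. `read` pops a symbol and continues according to it; `loop` pops a symbol,
ends if the symbol is a stopping one, and otherwise runs its body and repeats. -/
inductive Cmd where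
  | skip
  | push (k : Stk) (x : Sym)
  | read (k : Stk) (f : Option Sym → Cmd)
  | seq (c d : Cmd)
  | loop (k : Stk) (last : Option Sym → Bool) (f : Option Sym → Cmd)

abbrev Store := Stk → List Sym

/-- Big-step semantics, with the number of passes through loops. -/
inductive Exec : Cmd → Store → Store → ℕ → Prop
  | skip (S : Store) : Exec .skip S S 0
  | push (k : Stk) (x : Sym) (S : Store) : Exec (.push k x) S (update S k (x :: S k)) 0
  | read {k : Stk} {f : Option Sym → Cmd} {S S' : Store} {t : ℕ} :
      Exec (f (S k).head?) (update S k (S k).tail) S' t → Exec (.read k f) S S' t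
  | seq {c d : Cmd} {S S' S'' : Store} {t t' : ℕ} :
      Exec c S S' t → Exec d S' S'' t' → Exec (.seq c d) S S'' (t + t')
  | last {k : Stk} {last : Option Sym → Bool} {f : Option Sym → Cmd} {S : Store} :
      last (S k).head? = true → Exec (.loop k last f) S (update S k (S k).tail) 1
  | step {k : Stk} {last : Option Sym → Bool} {f : Option Sym → Cmd} {S S' S'' : Store} {t t' : ℕ} :
      last (S k).head? = false → Exec (f (S k).head?) (update S k (S k).tail) S' t →
      Exec (.loop k last f) S' S'' t' → Exec (.loop k last f) S S'' (t + t' + 1)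

/-! ### Compilation to stack machines -/

/-- The labels needed for a command. -/
def Cmd.Lab : Cmd → Type
  | .skip => Empty
  | .push _ _ => Empty
  | .read _ f => Σ o, (f o).Lab
  | .seq c d => c.Lab ⊕ d.Lab
  | .loop _ _ f => Option (Σ o, (f o).Lab)

instance Cmd.instFintypeLab : (c : Cmd) → Fintype c.Lab
  | .skip => inferInstanceAs (Fintype Empty)
  | .push _ _ => inferInstanceAs (Fintype Empty)
  | .read _ f =>
    haveI := fun o => (f o).instFintypeLab
    inferInstanceAs (Fintype (Σ o, (f o).Lab))
  | .seq c d =>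
    haveI := c.instFintypeLab
    haveI := d.instFintypeLab
    inferInstanceAs (Fintype (c.Lab ⊕ d.Lab))
  | .loop _ _ f =>
    haveI := fun o => (f o).instFintypeLab
    inferInstanceAs (Fintype (Option (Σ o, (f o).Lab)))

/-- Machine statements over the four stacks; the internal state is the symbol read last. -/
abbrev MStmt (Λ : Type) := Turing.TM2.Stmt (fun _ : Stk => Sym) Λ (Option Sym)

def switchList {Λ : Type} (f : Option Sym → MStmt Λ) : List (Option Sym) → MStmt Λ
  | [] => .halt
  | o :: l => .branch (fun v => decide (v = o)) (f o) (switchList f l)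

/-- Case distinction on the symbol read last. -/
noncomputable def switch {Λ : Type} (f : Option Sym → MStmt Λ) : MStmt Λ :=
  switchList f Finset.univ.toList

theorem stepAux_switch {Λ : Type} (f : Option Sym → MStmt Λ) (v : Option Sym) (S : Store) :
    Turing.TM2.stepAux (switch f) v S = Turing.TM2.stepAux (f v) v S := by
  have key : ∀ l : List (Option Sym), v ∈ l →
      Turing.TM2.stepAux (switchList f l) v S = Turing.TM2.stepAux (f v) v S := by
    intro l
    induction l with
    | nil => simp
    | cons o l ih =>
      intro h
      by_cases hv : v = o
      · subst hv; simp [switchList]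
      · simp [switchList, hv, ih ((List.mem_cons.1 h).resolve_left hv)]
  exact key _ (by simp)

/-- The statement that runs a command and then continues with `q`. -/
noncomputable def Cmd.entry {Λ : Type} : (c : Cmd) → (c.Lab → Λ) → MStmt Λ → MStmt Λ
  | .skip, _, q => q
  | .push k x, _, q => .push k (fun _ => x) q
  | .read k f, e, q => .pop k (fun _ o => o) (switch fun o => (f o).entry (fun l => e ⟨o, l⟩) q)
  | .seq c d, e, q => c.entry (fun l => e (.inl l)) (d.entry (fun l => e (.inr l)) q)
  | .loop _ _ _, e, _ => .goto fun _ => e none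

/-- The statements at the labels of a command. -/
noncomputable def Cmd.code {Λ : Type} : (c : Cmd) → (c.Lab → Λ) → MStmt Λ → c.Lab → MStmt Λ
  | .skip, _, _ => Empty.elim
  | .push _ _, _, _ => Empty.elim
  | .read _ f, e, q => fun l => (f l.1).code (fun l' => e ⟨l.1, l'⟩) q l.2
  | .seq c d, e, q => fun l => match l with
    | .inl l => c.code (fun l => e (.inl l)) (d.entry (fun l => e (.inr l)) q) l
    | .inr l => d.code (fun l => e (.inr l)) q l
  | .loop k last f, e, q => fun l => match l with
    | none => .pop k (fun _ o => o) (switch fun o => bif last o then q else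
        (f o).entry (fun l => e (some ⟨o, l⟩)) (.goto fun _ => e none))
    | some l => (f l.1).code (fun l' => e (some ⟨l.1, l'⟩)) (.goto fun _ => e none) l.2

/-- Only the heads of loops are targets of jumps, and everything between two jumps is a single
machine step; so passes through loops bound the number of steps. The continuation `q` is arbitrary
for the sake of sequencing, and the final internal state is left open because every read overwrites
it. -/
theorem Exec.iterate {c : Cmd} {S S' : Store} {t : ℕ} (h : Exec c S S' t) :
    ∀ {Λ : Type} (M : Λ → MStmt Λ) (e : c.Lab → Λ) (q : MStmt Λ),
      (∀ l, M (e l) = c.code e q l) → ∀ v : Option Sym, ∃ v' : Option Sym, ∃ n ≤ t,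
      (flip bind (Turing.TM2.step M))^[n] (some (Turing.TM2.stepAux (c.entry e q) v S)) =
        some (Turing.TM2.stepAux q v' S') := by
  induction h with
  | skip S => exact fun M e q _ v => ⟨v, 0, le_rfl, rfl⟩
  | push k x S => exact fun M e q _ v => ⟨v, 0, le_rfl, by simp [Cmd.entry]⟩
  | @read k f S S' t _ ih =>
    intro Λ M e q hM v
    obtain ⟨v', n, hn, hi⟩ := ih M (fun l => e ⟨_, l⟩) q (fun l => hM ⟨_, l⟩) (S k).head?
    refine ⟨v', n, hn, ?_⟩
    rw [← hi]
    simp only [Cmd.entry, Turing.TM2.stepAux, stepAux_switch]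
  | @seq c d S S' S'' t t' _ _ ih1 ih2 =>
    intro Λ M e q hM v
    obtain ⟨v1, n1, hn1, h1⟩ := ih1 M (fun l => e (.inl l)) (d.entry (fun l => e (.inr l)) q)
      (fun l => hM (.inl l)) v
    obtain ⟨v2, n2, hn2, h2⟩ := ih2 M (fun l => e (.inr l)) q (fun l => hM (.inr l)) v1
    refine ⟨v2, n2 + n1, by omega, ?_⟩
    rw [Function.iterate_add_apply, Cmd.entry, h1, h2]
  | @last k last f S hs =>
    intro Λ M e q hM v
    refine ⟨(S k).head?, 1, le_rfl, ?_⟩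
    have := hM none
    simp only [Cmd.code] at this
    simp [Cmd.entry, flip, this, stepAux_switch, hs]
  | @step k last f S S' S'' t t' hs _ _ ih1 ih2 =>
    intro Λ M e q hM v
    obtain ⟨v1, n1, hn1, h1⟩ := ih1 M (fun l => e (some ⟨_, l⟩)) (.goto fun _ => e none)
      (fun l => (hM (some ⟨_, l⟩)).trans (by simp only [Cmd.code])) (S k).head?
    obtain ⟨v2, n2, hn2, h2⟩ := ih2 M e q hM v1
    refine ⟨v2, n2 + (n1 + 1), by omega, ?_⟩
    have := hM none
    simp only [Cmd.code] at this
    have h0 : flip bind (Turing.TM2.step M)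
        (some (Turing.TM2.stepAux ((Cmd.loop k last f).entry e q) v S)) =
        some (Turing.TM2.stepAux ((f (S k).head?).entry (fun l => e (some ⟨_, l⟩))
          (.goto fun _ => e none)) (S k).head? (update S k (S k).tail)) := by
      simp [Cmd.entry, flip, this, stepAux_switch, hs]
    rw [Function.iterate_add_apply, Function.iterate_succ_apply, h0, h1]
    exact h2

/-- The machine that runs a command, with the main stack for input and output. -/
noncomputable def Cmd.machine (c : Cmd) : Turing.FinTM2 where
  K := Stk
  k₀ := .m
  k₁ := .m
  Γ _ := Sym
  Λ := Option c.Lab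
  main := none
  σ := Option Sym
  initialState := none
  Γk₀Fin := inferInstanceAs (Fintype Sym)
  m l := match l with
    | none => c.entry some (.load (fun _ => none) .halt)
    | some l => c.code some (.load (fun _ => none) .halt) l

/-- The store with the given stacks. -/
def st (m a b s : List Sym) : Store
  | .m => m
  | .a => a
  | .b => b
  | .s => s

theorem polyTime_of_exec {α β : Type} [Encoded α] [Encoded β] {f : α → β} (c : Cmd)
    (p : Polynomial ℕ)
    (h : ∀ x, ∃ t ≤ p.eval (enc x).length,
      Exec c (st (enc x) [] [] []) (st (enc (f x)) [] [] []) t) : PolyTime f := by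
  refine ⟨⟨⟨c.machine, Equiv.refl _, Equiv.refl _⟩, p + 1, fun x => ?_⟩⟩
  have H : ∃ n ≤ (p + 1).eval (enc x).length, (flip bind c.machine.step)^[n]
      (some (Turing.initList c.machine (enc x))) = some (Turing.haltList c.machine (enc (f x))) := by
    obtain ⟨t, ht, hx⟩ := h x
    obtain ⟨v, n, hn, hi⟩ := hx.iterate c.machine.m some (.load (fun _ => none) .halt)
      (fun _ => rfl) none
    -- The additional step leads from the main label into the command.
    refine ⟨n + 1, by simp; omega, ?_⟩
    have h0 : flip bind c.machine.step (some (Turing.initList c.machine (enc x))) =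
        some (Turing.TM2.stepAux (c.entry some (.load (fun _ => none) .halt)) none
          (st (enc x) [] [] [])) := by
      have : (Turing.initList c.machine (enc x)).stk = st (enc x) [] [] [] := by
        funext k; cases k <;> rfl
      change some (Turing.TM2.stepAux _ _ (Turing.initList c.machine (enc x)).stk) = _
      rw [this]; rfl
    rw [Function.iterate_succ_apply, h0]
    refine hi.trans ?_
    have : (Turing.haltList c.machine (enc (f x))).stk = st (enc (f x)) [] [] [] := by
      funext k; cases k <;> rfl
    rw [← this]; rfl
  choose n hn hi using H
  refine ⟨⟨n, ?_⟩, hn⟩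
  -- The machine model presents both words as images under the identity map of the alphabet, hence
  -- the equations.
  have key : ∀ w w' : List Sym, w = enc x → w' = enc (f x) → (flip bind c.machine.step)^[n]
      (some (Turing.initList c.machine w)) = some (Turing.haltList c.machine w') := by
    rintro _ _ rfl rfl
    exact hi
  exact key _ _ (List.map_id _) (List.map_id _)

/-! ### Running commands with a bound on the time -/

/-- The command leads from `S` to `S'` in time at most `n`. -/
def Runs (c : Cmd) (S S' : Store) (n : ℕ) : Prop := ∃ t ≤ n, Exec c S S' t

theorem Runs.mono {c : Cmd} {S S' : Store} {n n' : ℕ} (h : Runs c S S' n) (hn : n ≤ n') :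
    Runs c S S' n' := by
  obtain ⟨t, ht, h⟩ := h
  exact ⟨t, ht.trans hn, h⟩

theorem Runs.to {c : Cmd} {S S' T : Store} {n : ℕ} (h : Runs c S S' n) (hT : S' = T) :
    Runs c S T n := hT ▸ h

theorem Runs.skip (S : Store) : Runs .skip S S 0 := ⟨0, le_rfl, .skip S⟩

theorem Runs.seq {c d : Cmd} {S S' S'' : Store} {n n' : ℕ} (h : Runs c S S' n)
    (h' : Runs d S' S'' n') : Runs (.seq c d) S S'' (n + n') := by
  obtain ⟨t, ht, h⟩ := h
  obtain ⟨t', ht', h'⟩ := h'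
  exact ⟨t + t', by omega, .seq h h'⟩

theorem Runs.push (k : Stk) (x : Sym) (S : Store) :
    Runs (.push k x) S (update S k (x :: S k)) 0 := ⟨0, le_rfl, .push k x S⟩

theorem Runs.read {k : Stk} {f : Option Sym → Cmd} {S S' : Store} {x : Sym} {w : List Sym} {n : ℕ}
    (hS : S k = x :: w) (h : Runs (f (some x)) (update S k w) S' n) :
    Runs (.read k f) S S' n := by
  obtain ⟨t, ht, h⟩ := h
  exact ⟨t, ht, .read (by simpa [hS] using h)⟩

theorem Runs.read_nil {k : Stk} {f : Option Sym → Cmd} {S S' : Store} {n : ℕ}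
    (hS : S k = []) (h : Runs (f none) S S' n) : Runs (.read k f) S S' n := by
  obtain ⟨t, ht, h⟩ := h
  have e : update S k (S k).tail = S := by
    rw [hS, List.tail_nil, ← hS, Function.update_eq_self]
  exact ⟨t, ht, .read (by rw [e]; simpa [hS] using h)⟩

theorem Runs.last {k : Stk} {last : Option Sym → Bool} {f : Option Sym → Cmd} {S : Store} {x : Sym}
    {w : List Sym} (hS : S k = x :: w) (hx : last (some x) = true) :
    Runs (.loop k last f) S (update S k w) 1 := by
  have := Exec.last (k := k) (last := last) (f := f) (S := S) (by simpa [hS] using hx)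
  exact ⟨1, le_rfl, by simpa [hS] using this⟩

theorem Runs.step {k : Stk} {last : Option Sym → Bool} {f : Option Sym → Cmd} {S S' S'' : Store}
    {x : Sym} {w : List Sym} {n n' : ℕ} (hS : S k = x :: w) (hx : last (some x) = false)
    (h : Runs (f (some x)) (update S k w) S' n) (h' : Runs (.loop k last f) S' S'' n') :
    Runs (.loop k last f) S S'' (n + n' + 1) := by
  obtain ⟨t, ht, h⟩ := h
  obtain ⟨t', ht', h'⟩ := h'
  exact ⟨t + t' + 1, by omega, .step (by simpa [hS] using hx) (by simpa [hS] using h) h'⟩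

@[simp] theorem st_m (m a b s : List Sym) : st m a b s .m = m := rfl
@[simp] theorem st_a (m a b s : List Sym) : st m a b s .a = a := rfl
@[simp] theorem st_b (m a b s : List Sym) : st m a b s .b = b := rfl
@[simp] theorem st_s (m a b s : List Sym) : st m a b s .s = s := rfl

@[simp] theorem update_st_m (m a b s w : List Sym) : update (st m a b s) .m w = st w a b s := by
  funext k; cases k <;> rfl
@[simp] theorem update_st_a (m a b s w : List Sym) : update (st m a b s) .a w = st m w b s := by
  funext k; cases k <;> rfl
@[simp] theorem update_st_b (m a b s w : List Sym) : update (st m a b s) .b w = st m a w s := by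
  funext k; cases k <;> rfl
@[simp] theorem update_st_s (m a b s w : List Sym) : update (st m a b s) .s w = st m a b w := by
  funext k; cases k <;> rfl

/-- Push a word, its first symbol on top. -/
def pushWord (k : Stk) : List Sym → Cmd
  | [] => .skip
  | x :: w => .seq (pushWord k w) (.push k x)

theorem runs_pushWord (k : Stk) (w : List Sym) (S : Store) :
    Runs (pushWord k w) S (update S k (w ++ S k)) 0 := by
  induction w with
  | nil => exact (Runs.skip S).to (by simp)
  | cons x w ih => exact (ih.seq (.push k x _)).to (by simp)

/-- Loop until the stack is empty. -/
def drain (k : Stk) (f : Sym → Cmd) : Cmd :=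
  .loop k (fun o => o.isNone) (fun o => match o with
    | none => .skip
    | some x => f x)

theorem runs_drain_nil {k : Stk} {f : Sym → Cmd} {S : Store} (h : S k = []) :
    Runs (drain k f) S S 1 := by
  refine ⟨1, le_rfl, ?_⟩
  have := Exec.last (k := k) (last := fun o => o.isNone) (f := fun o => match o with
    | none => .skip
    | some x => f x) (S := S) (by simp [h])
  have e : update S k (S k).tail = S := by
    rw [h, List.tail_nil, ← h, Function.update_eq_self]
  rwa [e] at this

theorem runs_drain_cons {k : Stk} {f : Sym → Cmd} {S S' S'' : Store} {x : Sym} {w : List Sym}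
    {n n' : ℕ} (h : S k = x :: w) (h1 : Runs (f x) (update S k w) S' n)
    (h2 : Runs (drain k f) S' S'' n') : Runs (drain k f) S S'' (n + n' + 1) :=
  Runs.step h rfl h1 h2

/-- Move a stack onto another one, in reverse order. -/
def move (k k' : Stk) : Cmd := drain k (fun x => .push k' x)

theorem runs_move {k k' : Stk} (hk : k ≠ k') (w : List Sym) : ∀ S : Store, S k = w →
    Runs (move k k') S (update (update S k []) k' (w.reverse ++ S k')) (w.length + 1) := by
  induction w with
  | nil =>
    intro S h
    refine (runs_drain_nil h).to ?_
    have e : update S k [] = S := by rw [← h, Function.update_eq_self]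
    rw [e]; simp
  | cons x w ih =>
    intro S h
    refine ((runs_drain_cons h (.push k' x _) (ih _ ?_)).to ?_).mono (by simp)
    · simp [hk, Function.update_of_ne]
    · funext j
      by_cases h1 : j = k' <;> by_cases h2 : j = k <;> simp_all [Function.update_apply]

/-- Empty a stack. -/
def clear (k : Stk) : Cmd := drain k (fun _ => .skip)

theorem runs_clear {k : Stk} (w : List Sym) : ∀ S : Store, S k = w →
    Runs (clear k) S (update S k []) (w.length + 1) := by
  induction w with
  | nil =>
    intro S h
    refine (runs_drain_nil h).to ?_
    rw [← h, Function.update_eq_self]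
  | cons x w ih =>
    intro S h
    exact ((runs_drain_cons h (.skip _) (ih _ (by simp))).to (by simp)).mono (by simp)

/-! ### Moving encoded objects -/

/-- The encoding of an object on top of a stack can be recognized and moved to another stack, in
reverse order and in linear time. -/
class Parse (α : Type) [Encoded α] : Prop where
  exists_cmd : ∃ C : ℕ, ∀ k k' : Stk, k ≠ k' → ∃ c : Cmd, ∀ (S : Store) (x : α) (w : List Sym),
    S k = enc x ++ w →
    Runs c S (update (update S k w) k' ((enc x).reverse ++ S k')) (C * (enc x).length)

/-- The constant in the time for moving an object. -/
noncomputable def mvRate (α : Type) [Encoded α] [Parse α] : ℕ :=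
  (Parse.exists_cmd (α := α)).choose

/-- Move an object to another stack. -/
noncomputable def mv (α : Type) [Encoded α] [Parse α] (k k' : Stk) (h : k ≠ k') : Cmd :=
  ((Parse.exists_cmd (α := α)).choose_spec k k' h).choose

theorem runs_mv {α : Type} [Encoded α] [Parse α] {k k' : Stk} (h : k ≠ k') (S : Store) (x : α)
    (w : List Sym) (hS : S k = enc x ++ w) :
    Runs (mv α k k' h) S (update (update S k w) k' ((enc x).reverse ++ S k')) (mvRate α * (enc x).length) :=
  ((Parse.exists_cmd (α := α)).choose_spec k k' h).choose_spec S x w hS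

theorem Parse.of_enc_eq {α β : Type} [Encoded α] [Encoded β] [Parse β] (g : α → β)
    (h : ∀ x, enc x = enc (g x)) : Parse α where
  exists_cmd := ⟨mvRate β, fun k k' hk => ⟨mv β k k' hk, fun S x w hS => by
    rw [h x] at hS ⊢
    exact runs_mv hk S (g x) w hS⟩⟩

instance : Encoded Unit where
  enc _ := []
  prefixFree _ _ _ _ h := ⟨rfl, h⟩

instance : Parse Unit where
  exists_cmd := ⟨0, fun k k' hk => ⟨.skip, fun S x w hS => (Runs.skip S).to (by
    have : S k = w := by simpa [enc] using hS
    simp [enc, ← this])⟩⟩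

/-- The first symbol determines the type `τ` of the remainder. The alphabet is finite, so the sum of
all rates is a common constant. -/
theorem Parse.of_read {α : Type} [Encoded α] (h0 : ∀ x : α, enc x ≠ [])
    (h : ∀ o : Sym, ∃ (τ : Type) (_ : Encoded τ) (_ : Parse τ), ∀ (x : α) (w : List Sym),
      enc x = o :: w → ∃ y : τ, w = enc y) : Parse α where
  exists_cmd := by
    choose τ i1 i2 h using h
    refine ⟨∑ o, mvRate (τ o), fun k k' hk => ?_⟩
    refine ⟨.read k fun o => match o with
      | none => .skip
      | some o => .seq (.push k' o) (mv (τ o) k k' hk), fun S x w hS => ?_⟩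
    obtain ⟨o, v, hv⟩ := List.exists_cons_of_ne_nil (h0 x)
    obtain ⟨y, rfl⟩ := h o x v hv
    rw [hv] at hS ⊢
    refine ((Runs.read hS ((Runs.push k' o _).seq (runs_mv hk _ y w ?_))).to ?_).mono ?_
    · simp [hk, Function.update_of_ne]
    · funext j
      by_cases h1 : j = k' <;> by_cases h2 : j = k <;> simp_all [Function.update_apply]
    · have := Finset.single_le_sum (f := fun o => mvRate (τ o)) (fun _ _ => Nat.zero_le _)
        (Finset.mem_univ o)
      rw [Nat.zero_add]
      exact Nat.mul_le_mul this (by simp)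

instance : Parse Bool :=
  .of_read (by intro x; cases x <;> simp [enc]) (fun o => ⟨Unit, inferInstance, inferInstance, by
    intro x w h
    refine ⟨(), ?_⟩
    cases x <;> simp_all [enc]⟩)

theorem enc_pair {α β : Type} [Encoded α] [Encoded β] (x : α) (y : β) :
    enc (x, y) = enc x ++ enc y := rfl

instance {α β : Type} [Encoded α] [Encoded β] [Parse α] [Parse β] : Parse (α × β) where
  exists_cmd := by
    refine ⟨mvRate α + mvRate β, fun k k' hk => ?_⟩
    refine ⟨.seq (mv α k k' hk) (mv β k k' hk), fun S x w hS => ?_⟩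
    obtain ⟨x, y⟩ := x
    change S k = (enc x ++ enc y) ++ w at hS
    rw [List.append_assoc] at hS
    refine (((runs_mv hk _ x _ hS).seq (runs_mv hk _ y w ?_)).to ?_).mono ?_
    · simp [hk, Function.update_of_ne]
    · funext j
      by_cases h1 : j = k' <;> by_cases h2 : j = k <;> simp_all [enc]
    · simp [enc_pair]; nlinarith

theorem enc_nil {α : Type} [Encoded α] : enc ([] : List α) = [Sym.nil] := rfl

theorem enc_cons {α : Type} [Encoded α] (x : α) (l : List α) :
    enc (x :: l) = Sym.cons :: (enc x ++ enc l) := rfl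

/-- The loop that moves an encoded list, without its final symbol, and with the given word in front
of each entry. -/
noncomputable def mvEntries (α : Type) [Encoded α] [Parse α] (k k' : Stk) (h : k ≠ k')
    (v : List Sym) : Cmd :=
  .loop k (fun o => decide (o = some Sym.nil)) (fun _ => .seq (pushWord k' v) (mv α k k' h))

theorem runs_mvEntries {α : Type} [Encoded α] [Parse α] {k k' : Stk} (hk : k ≠ k') (v : List Sym)
    (l : List α) (w : List Sym) : ∀ S : Store, S k = enc l ++ w →
    Runs (mvEntries α k k' hk v) S
      (update (update S k w) k' ((l.flatMap fun x => v.reverse ++ enc x).reverse ++ S k'))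
      ((mvRate α + 1) * (enc l).length) := by
  induction l with
  | nil =>
    intro S hS
    exact ((Runs.last hS (by simp)).to (by simp [hk.symm, Function.update_of_ne])).mono
      (by simp [enc_nil])
  | cons x l ih =>
    intro S hS
    rw [enc_cons, List.cons_append, List.append_assoc] at hS
    refine ((Runs.step hS (by simp) ((runs_pushWord k' v _).seq
      (runs_mv hk _ x (enc l ++ w) ?_)) (ih _ ?_)).to ?_).mono ?_
    · simp [hk, Function.update_of_ne]
    · simp [hk, Function.update_of_ne]
    · funext j
      by_cases h1 : j = k' <;> by_cases h2 : j = k <;> simp_all [Function.update_apply]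
    · simp [enc_cons]; nlinarith

theorem enc_eq_flatMap {α : Type} [Encoded α] (l : List α) :
    enc l = (l.flatMap fun x => Sym.cons :: enc x) ++ [Sym.nil] := by
  induction l with
  | nil => rfl
  | cons x l ih => rw [enc_cons, ih]; simp

instance {α : Type} [Encoded α] [Parse α] : Parse (List α) where
  exists_cmd := by
    refine ⟨mvRate α + 1, fun k k' hk => ?_⟩
    refine ⟨.seq (mvEntries α k k' hk [.cons]) (.push k' .nil), fun S x w hS => ?_⟩
    refine (((runs_mvEntries hk [.cons] x w S hS).seq (.push k' .nil _)).to ?_).mono (by simp)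
    funext j
    by_cases h1 : j = k' <;> by_cases h2 : j = k <;>
      simp_all [enc_eq_flatMap]

theorem enc_infinite (n : Name) : enc (Domain.infinite n) = Sym.infinite :: enc n := rfl

theorem enc_finite (n : Name) (c : Const) (cs : List Const) :
    enc (Domain.finite n c cs) = Sym.finite :: enc (n, c, cs) := rfl

theorem enc_var (x : Name) : enc (Term.var x) = Sym.var :: enc x := rfl

theorem enc_const (c : Const) : enc (Term.const c) = Sym.const :: enc c := rfl

instance : Parse Domain :=
  .of_read (by intro x; cases x <;> simp [enc]) (fun o => by
    by_cases ho : o = .infinite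
    · refine ⟨Name, inferInstance, inferInstance, fun x w h => ?_⟩
      cases x with
      | infinite n => rw [enc_infinite] at h; exact ⟨n, (List.cons.inj h).2.symm⟩
      | finite n c cs => rw [enc_finite, ho] at h; simp at h
    · refine ⟨Name × Const × List Const, inferInstance, inferInstance, fun x w h => ?_⟩
      cases x with
      | infinite n => rw [enc_infinite] at h; exact absurd (List.cons.inj h).1.symm ho
      | finite n c cs => rw [enc_finite] at h; exact ⟨_, (List.cons.inj h).2.symm⟩)

instance : Parse Rel := .of_enc_eq (fun R => (R.name, R.doms)) (fun _ => rfl)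
instance : Parse Fact := .of_enc_eq (fun f => (f.rel, f.args)) (fun _ => rfl)
instance : Parse Method := .of_enc_eq (fun m => (m.rel, m.inputs, m.dependent)) (fun _ => rfl)
instance : Parse Access := .of_enc_eq (fun a => (a.method, a.bind)) (fun _ => rfl)

instance : Parse Term :=
  .of_read (by intro x; cases x <;> simp [enc]) (fun o => ⟨Name, inferInstance, inferInstance, by
    intro x w h
    cases x with
    | var x => rw [enc_var] at h; exact ⟨x, (List.cons.inj h).2.symm⟩
    | const c => rw [enc_const] at h; exact ⟨c, (List.cons.inj h).2.symm⟩⟩)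

/-! ### Formulas as lists of tokens -/

/-- The tokens of a formula in prefix notation. -/
inductive Tok where
  | atom (p : Rel × List Term)
  | conj
  | disj
  | ex (x : Name)

def Tok.word : Tok → List Sym
  | .atom p => Sym.atom :: enc p
  | .conj => [Sym.conj]
  | .disj => [Sym.disj]
  | .ex x => Sym.ex :: enc x

instance : Encoded Tok where
  enc := Tok.word
  prefixFree a b s t h := by
    cases a <;> cases b <;>
      simp only [Tok.word, List.cons_append, List.cons.injEq, true_and, reduceCtorEq,
        false_and] at h
    · obtain ⟨h1, h⟩ := prefixFree _ _ _ _ h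
      exact ⟨by rw [h1], h⟩
    · exact ⟨rfl, h⟩
    · exact ⟨rfl, h⟩
    · obtain ⟨h1, h⟩ := prefixFree _ _ _ _ h
      exact ⟨by rw [h1], h⟩

theorem enc_tok (t : Tok) : enc t = t.word := rfl

instance : Parse Tok :=
  .of_read (by intro x; cases x <;> simp [enc_tok, Tok.word]) (fun o => by
    by_cases ho : o = .atom
    · refine ⟨Rel × List Term, inferInstance, inferInstance, fun x w h => ?_⟩
      cases x <;> simp_all [enc_tok, Tok.word]
      exact ⟨_, _, h.symm⟩
    by_cases ho' : o = .ex
    · refine ⟨Name, inferInstance, inferInstance, fun x w h => ?_⟩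
      cases x <;> simp_all [enc_tok, Tok.word]
      exact ⟨_, h.symm⟩
    · refine ⟨Unit, inferInstance, inferInstance, fun x w h => ⟨(), ?_⟩⟩
      cases x <;> simp_all [enc_tok, Tok.word] <;> simp_all [enc])

def Query.toks : Query → List Tok
  | .atom R ts => [.atom (R, ts)]
  | .and φ ψ => .conj :: (φ.toks ++ ψ.toks)
  | .or φ ψ => .disj :: (φ.toks ++ ψ.toks)
  | .ex x φ => .ex x :: φ.toks

/-- Prefix notation needs no brackets. A machine can therefore treat a formula as a flat sequence of
tokens that ends with a period. -/
theorem encQuery_eq (φ : Query) : encQuery φ = φ.toks.flatMap enc := by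
  induction φ with
  | atom R ts => simp [encQuery, Query.toks, enc_tok, Tok.word]
  | and φ ψ h1 h2 => simp [encQuery, Query.toks, enc_tok, Tok.word, h1, h2]
  | or φ ψ h1 h2 => simp [encQuery, Query.toks, enc_tok, Tok.word, h1, h2]
  | ex x φ h => simp [encQuery, Query.toks, enc_tok, Tok.word, h]

theorem enc_query (φ : Query) : enc φ = φ.toks.flatMap enc ++ [Sym.period] := by
  rw [← encQuery_eq]; rfl

theorem Tok.exists_word (t : Tok) : ∃ o w, enc t = o :: w ∧ o ≠ .period := by
  cases t <;> simp [enc_tok, Tok.word]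

/-- Move the tokens up to a period, with the given word in front of each of them. -/
noncomputable def mvToks (k k' : Stk) (h : k ≠ k') (v : List Sym) : Cmd :=
  .loop k (fun o => decide (o = some Sym.period)) (fun o => match o with
    | none => .skip
    | some o => .seq (.push k o) (.seq (pushWord k' v) (mv Tok k k' h)))

theorem runs_mvToks {k k' : Stk} (hk : k ≠ k') (v : List Sym) (l : List Tok) (w : List Sym) :
    ∀ S : Store, S k = l.flatMap enc ++ Sym.period :: w →
    Runs (mvToks k k' hk v) S
      (update (update S k w) k' ((l.flatMap fun x => v.reverse ++ enc x).reverse ++ S k'))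
      ((mvRate Tok + 1) * (l.flatMap enc).length + 1) := by
  induction l with
  | nil =>
    intro S hS
    exact ((Runs.last hS (by simp)).to (by simp [hk.symm, Function.update_of_ne])).mono (by simp)
  | cons x l ih =>
    intro S hS
    -- The test of the loop consumes the first symbol `o` of the token; the body pushes it back
    -- before it moves the token.
    obtain ⟨o, u, hu, ho⟩ := x.exists_word
    have hS' : S k = o :: (u ++ (l.flatMap enc ++ Sym.period :: w)) := by
      rw [hS]; simp [hu]
    refine ((Runs.step hS' (by simpa using ho) ((Runs.push k o _).seq
      ((runs_pushWord k' v _).seq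
      (runs_mv hk _ x (l.flatMap enc ++ Sym.period :: w) ?_))) (ih _ ?_)).to ?_).mono ?_
    · simp [hk, hu, Function.update_of_ne]
    · simp [hk, Function.update_of_ne]
    · funext j
      by_cases h1 : j = k' <;> by_cases h2 : j = k <;> simp_all [Function.update_apply]
    · simp [hu]; nlinarith

instance : Parse Query where
  exists_cmd := by
    refine ⟨mvRate Tok + 1, fun k k' hk => ?_⟩
    refine ⟨.seq (mvToks k k' hk []) (.push k' .period), fun S x w hS => ?_⟩
    rw [enc_query] at hS ⊢
    refine (((runs_mvToks hk [] x.toks w S (by simpa using hS)).seq (.push k' .period _)).to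
      ?_).mono (by simp)
    funext j
    by_cases h1 : j = k' <;> by_cases h2 : j = k <;> simp_all

/-! ### A calculus of polynomial-time functions -/

/-- The coefficients are natural numbers. -/
theorem eval_mono (p : Polynomial ℕ) {a b : ℕ} (h : a ≤ b) : p.eval a ≤ p.eval b := by
  induction p using Polynomial.induction_on' with
  | add p q hp hq => simpa using Nat.add_le_add hp hq
  | monomial n c => simpa using Nat.mul_le_mul_left c (Nat.pow_le_pow_left h n)

/-- The function is computed in polynomial time by a command that replaces the argument on top of
the main stack by the value, and leaves everything else on the stacks as it is. -/
def Comp {α β : Type} [Encoded α] [Encoded β] (f : α → β) : Prop :=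
  ∃ (c : Cmd) (p : Polynomial ℕ), ∀ x, (enc (f x)).length ≤ p.eval (enc x).length ∧
    ∀ m s, Runs c (st (enc x ++ m) [] [] s) (st (enc (f x) ++ m) [] [] s) (p.eval (enc x).length)

section
variable {α β γ δ : Type} [Encoded α] [Encoded β] [Encoded γ] [Encoded δ]

theorem Comp.polyTime {f : α → β} (h : Comp f) : PolyTime f := by
  obtain ⟨c, p, h⟩ := h
  exact polyTime_of_exec c p fun x => by
    have := (h x).2 [] []
    rw [List.append_nil, List.append_nil] at this
    exact this

theorem Comp.congr {f g : α → β} (h : Comp f) (hg : ∀ x, f x = g x) : Comp g := by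
  rwa [← funext hg]

/-- `Comp` includes a bound on the length of the value for this purpose: it limits the time of the
second command. -/
theorem Comp.comp {g : β → γ} {f : α → β} (hg : Comp g) (hf : Comp f) : Comp fun x => g (f x) := by
  obtain ⟨c, p, hf⟩ := hf
  obtain ⟨d, q, hg⟩ := hg
  refine ⟨.seq c d, p + q.comp p, fun x => ⟨?_, fun m s => ?_⟩⟩
  · have := eval_mono q (hf x).1
    have := (hg (f x)).1
    simp; omega
  · exact (((hf x).2 m s).seq ((hg (f x)).2 m s)).mono
      (by simpa using eval_mono q (hf x).1)

/-- Functions with the same encoded values. -/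
theorem Comp.of_enc {f : α → β} {g : α → γ} (hf : Comp f) (h : ∀ x, enc (g x) = enc (f x)) :
    Comp g := by
  obtain ⟨c, p, hf⟩ := hf
  exact ⟨c, p, fun x => by rw [h]; exact hf x⟩

/-- Functions that only write a fixed word in front of the encoding. -/
theorem Comp.of_enc_append {g : α → β} (v : List Sym) (h : ∀ x, enc (g x) = v ++ enc x) :
    Comp g := by
  refine ⟨pushWord .m v, Polynomial.X + Polynomial.C v.length, fun x => ⟨?_, fun m s => ?_⟩⟩
  · simp [h, add_comm]
  · exact ((runs_pushWord .m v _).to (by simp [h])).mono (by simp)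

theorem Comp.of_enc_eq {g : α → β} (h : ∀ x, enc (g x) = enc x) : Comp g := .of_enc_append [] h

theorem Comp.id : Comp fun x : α => x := .of_enc_eq fun _ => rfl

/-- Commands that need the encoded argument in the first scratch stack. -/
theorem Comp.of_mv [Parse α] {f : α → β} (c : Cmd) (p : Polynomial ℕ)
    (h : ∀ x, (enc (f x)).length ≤ p.eval (enc x).length ∧
      ∀ m s, Runs c (st m (enc x).reverse [] s) (st (enc (f x) ++ m) [] [] s)
        (p.eval (enc x).length)) : Comp f := by
  refine ⟨.seq (mv α .m .a (by decide)) c, p + Polynomial.C (mvRate α) * Polynomial.X,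
    fun x => ⟨?_, fun m s => ?_⟩⟩
  · have := (h x).1
    simp; omega
  · exact (((runs_mv _ _ x m rfl).to (by simp)).seq ((h x).2 m s)).mono (by simp; omega)

theorem Comp.const [Parse α] (y : β) : Comp fun _ : α => y := by
  refine .of_mv (.seq (clear .a) (pushWord .m (enc y)))
    (Polynomial.X + 1 + Polynomial.C (enc y).length) fun x => ⟨by simp, fun m s => ?_⟩
  exact ((((runs_clear _ _ rfl).to (by simp; rfl)).seq (runs_pushWord .m (enc y) _)).to
    (by simp)).mono (by simp)

/-- The argument lies reversed on `.a`. Popping it writes one copy in the right order on `.m` and a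
second one on `.b`, which then reaches `.m` by two moves. -/
theorem Comp.dup [Parse α] : Comp fun x : α => (x, x) := by
  refine .of_mv (.seq (drain .a fun x => .seq (.push .m x) (.push .b x))
    (.seq (move .b .a) (move .a .m))) (3 * Polynomial.X + 3) fun x => ⟨?_, fun m s => ?_⟩
  · simp [enc_pair]; omega
  · have key : ∀ (w m b : List Sym), Runs (drain .a fun x => .seq (.push .m x) (.push .b x))
        (st m w b s) (st (w.reverse ++ m) [] (w.reverse ++ b) s) (w.length + 1) := by
      intro w
      induction w with
      | nil => exact fun m b => runs_drain_nil rfl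
      | cons x w ih =>
        intro m b
        exact ((runs_drain_cons rfl (((Runs.push .m x _).seq (.push .b x _)).to (by simp; rfl))
          (ih _ _)).to (by simp)).mono (by simp)
    exact (((key _ _ _).seq (((runs_move (by decide) _ _ rfl).to (by simp; rfl)).seq
      (runs_move (by decide) _ _ rfl))).to (by simp [enc_pair])).mono (by simp; omega)

theorem Comp.swap [Parse α] [Parse β] : Comp fun p : α × β => (p.2, p.1) := by
  refine ⟨.seq (mv α .m .a (by decide)) (.seq (mv β .m .b (by decide)) (.seq (move .a .m)
    (move .b .m))), Polynomial.C (mvRate α + mvRate β + 1) * Polynomial.X + 2,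
    fun ⟨x, y⟩ => ⟨?_, fun m s => ?_⟩⟩
  · simp [enc_pair]; nlinarith
  · exact ((((runs_mv _ _ x (enc y ++ m) (by simp [enc_pair])).to (by simp; rfl)).seq
      (((runs_mv _ _ y m (by simp)).to (by simp; rfl)).seq
      (((runs_move (by decide) _ _ rfl).to (by simp; rfl)).seq
      (runs_move (by decide) _ _ rfl)))).to (by simp [enc_pair])).mono
      (by simp [enc_pair]; nlinarith)

/-- Apply a function to the first component. -/
theorem Comp.first {f : α → β} (hf : Comp f) : Comp fun p : α × γ => (f p.1, p.2) := by
  obtain ⟨c, p, h⟩ := hf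
  refine ⟨c, p + Polynomial.X, fun ⟨x, z⟩ => ⟨?_, fun m s => ?_⟩⟩
  · have h1 := (h x).1
    have h2 := eval_mono p (show (enc x).length ≤ (enc (x, z)).length by simp [enc_pair])
    simp only [enc_pair, List.length_append, Polynomial.eval_add, Polynomial.eval_X] at h2 ⊢
    omega
  · have h2 := eval_mono p (show (enc x).length ≤ (enc (x, z)).length by simp [enc_pair])
    have := (h x).2 (enc z ++ m) s
    simp only [← List.append_assoc] at this
    exact this.mono (by simp only [Polynomial.eval_add]; omega)

/-- Duplicate, apply `f` on top, swap, apply `g` on top, and swap back. Commands preserve what lies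
below their argument. -/
theorem Comp.pair [Parse α] [Parse β] [Parse γ] {f : α → β} {g : α → γ} (hf : Comp f)
    (hg : Comp g) : Comp fun x => (f x, g x) :=
  ((Comp.swap (α := γ) (β := β)).comp (((hg.first (γ := β)).comp
    ((Comp.swap (α := β) (β := α)).comp ((hf.first (γ := α)).comp .dup)))))

theorem Comp.snd [Parse α] : Comp fun p : α × β => p.2 := by
  refine ⟨.seq (mv α .m .a (by decide)) (clear .a), Polynomial.C (mvRate α + 1) * Polynomial.X + 1,
    fun ⟨x, y⟩ => ⟨?_, fun m s => ?_⟩⟩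
  · simp [enc_pair]; nlinarith
  · exact ((((runs_mv _ _ x (enc y ++ m) (by simp [enc_pair])).to (by simp; rfl)).seq
      (runs_clear _ _ rfl)).to (by simp)).mono (by simp [enc_pair]; nlinarith)

theorem Comp.fst [Parse α] [Parse β] : Comp fun p : α × β => p.1 :=
  (Comp.snd (α := β) (β := α)).comp .swap

/-- Case distinction on the first symbol of the encoding. -/
theorem Comp.read {f : α → β} (h0 : ∀ x : α, enc x ≠ [])
    (h : ∀ o : Sym, ∃ (τ : Type) (_ : Encoded τ) (g : τ → β), Comp g ∧ ∀ (x : α) (w : List Sym),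
      enc x = o :: w → ∃ y : τ, w = enc y ∧ f x = g y) : Comp f := by
  choose τ i g hg h using h
  choose c p hc using hg
  -- The sum over the alphabet is one bound for all branches; `n` is the length without the first
  -- symbol.
  have key : ∀ o n, (p o).eval n ≤ (∑ o, p o).eval (n + 1) := by
    intro o n
    rw [Polynomial.eval_finsetSum]
    exact (eval_mono (p o) (Nat.le_succ n)).trans (Finset.single_le_sum
      (f := fun o => (p o).eval (n + 1)) (fun _ _ => Nat.zero_le _) (Finset.mem_univ o))
  refine ⟨.read .m fun o => match o with
    | none => .skip
    | some o => c o, ∑ o, p o, fun x => ?_⟩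
  obtain ⟨o, v, hv⟩ := List.exists_cons_of_ne_nil (h0 x)
  obtain ⟨y, rfl, hy⟩ := h o x v hv
  rw [hv, hy]
  refine ⟨((hc o y).1).trans (key _ _), fun m s => ?_⟩
  exact (Runs.read rfl (by simpa using (hc o y).2 m s)).mono (key _ _)

/-! ### Booleans and equality -/

theorem enc_true : enc true = [Sym.one] := rfl
theorem enc_false : enc false = [Sym.zero] := rfl

theorem Comp.cond' {f g : γ → β} (hf : Comp f) (hg : Comp g) :
    Comp fun p : Bool × γ => if p.1 then f p.2 else g p.2 := by
  refine .read (fun ⟨x, z⟩ => by cases x <;> simp [enc_pair, enc_true, enc_false]) fun o => ?_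
  by_cases ho : o = .one
  · refine ⟨γ, inferInstance, f, hf, fun ⟨x, z⟩ w h => ?_⟩
    cases x <;> simp_all [enc_pair, enc_true, enc_false]
    exact ⟨z, h.symm, rfl⟩
  · refine ⟨γ, inferInstance, g, hg, fun ⟨x, z⟩ w h => ?_⟩
    cases x <;> simp_all [enc_pair, enc_true, enc_false]
    exact ⟨z, h.2.symm, rfl⟩

theorem Comp.ite [Parse α] {b : α → Bool} {f g : α → β} (hb : Comp b) (hf : Comp f) (hg : Comp g) :
    Comp fun x => if b x then f x else g x :=
  (Comp.cond' hf hg).comp (Comp.pair hb .id)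

/-- Overwrite the Boolean on top of the main stack. -/
def setFalse : Cmd := .read .m fun _ => .push .m .zero

theorem runs_setFalse (x : Bool) (m a b s : List Sym) :
    Runs setFalse (st (enc x ++ m) a b s) (st (enc false ++ m) a b s) 0 := by
  cases x <;> exact (Runs.read rfl (.push .m .zero _)).to (by simp [enc_false])

/-- Compare the scratch stacks, with the result on the main stack. -/
def compareCmd : Cmd :=
  .seq (.push .m .one) (.seq
    (drain .a fun x => .read .b fun o => if o = some x then .skip else setFalse)
    (drain .b fun _ => setFalse))

/-- The answer `one` is written in advance and overwritten at every mismatch. Draining `.a` detects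
unequal symbols and a second word that is too short; draining the rest of `.b` detects one that is
too long. -/
theorem runs_compare (u v m s : List Sym) :
    Runs compareCmd (st m u v s) (st (enc (decide (u = v)) ++ m) [] [] s)
      (u.length + v.length + 2) := by
  have h1 : ∀ (u v : List Sym) (x : Bool),
      Runs (drain .a fun x => .read .b fun o => if o = some x then .skip else setFalse)
      (st (enc x ++ m) u v s) (st (enc (x && decide (u = v.take u.length)) ++ m) []
        (v.drop u.length) s) (u.length + 1) := by
    intro u
    induction u with
    | nil => intro v x; simpa using runs_drain_nil rfl
    | cons y u ih =>
      intro v x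
      cases v with
      | nil =>
        have := ih [] false
        simp only [List.drop_nil, Bool.false_and] at this
        simpa using (runs_drain_cons rfl ((Runs.read_nil rfl
          (by simpa using runs_setFalse x m u [] s)).to rfl) this).mono (by simp)
      | cons z v =>
        by_cases hz : z = y
        · subst hz
          simpa using (runs_drain_cons rfl (Runs.read (x := z) (w := v) (by simp)
            (by simpa using Runs.skip _)) (ih v x)).mono (by omega)
        · have := ih v false
          have hz' : ¬ y = z := fun h => hz h.symm
          simpa [hz'] using (runs_drain_cons rfl (Runs.read (x := z) (w := v) (by simp)
            (by simpa [hz] using runs_setFalse x m u v s)) (by simpa using this)).mono (by omega)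
  have h2 : ∀ (v : List Sym) (x : Bool), Runs (drain .b fun _ => setFalse)
      (st (enc x ++ m) [] v s) (st (enc (x && decide (v = [])) ++ m) [] [] s) (v.length + 1) := by
    intro v
    induction v with
    | nil => intro x; simpa using runs_drain_nil rfl
    | cons y v ih =>
      intro x
      simpa using (runs_drain_cons rfl (by simpa using runs_setFalse x m [] v s)
        (by simpa using ih false)).mono (by omega)
  have e : (true && decide (u = v.take u.length) && decide (v.drop u.length = [])) =
      decide (u = v) := by
    rw [Bool.eq_iff_iff]
    simp only [Bool.true_and, Bool.and_eq_true, decide_eq_true_eq, List.drop_eq_nil_iff]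
    constructor
    · rintro ⟨h, h'⟩
      rwa [List.take_of_length_le h'] at h
    · rintro rfl
      simp
  rw [← e]
  exact (((Runs.push .m .one _).to (T := st (enc true ++ m) u v s) (by simp [enc_true])).seq
    ((h1 u v true).seq (h2 _ _))).mono (by simp; omega)

theorem Comp.eq' [DecidableEq α] [Parse α] : Comp fun p : α × α => decide (p.1 = p.2) := by
  refine ⟨.seq (mv α .m .a (by decide)) (.seq (mv α .m .b (by decide)) compareCmd),
    Polynomial.C (mvRate α + 1) * Polynomial.X + 2, fun ⟨x, y⟩ => ⟨?_, fun m s => ?_⟩⟩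
  · by_cases h : x = y <;> simp [h, enc_true, enc_false]
  -- Encodings are injective, so equality can be tested on words.
  · have e : decide (x = y) = decide ((enc x).reverse = (enc y).reverse) := by
      simp [(enc_injective α).eq_iff]
    simp only [e]
    exact (((runs_mv _ _ x (enc y ++ m) (by simp [enc_pair])).to (by simp; rfl)).seq
      (((runs_mv _ _ y m (by simp)).to (by simp)).seq (runs_compare _ _ _ _))).mono
      (by simp [enc_pair]; nlinarith)

theorem Comp.eq [DecidableEq β] [Parse α] [Parse β] {f g : α → β} (hf : Comp f) (hg : Comp g) :
    Comp fun x => decide (f x = g x) :=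
  (Comp.eq' (α := β)).comp (hf.pair hg)

/-! ### Codes -/

/-- Four bits for each symbol. -/
def symBits : Sym → List Bool
  | .zero => [false, false, false, false]
  | .one => [false, false, false, true]
  | .nil => [false, false, true, false]
  | .cons => [false, false, true, true]
  | .infinite => [false, true, false, false]
  | .finite => [false, true, false, true]
  | .var => [false, true, true, false]
  | .const => [false, true, true, true]
  | .atom => [true, false, false, false]
  | .conj => [true, false, false, true]
  | .disj => [true, false, true, false]
  | .ex => [true, false, true, true]
  | .period => [true, true, false, false]

/-- The encoding of an object as a bit string. -/
def code (x : α) : List Bool := (enc x).flatMap symBits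

/-- All symbols have codes of the same length, so a concatenation of codes can be split in one way
only. -/
theorem code_injective : Function.Injective (code : α → List Bool) := by
  have key : ∀ u v : List Sym, u.flatMap symBits = v.flatMap symBits → u = v := by
    intro u
    induction u with
    | nil =>
      intro v h
      cases v with
      | nil => rfl
      | cons y v => cases y <;> simp [symBits] at h
    | cons x u ih =>
      intro v h
      cases v with
      | nil => cases x <;> simp [symBits] at h
      | cons y v =>
        have hl : (symBits x).length = (symBits y).length := by cases x <;> cases y <;> rfl
        obtain ⟨h1, h2⟩ := List.append_inj (by simpa using h) hl
        rw [ih v h2]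
        cases x <;> cases y <;> simp_all [symBits]
  exact fun x y h => enc_injective α (key _ _ h)

theorem Comp.code [Parse α] : Comp fun x : α => code x := by
  let W : Sym → List Sym := fun o => (symBits o).flatMap fun b => Sym.cons :: enc b
  have hW : ∀ (o : Sym) (l : List Bool), enc (symBits o ++ l) = W o ++ enc l := by
    intro o l
    simp only [enc_eq_flatMap, List.flatMap_append, List.append_assoc, W]
  have hW' : ∀ o, (W o).length = 8 := by intro o; cases o <;> rfl
  have key : ∀ (u : List Sym) (l : List Bool) (m s : List Sym),
      Runs (drain .a fun o => pushWord .m (W o)) (st (enc l ++ m) u [] s)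
        (st (enc (u.reverse.flatMap symBits ++ l) ++ m) [] [] s) (u.length + 1) := by
    intro u
    induction u with
    | nil => exact fun l m s => runs_drain_nil rfl
    | cons o u ih =>
      intro l m s
      have := ih (symBits o ++ l) m s
      rw [hW] at this
      exact ((runs_drain_cons rfl ((runs_pushWord .m (W o) _).to (by simp; rfl))
        (by simpa using this)).to (by simp)).mono (by simp)
  have hlen : ∀ u : List Sym, (enc (u.flatMap symBits)).length = 8 * u.length + 1 := by
    intro u
    induction u with
    | nil => rfl
    | cons o u ih => rw [List.flatMap_cons, hW, List.length_append, hW', ih]; simp; omega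
  refine .of_mv (.seq (.push .m .nil) (drain .a fun o => pushWord .m (W o)))
    (8 * Polynomial.X + 1) fun x => ⟨?_, fun m s => ?_⟩
  · rw [LimitedAccess.code, hlen]; simp
  · exact ((((Runs.push .m .nil _).to (T := st (enc ([] : List Bool) ++ m) (enc x).reverse [] s)
      (by simp [enc_nil])).seq (key _ _ _ _)).to (by simp [LimitedAccess.code])).mono
      (by simp; omega)

end

section
variable {α β γ δ : Type} [Encoded α] [Encoded β] [Encoded γ] [Encoded δ]

/-! ### Lists -/

/-- The `+ 1` accounts for the final `nil` of the first list, which disappears. -/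
theorem length_enc_append (l l' : List α) :
    (enc (l ++ l')).length + 1 = (enc l).length + (enc l').length := by
  simp only [enc_eq_flatMap, List.flatMap_append, List.length_append, List.length_singleton]
  omega

theorem length_enc_pos (l : List α) : 1 ≤ (enc l).length := by simp [enc_eq_flatMap]

theorem length_enc_flatMap_le (l : List α) (f : α → List β) (K : ℕ)
    (h : ∀ x ∈ l, (enc (f x)).length ≤ K) :
    (enc (l.flatMap f)).length ≤ (enc l).length * K + 1 := by
  induction l with
  | nil => simp [enc_nil]
  | cons x l ih =>
    have h1 := h x (by simp)
    have h2 := ih (fun y hy => h y (by simp [hy]))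
    have h3 := length_enc_append (f x) (l.flatMap f)
    rw [List.flatMap_cons, enc_cons]
    simp
    nlinarith

theorem length_enc_le_of_mem {x : α} {l : List α} (h : x ∈ l) :
    (enc x).length ≤ (enc l).length := by
  obtain ⟨l1, l2, rfl⟩ := List.append_of_mem h
  have h1 := length_enc_append l1 (x :: l2)
  have h2 := length_enc_pos l1
  simp [enc_cons] at h1
  omega

theorem Comp.listCases {f : γ → β} {g : α × List α × γ → β} (hf : Comp f) (hg : Comp g)
    {F : List α × γ → β} (h0 : ∀ z, F ([], z) = f z) (h1 : ∀ x l z, F (x :: l, z) = g (x, l, z)) :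
    Comp F := by
  refine .read (fun ⟨x, z⟩ => by cases x <;> simp [enc_pair, enc_nil, enc_cons]) fun o => ?_
  by_cases ho : o = .nil
  · refine ⟨γ, inferInstance, f, hf, fun ⟨x, z⟩ w h => ?_⟩
    cases x with
    | nil => exact ⟨z, (List.cons.inj h).2.symm, h0 z⟩
    | cons x l => rw [enc_pair, enc_cons, ho] at h; simp at h
  · refine ⟨α × List α × γ, inferInstance, g, hg, fun ⟨x, z⟩ w h => ?_⟩
    cases x with
    | nil => exact absurd (List.cons.inj h).1.symm ho
    | cons x l =>
      refine ⟨(x, l, z), ?_, h1 x l z⟩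
      rw [enc_pair, enc_cons] at h
      simpa [enc_pair] using (List.cons.inj h).2.symm

variable [Parse α] [Parse β] [Parse γ] [Parse δ]

theorem Comp.append' : Comp fun p : List α × List α => p.1 ++ p.2 := by
  refine ⟨.seq (mv (List α) .m .a (by decide)) (.seq (.read .a fun _ => .skip) (move .a .m)),
    Polynomial.C (mvRate (List α) + 1) * Polynomial.X + 1, fun ⟨l, l'⟩ => ⟨?_, fun m s => ?_⟩⟩
  · have := length_enc_append l l'
    simp [enc_pair]; nlinarith
  · have e : (enc l).reverse = Sym.nil :: (l.flatMap fun x => Sym.cons :: enc x).reverse := by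
      simp [enc_eq_flatMap]
    have hl : ((l.flatMap fun x => Sym.cons :: enc x).reverse).length + 1 = (enc l).length := by
      simp [enc_eq_flatMap]
    refine (((runs_mv _ _ l (enc l' ++ m) (by simp [enc_pair])).to
      (T := st (enc l' ++ m) (Sym.nil :: (l.flatMap fun x => Sym.cons :: enc x).reverse) [] s)
      (by simp [e])).seq ((Runs.read rfl (.skip _)).seq
      (runs_move (by decide) (l.flatMap fun x => Sym.cons :: enc x).reverse _ (by simp)))).to
      ?_ |>.mono ?_
    · simp [enc_eq_flatMap]
    · rw [hl]; simp [enc_pair]; nlinarith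

theorem Comp.append {f g : δ → List α} (hf : Comp f) (hg : Comp g) : Comp fun x => f x ++ g x :=
  (Comp.append' (α := α)).comp (hf.pair hg)

theorem Comp.cons {f : δ → α} {g : δ → List α} (hf : Comp f) (hg : Comp g) :
    Comp fun x => f x :: g x :=
  (Comp.of_enc_append (α := α × List α) (g := fun p => p.1 :: p.2) [.cons]
    (fun _ => rfl)).comp (hf.pair hg)

omit [Parse β] in
theorem Comp.foldl {g : α × β → β} (hg : Comp g) (q : Polynomial ℕ)
    (hq : ∀ (l : List α) (y : β),
      (enc (l.foldl (fun y x => g (x, y)) y)).length ≤ q.eval (enc (l, y)).length) :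
    Comp fun p : List α × β => p.1.foldl (fun y x => g (x, y)) p.2 := by
  obtain ⟨c, p, hc⟩ := hg
  let C := Cmd.loop .s (fun o => decide (o = some Sym.nil))
    (fun _ => .seq (mv α .s .a (by decide)) (.seq (move .a .m) c))
  have key : ∀ (K : ℕ) (m s : List Sym) (l : List α) (y : β),
      (∀ l1 x l2, l = l1 ++ x :: l2 →
        p.eval (enc (x, l1.foldl (fun y x => g (x, y)) y)).length ≤ K) →
      Runs C (st (enc y ++ m) [] [] (enc l ++ s))
        (st (enc (l.foldl (fun y x => g (x, y)) y) ++ m) [] [] s)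
        ((enc l).length * (mvRate α + 2 + K)) := by
    intro K m s l
    induction l with
    | nil =>
      intro y _
      exact ((Runs.last (x := .nil) (w := s) rfl (by simp)).to (by simp)).mono (by simp [enc_nil]; omega)
    | cons x l ih =>
      intro y hK
      have h1 := hK [] x l rfl
      have h2 := ih (g (x, y)) (fun l1 z l2 h => hK (x :: l1) z l2 (by simp [h]))
      have h3 := (hc (x, y)).2 m (enc l ++ s)
      rw [enc_pair, List.append_assoc] at h3
      refine (Runs.step (x := .cons) (w := enc x ++ (enc l ++ s)) (by simp [enc_cons]) (by simp)
        (((runs_mv _ _ x (enc l ++ s) (by simp)).to (by simp; rfl)).seq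
        (((runs_move (by decide) _ _ rfl).to (by simp)).seq h3)) h2).mono ?_
      rw [enc_pair] at h1
      simp only [List.foldl_nil] at h1
      simp [enc_cons] at h1 ⊢
      nlinarith [h1]
  refine ⟨.seq (mv (List α) .m .a (by decide)) (.seq (move .a .s) C),
    Polynomial.C (mvRate (List α)) * Polynomial.X + Polynomial.X + 1 +
      Polynomial.X * (Polynomial.C (mvRate α + 2) + p.comp (Polynomial.X + q)) + q,
    fun ⟨l, y⟩ => ⟨?_, fun m s => ?_⟩⟩
  · exact (hq l y).trans (by simp only [Polynomial.eval_add]; omega)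
  -- Since `hq` holds for all lists, it applies to the prefix `l1` and so bounds each intermediate
  -- accumulator.
  · have hK : ∀ l1 x l2, l = l1 ++ x :: l2 →
        p.eval (enc (x, l1.foldl (fun y x => g (x, y)) y)).length ≤
        (p.comp (Polynomial.X + q)).eval (enc (l, y)).length := by
      intro l1 x l2 hl
      have h1 := hq l1 y
      have h2 := length_enc_append l1 (x :: l2)
      have h3 := length_enc_pos l2
      rw [← hl] at h2
      have h4 : (enc (x :: l2)).length = 1 + (enc x).length + (enc l2).length := by
        simp [enc_cons]; omega
      have h5 := eval_mono q (show (enc (l1, y)).length ≤ (enc (l, y)).length by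
        simp [enc_pair]; omega)
      rw [Polynomial.eval_comp]
      refine eval_mono p ?_
      rw [enc_pair, List.length_append, Polynomial.eval_add, Polynomial.eval_X]
      have : (enc x).length ≤ (enc (l, y)).length := by simp [enc_pair]; omega
      omega
    have h := key _ m s l y hK
    refine (((runs_mv _ _ l (enc y ++ m) (by simp [enc_pair])).to (by simp; rfl)).seq
      (((runs_move (by decide) _ _ rfl).to (by simp)).seq h)).mono ?_
    simp only [Polynomial.eval_add, Polynomial.eval_mul, Polynomial.eval_C, Polynomial.eval_X,
      Polynomial.eval_one, st_a, List.length_reverse, enc_pair, List.length_append]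
    nlinarith [Nat.zero_le ((p.comp (Polynomial.X + q)).eval ((enc l).length + (enc y).length))]

theorem Comp.flatMap' {g : γ × α → List β} (hg : Comp g) :
    Comp fun p : List α × γ => p.1.flatMap fun x => g (p.2, x) := by
  -- The parameter `z` travels with the accumulator, because the step of a fold has no access to an
  -- environment.
  have e : ∀ (l : List α) (z : γ) (acc : List β),
      l.foldl (fun (y : γ × List β) x => (y.1, y.2 ++ g (y.1, x))) (z, acc) =
        (z, acc ++ l.flatMap fun x => g (z, x)) := by
    intro l z
    induction l with
    | nil => simp
    | cons x l ih => intro acc; simp [ih]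
  have hstep : Comp fun p : α × γ × List β => (p.2.1, p.2.2 ++ g (p.2.1, p.1)) := by
    have h1 : Comp fun p : α × γ × List β => p.2.1 := Comp.fst.comp .snd
    exact h1.pair ((Comp.snd.comp .snd).append (hg.comp (h1.pair .fst)))
  obtain ⟨_, p, hp⟩ := hg
  have hf := Comp.foldl hstep (Polynomial.X + Polynomial.X * p + 1) (by
    intro l ⟨z, acc⟩
    dsimp only
    rw [e]
    have h1 := length_enc_append acc (l.flatMap fun x => g (z, x))
    have h2 := length_enc_flatMap_le l (fun x => g (z, x)) (p.eval (enc (l, (z, acc))).length) (by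
      intro x hx
      refine (hp (z, x)).1.trans (eval_mono p ?_)
      have := length_enc_le_of_mem hx
      simp [enc_pair]; omega)
    simp only [enc_pair, List.length_append, Polynomial.eval_add, Polynomial.eval_mul,
      Polynomial.eval_X, Polynomial.eval_one] at h2 ⊢
    nlinarith [Nat.zero_le (p.eval ((enc l).length + ((enc z).length + (enc acc).length)))])
  exact (Comp.snd.comp (hf.comp (Comp.pair .fst (Comp.pair .snd (.const [])))) |>.congr
    fun x => by dsimp only; rw [e]; simp)

theorem Comp.flatMap {l : δ → List α} {g : δ → α → List β} (hl : Comp l)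
    (hg : Comp fun p : δ × α => g p.1 p.2) : Comp fun x => (l x).flatMap (g x) :=
  (Comp.flatMap' hg).comp (hl.pair .id)

theorem Comp.map {l : δ → List α} {g : δ → α → β} (hl : Comp l)
    (hg : Comp fun p : δ × α => g p.1 p.2) : Comp fun x => (l x).map (g x) :=
  (Comp.flatMap (g := fun x y => [g x y]) hl (hg.cons (.const []))).congr fun x => by
    rw [List.map_eq_flatMap]

/-- A fold over the first list; its state is the unused rest of the second list and the output so
far. -/
theorem Comp.zip' : Comp fun p : List α × List β => p.1.zip p.2 := by
  let step : α × List β × List (α × β) → List β × List (α × β) := fun p => match p.2.1 with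
    | [] => ([], p.2.2)
    | y :: l => (l, p.2.2 ++ [(p.1, y)])
  have e : ∀ (l : List α) (l' : List β) (acc : List (α × β)),
      l.foldl (fun y x => step (x, y)) (l', acc) = (l'.drop l.length, acc ++ l.zip l') := by
    intro l
    induction l with
    | nil => simp
    | cons x l ih =>
      intro l' acc
      cases l' with
      | nil => simp [step, ih]
      | cons y l' => simp [step, ih]
  have hstep : Comp step := by
    have h : Comp fun q : List β × α × List (α × β) => step (q.2.1, q.1, q.2.2) := by
      refine .listCases (f := fun z : α × List (α × β) => (([] : List β), z.2))
        (g := fun z : β × List β × α × List (α × β) => (z.2.1, z.2.2.2 ++ [(z.2.2.1, z.1)]))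
        ((Comp.const []).pair .snd) ?_ (fun z => rfl) (fun x l z => rfl)
      have h2 : Comp fun z : β × List β × α × List (α × β) => z.2.2 := Comp.snd.comp .snd
      exact (Comp.fst.comp .snd).pair ((Comp.snd.comp h2).append
        (((Comp.fst.comp h2).pair .fst).cons (.const [])))
    exact h.comp (f := fun p : α × List β × List (α × β) => (p.2.1, p.1, p.2.2))
      ((Comp.fst.comp .snd).pair (Comp.fst.pair (Comp.snd.comp .snd)))
  have hz : ∀ (l : List α) (l' : List β), (enc (l.zip l')).length + (enc (l'.drop l.length)).length ≤
      (enc l).length + (enc l').length := by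
    intro l
    induction l with
    | nil => intro l'; simp [enc_nil]
    | cons x l ih =>
      intro l'
      cases l' with
      | nil => simpa [enc_nil] using length_enc_pos _
      | cons y l' =>
        have := ih l'
        simp [enc_cons, enc_pair]
        omega
  have hf := Comp.foldl hstep Polynomial.X (by
    intro l ⟨l', acc⟩
    rw [e]
    have h1 := hz l l'
    have h2 := length_enc_append acc (l.zip l')
    simp only [enc_pair, List.length_append, Polynomial.eval_X]
    omega)
  exact (Comp.snd.comp (hf.comp (Comp.pair .fst (Comp.pair .snd (.const [])))) |>.congr
    fun x => by dsimp only; rw [e]; simp)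

theorem Comp.zip {f : δ → List α} {g : δ → List β} (hf : Comp f) (hg : Comp g) :
    Comp fun x => (f x).zip (g x) :=
  (Comp.zip' (α := α) (β := β)).comp (hf.pair hg)

/-- The unary numerals below the length of a list. -/
def numerals (l : List α) : List Name := (List.range l.length).map fun i => List.replicate i true

/-- A fold that ignores the entries; its state is the next numeral and the output so far. The output
has quadratic length because the numerals are unary. -/
theorem Comp.numerals : Comp fun l : List α => numerals l := by
  have hstep : Comp fun p : α × Name × List Name => (true :: p.2.1, p.2.2 ++ [p.2.1]) := by
    have h1 : Comp fun p : α × Name × List Name => p.2.1 := Comp.fst.comp .snd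
    exact ((Comp.const true).cons h1).pair ((Comp.snd.comp .snd).append (h1.cons (.const [])))
  have hrep : ∀ (i : ℕ) (k : Name), (enc (List.replicate i true ++ k)).length =
      2 * i + (enc k).length := by
    intro i k
    induction i with
    | zero => simp
    | succ i ih => rw [List.replicate_succ, List.cons_append, enc_cons]; simp [ih, enc_true]; omega
  have e' : ∀ (l : List α) (k : Name) (acc : List Name),
      l.foldl (fun (y : Name × List Name) _ => (true :: y.1, y.2 ++ [y.1]))
        (k, acc) = (List.replicate l.length true ++ k,
          acc ++ (List.range l.length).map fun i => List.replicate i true ++ k) := by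
    intro l
    induction l with
    | nil => simp
    | cons x l ih =>
      intro k acc
      rw [List.foldl_cons, ih, List.length_cons, List.range_succ_eq_map]
      have hc : ∀ i : ℕ, List.replicate i true ++ true :: k = true :: (List.replicate i true ++ k) := by
        intro i
        induction i with
        | zero => rfl
        | succ i ih => simp [List.replicate_succ, ih]
      simp [Function.comp_def, List.replicate_succ, hc]
  have hn : ∀ l : List α, l.length ≤ (enc l).length := by
    intro l
    induction l with
    | nil => simp
    | cons x l ih => simp [enc_cons]; omega
  have hm : ∀ (n N : ℕ) (k : Name), n ≤ N → (enc ((List.range n).map fun i =>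
      List.replicate i true ++ k)).length ≤ n * (2 * N + (enc k).length + 1) + 1 := by
    intro n N k
    induction n with
    | zero => simp [enc_nil]
    | succ n ih =>
      intro hN
      have := ih (by omega)
      rw [List.range_succ, List.map_append]
      have h1 := length_enc_append ((List.range n).map fun i => List.replicate i true ++ k)
        (([n] : List ℕ).map fun i => List.replicate i true ++ k)
      have h2 := hrep n k
      simp [enc_cons, enc_nil] at h1 ⊢
      rw [h2] at h1
      nlinarith
  have hf := Comp.foldl hstep (3 * Polynomial.X + Polynomial.X * (3 * Polynomial.X + 1) + 1) (by
    intro l ⟨k, acc⟩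
    dsimp only
    rw [e']
    have h1 := hm l.length l.length k le_rfl
    have h2 := length_enc_append acc ((List.range l.length).map fun i => List.replicate i true ++ k)
    have h3 := hrep l.length k
    have h4 := hn l
    simp only [enc_pair, List.length_append] at h1 h2 h3 ⊢
    simp
    nlinarith)
  exact (Comp.snd.comp (hf.comp (Comp.pair .id (.const ([], [])))) |>.congr
    fun x => by dsimp only; rw [e']; simp [LimitedAccess.numerals])

end

section
variable {α β γ δ : Type} [Encoded α] [Encoded β] [Encoded γ] [Encoded δ]

/-! ### Objects of a schema -/

theorem Comp.infinite {f : δ → Name} (hf : Comp f) : Comp fun x => Domain.infinite (f x) :=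
  (Comp.of_enc_append (g := Domain.infinite) [.infinite] (fun _ => rfl)).comp hf

theorem Comp.domainCases {f : Name × γ → β} {g : (Name × Const × List Const) × γ → β} (hf : Comp f)
    (hg : Comp g) {F : Domain × γ → β} (h0 : ∀ n z, F (.infinite n, z) = f (n, z))
    (h1 : ∀ n c cs z, F (.finite n c cs, z) = g ((n, c, cs), z)) : Comp F := by
  refine .read (fun ⟨x, z⟩ => by cases x <;> simp [enc_pair, enc_infinite, enc_finite]) fun o => ?_
  by_cases ho : o = .infinite
  · refine ⟨Name × γ, inferInstance, f, hf, fun ⟨x, z⟩ w h => ?_⟩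
    cases x with
    | infinite n => exact ⟨(n, z), (List.cons.inj h).2.symm, h0 n z⟩
    | finite n c cs => rw [enc_pair, enc_finite, ho] at h; simp at h
  · refine ⟨_, inferInstance, g, hg, fun ⟨x, z⟩ w h => ?_⟩
    cases x with
    | infinite n => exact absurd (List.cons.inj h).1.symm ho
    | finite n c cs => exact ⟨((n, c, cs), z), (List.cons.inj h).2.symm, h1 n c cs z⟩

theorem Comp.termCases {f g : Name × γ → β} (hf : Comp f) (hg : Comp g) {F : Term × γ → β}
    (h0 : ∀ n z, F (.var n, z) = f (n, z)) (h1 : ∀ c z, F (.const c, z) = g (c, z)) : Comp F := by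
  refine .read (fun ⟨x, z⟩ => by cases x <;> simp [enc_pair, enc_var, enc_const]) fun o => ?_
  by_cases ho : o = .var
  · refine ⟨Name × γ, inferInstance, f, hf, fun ⟨x, z⟩ w h => ?_⟩
    cases x with
    | var n => exact ⟨(n, z), (List.cons.inj h).2.symm, h0 n z⟩
    | const c => rw [enc_pair, enc_const, ho] at h; simp at h
  · refine ⟨Name × γ, inferInstance, g, hg, fun ⟨x, z⟩ w h => ?_⟩
    cases x with
    | var n => exact absurd (List.cons.inj h).1.symm ho
    | const c => exact ⟨(c, z), (List.cons.inj h).2.symm, h1 c z⟩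

theorem Comp.tokCases {f : Rel × List Term → β} {g : Name → β} {u v : Unit → β} (hf : Comp f)
    (hg : Comp g) (hu : Comp u) (hv : Comp v) {F : Tok → β} (h0 : ∀ p, F (.atom p) = f p)
    (h1 : ∀ x, F (.ex x) = g x) (h2 : F .conj = u ()) (h3 : F .disj = v ()) : Comp F := by
  refine .read (fun x => by cases x <;> simp [enc_tok, Tok.word]) fun o => ?_
  by_cases ho : o = .atom
  · refine ⟨_, inferInstance, f, hf, fun x w h => ?_⟩
    cases x <;> simp [enc_tok, Tok.word, ho] at h
    rename_i p
    exact ⟨p, h.symm, h0 p⟩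
  by_cases ho' : o = .ex
  · refine ⟨_, inferInstance, g, hg, fun x w h => ?_⟩
    cases x <;> simp [enc_tok, Tok.word, ho'] at h
    rename_i p
    exact ⟨p, h.symm, h1 p⟩
  by_cases ho'' : o = .conj
  · refine ⟨_, inferInstance, u, hu, fun x w h => ?_⟩
    cases x <;> simp [enc_tok, Tok.word, ho''] at h
    exact ⟨(), by rw [h]; rfl, h2⟩
  · refine ⟨_, inferInstance, v, hv, fun x w h => ?_⟩
    cases x <;> simp [enc_tok, Tok.word] at h
    · exact absurd h.1.symm ho
    · exact absurd h.1.symm ho''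
    · exact ⟨(), by rw [h.2]; rfl, h3⟩
    · exact absurd h.1.symm ho'

theorem Comp.var {f : δ → Name} (hf : Comp f) : Comp fun x => Term.var (f x) :=
  (Comp.of_enc_append (g := Term.var) [.var] (fun _ => rfl)).comp hf

theorem Comp.constTerm {f : δ → Const} (hf : Comp f) : Comp fun x => Term.const (f x) :=
  (Comp.of_enc_append (g := Term.const) [.const] (fun _ => rfl)).comp hf

variable [Parse δ]

theorem Comp.finite {f : δ → Name} {g : δ → Const} {h : δ → List Const} (hf : Comp f) (hg : Comp g)
    (hh : Comp h) : Comp fun x => Domain.finite (f x) (g x) (h x) :=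
  (Comp.of_enc_append (α := Name × Const × List Const) (g := fun p => Domain.finite p.1 p.2.1 p.2.2)
    [.finite] (fun _ => rfl)).comp (hf.pair (hg.pair hh))

theorem Comp.rel {f : δ → Name} {g : δ → List Domain} (hf : Comp f) (hg : Comp g) :
    Comp fun x => Rel.mk (f x) (g x) :=
  (Comp.of_enc_eq (α := Name × List Domain) (g := fun p => Rel.mk p.1 p.2) (fun _ => rfl)).comp
    (hf.pair hg)

omit [Parse δ] in
theorem Comp.relName {f : δ → Rel} (hf : Comp f) : Comp fun x => (f x).name :=
  Comp.fst.comp ((Comp.of_enc_eq (g := fun R : Rel => (R.name, R.doms)) (fun _ => rfl)).comp hf)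

omit [Parse δ] in
theorem Comp.relDoms {f : δ → Rel} (hf : Comp f) : Comp fun x => (f x).doms :=
  Comp.snd.comp ((Comp.of_enc_eq (g := fun R : Rel => (R.name, R.doms)) (fun _ => rfl)).comp hf)

theorem Comp.fact {f : δ → Rel} {g : δ → List Const} (hf : Comp f) (hg : Comp g) :
    Comp fun x => Fact.mk (f x) (g x) :=
  (Comp.of_enc_eq (α := Rel × List Const) (g := fun p => Fact.mk p.1 p.2) (fun _ => rfl)).comp
    (hf.pair hg)

omit [Parse δ] in
theorem Comp.factRel {f : δ → Fact} (hf : Comp f) : Comp fun x => (f x).rel :=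
  Comp.fst.comp ((Comp.of_enc_eq (g := fun R : Fact => (R.rel, R.args)) (fun _ => rfl)).comp hf)

omit [Parse δ] in
theorem Comp.factArgs {f : δ → Fact} (hf : Comp f) : Comp fun x => (f x).args :=
  Comp.snd.comp ((Comp.of_enc_eq (g := fun R : Fact => (R.rel, R.args)) (fun _ => rfl)).comp hf)

theorem Comp.method {f : δ → Rel} {g : δ → List Bool} {h : δ → Bool} (hf : Comp f) (hg : Comp g)
    (hh : Comp h) : Comp fun x => Method.mk (f x) (g x) (h x) :=
  (Comp.of_enc_eq (α := Rel × List Bool × Bool) (g := fun p => Method.mk p.1 p.2.1 p.2.2)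
    (fun _ => rfl)).comp (hf.pair (hg.pair hh))

omit [Parse δ] in
theorem Comp.methodData {f : δ → Method} (hf : Comp f) :
    Comp fun x => ((f x).rel, (f x).inputs, (f x).dependent) :=
  (Comp.of_enc_eq (g := fun m : Method => (m.rel, m.inputs, m.dependent)) (fun _ => rfl)).comp hf

theorem Comp.access {f : δ → Method} {g : δ → List Const} (hf : Comp f) (hg : Comp g) :
    Comp fun x => Access.mk (f x) (g x) :=
  (Comp.of_enc_eq (α := Method × List Const) (g := fun p => Access.mk p.1 p.2) (fun _ => rfl)).comp
    (hf.pair hg)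

/-! ### Formulas -/

theorem Comp.atom {f : δ → Rel} {g : δ → List Term} (hf : Comp f) (hg : Comp g) :
    Comp fun x => Query.atom (f x) (g x) := by
  have : Comp fun p : Rel × List Term => Query.atom p.1 p.2 := by
    refine .of_mv (.seq (.push .m .period) (.seq (move .a .m) (.push .m .atom)))
      (Polynomial.X + 2) fun ⟨R, ts⟩ => ⟨?_, fun m s => ?_⟩
    · simp [enc_query, Query.toks, enc_tok, Tok.word]
    · refine (((Runs.push .m .period _).to (by simp; rfl)).seq
        (((runs_move (by decide) _ _ rfl).to (by simp; rfl)).seq (.push .m .atom _))).to ?_ |>.mono ?_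
      · simp [enc_query, Query.toks, enc_tok, Tok.word]
      · simp
  exact this.comp (f := fun x => (f x, g x)) (hf.pair hg)

/-- Two encoded formulas are joined by deleting the period of the first. After the move it is on top
of `.a`, so a single pop removes it. -/
theorem Comp.binary {F : Query → Query → Query} (o : Sym)
    (hF : ∀ φ ψ, enc (F φ ψ) = o :: (φ.toks.flatMap enc ++ enc ψ)) {f g : δ → Query} (hf : Comp f)
    (hg : Comp g) : Comp fun x => F (f x) (g x) := by
  have : Comp fun p : Query × Query => F p.1 p.2 := by
    refine ⟨.seq (mv Query .m .a (by decide)) (.seq (.read .a fun _ => .skip) (.seq (move .a .m)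
      (.push .m o))), Polynomial.C (mvRate Query + 1) * Polynomial.X + 1,
      fun ⟨φ, ψ⟩ => ?_⟩
    have h1 : (enc φ).length = (φ.toks.flatMap enc).length + 1 := by simp [enc_query]
    have h2 : (enc (φ, ψ)).length = (enc φ).length + (enc ψ).length := by simp [enc_pair]
    have h3 := Nat.mul_le_mul_left (mvRate Query)
      (show (enc φ).length ≤ (enc (φ, ψ)).length by omega)
    have h4 : (Polynomial.C (mvRate Query + 1) * Polynomial.X + 1).eval (enc (φ, ψ)).length =
        mvRate Query * (enc (φ, ψ)).length + (enc (φ, ψ)).length + 1 := by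
      simp; ring
    refine ⟨?_, fun m s => ?_⟩
    · change (enc (F φ ψ)).length ≤ _
      rw [hF, h4, List.length_cons, List.length_append]
      omega
    · refine (((runs_mv _ _ φ (enc ψ ++ m) (by simp [enc_pair])).to
        (T := st (enc ψ ++ m) (Sym.period :: (φ.toks.flatMap enc).reverse) [] s)
        (by simp [enc_query])).seq ((Runs.read rfl (.skip _)).seq
        (((runs_move (by decide) (φ.toks.flatMap enc).reverse _ (by simp)).to (by simp; rfl)).seq
        (.push .m o _)))).to ?_ |>.mono ?_
      · simp [hF]
      · rw [h4, List.length_reverse]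
        omega
  exact this.comp (f := fun x => (f x, g x)) (hf.pair hg)

theorem Comp.and {f g : δ → Query} (hf : Comp f) (hg : Comp g) :
    Comp fun x => Query.and (f x) (g x) :=
  .binary .conj (fun φ ψ => by simp [enc_query, Query.toks, enc_tok, Tok.word]) hf hg

theorem Comp.or {f g : δ → Query} (hf : Comp f) (hg : Comp g) :
    Comp fun x => Query.or (f x) (g x) :=
  .binary .disj (fun φ ψ => by simp [enc_query, Query.toks, enc_tok, Tok.word]) hf hg

theorem Comp.ex {f : δ → Name} {g : δ → Query} (hf : Comp f) (hg : Comp g) :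
    Comp fun x => Query.ex (f x) (g x) :=
  (Comp.of_enc_append (α := Name × Query) (g := fun p => Query.ex p.1 p.2) [.ex] (fun p => by
    obtain ⟨x, φ⟩ := p
    simp [enc_query, Query.toks, enc_tok, Tok.word, enc_pair])).comp (hf.pair hg)

theorem length_enc_toks (φ : Query) : (enc φ.toks).length ≤ 2 * (enc φ).length := by
  rw [enc_query, enc_eq_flatMap]
  have : ∀ l : List Tok, (l.flatMap fun x => Sym.cons :: enc x).length ≤
      2 * (l.flatMap enc).length := by
    intro l
    induction l with
    | nil => simp
    | cons x l ih =>
      obtain ⟨o, w, h, _⟩ := x.exists_word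
      rw [List.flatMap_cons, List.flatMap_cons, h]
      simp only [List.length_append, List.length_cons]
      omega
  have := this φ.toks
  simp only [List.length_append, List.length_singleton]
  omega

theorem Comp.toks : Comp Query.toks := by
  refine ⟨.seq (mvToks .m .a (by decide) [.cons]) (.seq (.push .a .nil) (move .a .m)),
    Polynomial.C (mvRate Tok + 3) * Polynomial.X + 2, fun φ => ⟨?_, fun m s => ?_⟩⟩
  · have := length_enc_toks φ
    simp; nlinarith
  · have e := enc_eq_flatMap φ.toks
    have h1 := length_enc_toks φ
    refine (((runs_mvToks _ [.cons] φ.toks m _ (by simp [enc_query])).to (by simp; rfl)).seq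
      (((Runs.push .a .nil _).to (T := st m (enc φ.toks).reverse [] s) (by simp [e])).seq
      (runs_move (by decide) _ _ rfl))).to (by simp) |>.mono ?_
    simp only [st_a, List.length_reverse]
    simp [enc_query] at h1 ⊢
    nlinarith

/-- With `Comp.toks` this replaces recursion on formulas by operations on lists. To turn a list of
tokens into a formula, the `cons` before each entry is removed and the final `nil` becomes a period.
-/
theorem Comp.of_toks {f : α → Query} (h : Comp fun x => (f x).toks) : Comp f := by
  obtain ⟨c, p, h⟩ := h
  have e : ∀ l : List Tok, (l.flatMap enc).length + 1 ≤ (enc l).length := by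
    intro l
    induction l with
    | nil => simp [enc_nil]
    | cons x l ih => rw [enc_cons]; simp at ih ⊢; omega
  refine ⟨.seq c (.seq (mvEntries Tok .m .a (by decide) []) (.seq (.push .m .period) (move .a .m))),
    p * Polynomial.C (mvRate Tok + 3) + p, fun x => ⟨?_, fun m s => ?_⟩⟩
  · have h1 := e (f x).toks
    have h2 := (h x).1
    rw [enc_query]
    simp at h1 ⊢
    nlinarith
  · have h1 := e (f x).toks
    have h2 := (h x).1
    refine (((h x).2 m s).seq (((runs_mvEntries _ [] _ m _ rfl).to (by simp; rfl)).seq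
      (((Runs.push .m .period _).to (by simp; rfl)).seq
      (runs_move (by decide) _ _ rfl)))).to (by simp [enc_query]) |>.mono ?_
    simp only [st_a]
    simp at h1 ⊢
    nlinarith

end

/-! ### Paths and certain answers -/

theorem Query.Eval.mono {I J : Set Fact} (h : I ⊆ J) {φ : Query} :
    ∀ {v : Name → Const}, φ.Eval I v → φ.Eval J v := by
  induction φ with
  | atom R ts => exact fun hv => h hv
  | and φ ψ h1 h2 => exact fun hv => ⟨h1 hv.1, h2 hv.2⟩
  | or φ ψ h1 h2 => exact fun hv => hv.imp h1 h2
  | ex x φ ih => exact fun ⟨c, hv⟩ => ⟨c, ih hv⟩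

theorem IsInstance.subset {sch : List Rel} {I J : Set Fact} (h : IsInstance sch J) (hI : I ⊆ J) :
    IsInstance sch I :=
  ⟨h.1.subset hI, fun f hf => h.2 f (hI hf)⟩

/-- The configuration is the least instance that contains it, and positive queries are monotone. -/
theorem certain_iff {sch : List Rel} {φ : Query} {C : Set Fact} (h : IsInstance sch C) :
    Certain sch φ C ↔ φ.Holds C :=
  ⟨fun hc => hc C h subset_rfl, fun hc _ _ hI => Query.Eval.mono hI hc⟩

theorem subset_run (p : Path) : ∀ C : Set Fact, C ⊆ run C p := by
  induction p with
  | nil => exact fun C => subset_rfl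
  | cons a p ih => exact fun C => Set.subset_union_left.trans (ih _)

theorem IsPath.run_subset {acs : List Method} {I : Set Fact} {p : Path} :
    ∀ {C : Set Fact}, IsPath acs I C p → C ⊆ I → run C p ⊆ I := by
  induction p with
  | nil => exact fun _ h => h
  | cons a p ih =>
    intro C h hC
    exact ih h.2.2 (Set.union_subset hC fun f hf => (h.2.1 hf).1)

theorem run_union (p : Path) (r : Set Fact) : ∀ C : Set Fact, run (C ∪ r) p = run C p ∪ r := by
  induction p with
  | nil => exact fun C => rfl
  | cons a p ih =>
    intro C
    change run (C ∪ r ∪ a.2) p = run (C ∪ a.2) p ∪ r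
    rw [Set.union_right_comm, ih]

theorem adom_mono {C D : Set Fact} (h : C ⊆ D) : adom C ⊆ adom D :=
  fun _ ⟨f, hf, hp⟩ => ⟨f, h hf, hp⟩

theorem WellFormedAccess.mono {acs acs' : List Method} {C D : Set Fact} {a : Access}
    (h : WellFormedAccess acs C a) (hacs : acs ⊆ acs') (hC : C ⊆ D) :
    WellFormedAccess acs' D a :=
  ⟨hacs h.1, h.2.1, fun hd p hp => adom_mono hC (h.2.2 hd p hp)⟩

theorem IsPath.mono {acs acs' : List Method} {I J : Set Fact} (hacs : acs ⊆ acs') (hI : I ⊆ J)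
    {p : Path} : ∀ {C D : Set Fact}, IsPath acs I C p → C ⊆ D → IsPath acs' J D p := by
  induction p with
  | nil => exact fun _ _ => trivial
  | cons a p ih =>
    intro C D h hC
    exact ⟨h.1.mono hacs hC, h.2.1.trans fun f hf => ⟨hI hf.1, hf.2⟩,
      ih h.2.2 (Set.union_subset_union_left _ hC)⟩

theorem IsPath.truncate_eq {acs : List Method} {I : Set Fact} {p : Path} :
    ∀ {C : Set Fact}, IsPath acs I C p → truncate acs C p = p := by
  induction p with
  | nil => exact fun _ => rfl
  | cons a p ih =>
    intro C h
    rw [truncate, if_pos h.1, ih h.2.2]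

/-- The facts of `r` enable no access, so they can be taken out of every configuration along the
path. -/
theorem IsPath.of_union {acs : List Method} {I r : Set Fact}
    (hr : ∀ C a, WellFormedAccess acs (C ∪ r) a → WellFormedAccess acs C a) {p : Path} :
    ∀ {C : Set Fact}, IsPath acs I (C ∪ r) p → IsPath acs I C p := by
  induction p with
  | nil => exact fun _ => trivial
  | cons a p ih =>
    intro C h
    refine ⟨hr _ _ h.1, h.2.1, ih ?_⟩
    have := h.2.2
    rwa [Set.union_right_comm] at this

/-- Long-term relevance of an access whose responses do not make any further access well-formed. -/
theorem RelevanceInput.longTermRelevant_iff {L : QueryLanguage} (y : RelevanceInput L)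
    (hw : ∀ r : Set Fact, (∀ f ∈ r, f.rel = y.access.method.rel) →
      ∀ C a, WellFormedAccess y.acs (C ∪ r) a → WellFormedAccess y.acs C a) :
    y.LongTermRelevant ↔ ∃ I : Set Fact, IsInstance y.sch I ∧ {f | f ∈ y.conf} ⊆ I ∧
      ∃ r ⊆ matching I y.access, ∃ C, Reachable y.acs I {f | f ∈ y.conf} C ∧
        y.q.Holds (C ∪ r) ∧ ¬ y.q.Holds C := by
  constructor
  · rintro ⟨I, hI, hC, r, p, ⟨-, hr, hp⟩, hq⟩
    have hp' := hp.of_union (hw r fun f hf => (hr hf).2.1)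
    refine ⟨I, hI, hC, r, hr, run {f | f ∈ y.conf} p, ⟨p, hp', rfl⟩, ?_⟩
    have h1 := hI.subset (hp'.run_subset hC)
    have h2 := hI.subset (hp.run_subset (Set.union_subset hC fun f hf => (hr hf).1))
    rw [hp'.truncate_eq, run, certain_iff h1, certain_iff h2, run_union] at hq
    -- By monotonicity a response never makes the query false, so only one kind of difference is
    -- possible.
    by_cases h : y.q.Holds (run {f | f ∈ y.conf} p)
    · exact absurd (iff_of_true (Query.Eval.mono Set.subset_union_left h) h) hq
    · exact ⟨by_contra fun h' => hq (iff_of_false h' h), h⟩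
  · rintro ⟨I, hI, hC, r, hr, _, ⟨p, hp, rfl⟩, hq, hq'⟩
    have hp' : IsPath y.acs I ({f | f ∈ y.conf} ∪ r) p :=
      hp.mono (List.Subset.refl _) subset_rfl Set.subset_union_left
    refine ⟨I, hI, hC, r, p, ⟨y.access_wellFormed, hr, hp'⟩, ?_⟩
    have h1 := hI.subset (hp.run_subset hC)
    have h2 := hI.subset (hp'.run_subset (Set.union_subset hC fun f hf => (hr hf).1))
    rw [hp.truncate_eq, run, certain_iff h1, certain_iff h2, run_union]
    exact fun h => hq' (h.1 hq)

theorem ContainmentInput.not_contained_iff {L : QueryLanguage} (x : ContainmentInput L) :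
    ¬ x.Contained ↔ ∃ I : Set Fact, IsInstance x.sch I ∧ {f | f ∈ x.conf} ⊆ I ∧
      ∃ C, Reachable x.acs I {f | f ∈ x.conf} C ∧ x.q₁.Holds C ∧ ¬ x.q₂.Holds C := by
  simp only [Contained]
  push Not
  rfl

/-- Atoms of a well-typed formula are over `sch`. This makes the given queries blind to the relation
added by the reduction. -/
theorem Query.WellTyped.eval_congr {sch : List Rel} {C I J : Set Fact}
    (hIJ : ∀ f : Fact, f.rel ∈ sch → (f ∈ I ↔ f ∈ J)) {φ : Query} :
    ∀ {Γ : Name → Domain}, φ.WellTyped sch C Γ → ∀ v, (φ.Eval I v ↔ φ.Eval J v) := by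
  induction φ with
  | atom R ts => exact fun h v => hIJ _ h.1
  | and φ ψ h1 h2 => exact fun h v => and_congr (h1 h.1 v) (h2 h.2 v)
  | or φ ψ h1 h2 => exact fun h v => or_congr (h1 h.1 v) (h2 h.2 v)
  | ex x φ ih => exact fun ⟨D, h⟩ v => exists_congr fun c => ih h _

theorem Query.WellTyped.mono {sch sch' : List Rel} {C C' : Set Fact} (hs : sch ⊆ sch')
    (hC : C ⊆ C') {φ : Query} :
    ∀ {Γ : Name → Domain}, φ.WellTyped sch C Γ → φ.WellTyped sch' C' Γ := by
  induction φ with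
  | atom R ts =>
    refine fun h => ⟨hs h.1, h.2.imp fun t D ht => ?_⟩
    cases t with
    | var x => exact ht
    | const c => exact adom_mono hC ht
  | and φ ψ h1 h2 => exact fun h => ⟨h1 h.1, h2 h.2⟩
  | or φ ψ h1 h2 => exact fun h => ⟨h1 h.1, h2 h.2⟩
  | ex x φ ih => exact fun ⟨D, h⟩ => ⟨D, ih h⟩

/-- Free variables matter for well-typedness only. -/
theorem Query.WellTyped.congr {sch : List Rel} {C : Set Fact} {φ : Query} :
    ∀ {Γ Δ : Name → Domain}, φ.WellTyped sch C Γ → (∀ x ∈ φ.freeVars, Γ x = Δ x) →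
      φ.WellTyped sch C Δ := by
  induction φ with
  | atom R ts =>
    intro Γ Δ h hx
    refine ⟨h.1, ?_⟩
    have h2 := h.2
    simp only [freeVars, Set.mem_ofPred_eq] at hx
    generalize R.doms = Ds at h2 ⊢
    clear h
    induction h2 with
    | nil => exact .nil
    | @cons t D ts Ds ht _ ih =>
      refine .cons ?_ (ih fun x h => hx x (by simp [h]))
      cases t with
      | var x => exact (hx x (by simp)).symm.trans ht
      | const c => exact ht
  | and φ ψ h1 h2 =>
    exact fun h hx => ⟨h1 h.1 fun x hx' => hx x (.inl hx'), h2 h.2 fun x hx' => hx x (.inr hx')⟩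
  | or φ ψ h1 h2 =>
    exact fun h hx => ⟨h1 h.1 fun x hx' => hx x (.inl hx'), h2 h.2 fun x hx' => hx x (.inr hx')⟩
  | ex x φ ih =>
    rintro Γ Δ ⟨D, h⟩ hx
    refine ⟨D, ih h fun y hy => ?_⟩
    by_cases hyx : y = x
    · simp [hyx]
    · simpa [hyx] using hx y ⟨hy, hyx⟩

/-! ### The reduction for positive queries -/

namespace PQ

/-- A name that is longer than the names in the schema. -/
def fresh (sch : List Rel) : Name := false :: sch.flatMap Rel.name

theorem fresh_notMem (sch : List Rel) : fresh sch ∉ sch.map Rel.name := by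
  intro h
  obtain ⟨R, hR, h⟩ := List.mem_map.1 h
  have h1 : R.name.length ≤ (sch.flatMap Rel.name).length := by
    obtain ⟨l1, l2, rfl⟩ := List.append_of_mem hR
    simp; omega
  rw [h] at h1
  simp [fresh] at h1

/-- The new relation, without attributes. -/
def newRel (sch : List Rel) : Rel := ⟨fresh sch, []⟩

/-- The new access method, which is independent. -/
def newMethod (sch : List Rel) : Method := ⟨newRel sch, [], false⟩

def newQuery (sch : List Rel) (q₁ q₂ : Query) : Query :=
  .or (.and (.atom (newRel sch) []) q₁) q₂

theorem newRel_notMem (sch : List Rel) : newRel sch ∉ sch :=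
  fun h => fresh_notMem sch (List.mem_map_of_mem h)

/-- The reduction: the query is `(A() ∧ q₁) ∨ q₂`, and the access is to `A`. -/
def reduction (x : ContainmentInput .PQ) : RelevanceInput .PQ where
  sch := newRel x.sch :: x.sch
  acs := newMethod x.sch :: x.acs
  conf := x.conf
  access := ⟨newMethod x.sch, []⟩
  q := newQuery x.sch x.q₁ x.q₂
  isSchema := List.nodup_cons.2 ⟨fresh_notMem x.sch, x.isSchema⟩
  areMethods m hm := by
    rcases List.mem_cons.1 hm with rfl | hm
    · exact ⟨by simp [newMethod], rfl⟩
    · exact ⟨List.mem_cons_of_mem _ (x.areMethods m hm).1, (x.areMethods m hm).2⟩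
  isConf := ⟨x.isConf.1, fun f hf =>
    ⟨List.mem_cons_of_mem _ (x.isConf.2 f hf).1, (x.isConf.2 f hf).2⟩⟩
  access_wellFormed := ⟨by simp, by simp [Access.inputDoms, newMethod, select],
    by simp [newMethod]⟩
  q_boolean := by
    obtain ⟨h1, Γ1, w1⟩ := x.q₁_boolean
    obtain ⟨h2, Γ2, w2⟩ := x.q₂_boolean
    refine ⟨by simp [newQuery, Query.freeVars, h1, h2], Γ1, ⟨⟨by simp, .nil⟩, ?_⟩, ?_⟩
    · exact w1.mono (List.subset_cons_self _ _) subset_rfl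
    · exact (w2.congr (by simp [h2])).mono (List.subset_cons_self _ _) subset_rfl
  q_mem := trivial

/-- Nullary facts contain no values. -/
theorem adom_union {sch : List Rel} {C r : Set Fact} (hr : ∀ f ∈ r, f.rel = newRel sch) :
    adom (C ∪ r) ⊆ adom C := by
  rintro p ⟨f, hf | hf, hp⟩
  · exact ⟨f, hf, hp⟩
  · rw [hr f hf] at hp
    simp [newRel] at hp

/-- Accesses to the new relation are deleted. The others stay well-formed, since nullary facts
supply no values for dependent methods. -/
theorem reachable_restrict (x : ContainmentInput .PQ) {I : Set Fact} {p : Path} :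
    ∀ {C : Set Fact}, (∀ f ∈ C, f.rel ∈ newRel x.sch :: x.sch) →
      IsPath (reduction x).acs I C p →
      ∃ p', IsPath x.acs {f ∈ I | f.rel ∈ x.sch} {f ∈ C | f.rel ∈ x.sch} p' ∧
        run {f ∈ C | f.rel ∈ x.sch} p' = {f ∈ run C p | f.rel ∈ x.sch} := by
  induction p with
  | nil => exact fun _ _ => ⟨[], trivial, rfl⟩
  | cons a p ih =>
    obtain ⟨a, r⟩ := a
    rintro C hC ⟨hw, hr, hp⟩
    have hA : adom C ⊆ adom {f ∈ C | f.rel ∈ x.sch} := by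
      rintro p ⟨f, hf, hp⟩
      rcases List.mem_cons.1 (hC f hf) with h | h
      · rw [h] at hp
        simp [newRel] at hp
      · exact ⟨f, ⟨hf, h⟩, hp⟩
    rcases List.mem_cons.1 hw.1 with ha | ha
    · have hr' : ∀ f ∈ r, f.rel = newRel x.sch := fun f hf => by rw [(hr hf).2.1, ha]; rfl
      obtain ⟨p', h1, h2⟩ := ih (C := C ∪ r) (by
        rintro f (hf | hf)
        · exact hC f hf
        · simp [hr' f hf]) hp
      have e : {f ∈ C ∪ r | f.rel ∈ x.sch} = {f ∈ C | f.rel ∈ x.sch} := by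
        ext f
        simp only [Set.mem_union, Set.mem_ofPred_eq, and_congr_left_iff, or_iff_left_iff_imp]
        intro h hf
        exact absurd (hr' f hf ▸ h) (newRel_notMem _)
      rw [e] at h1 h2
      exact ⟨p', h1, h2⟩
    · have hr' : ∀ f ∈ r, f.rel ∈ x.sch := fun f hf => by
        rw [(hr hf).2.1]; exact (x.areMethods _ ha).1
      obtain ⟨p', h1, h2⟩ := ih (C := C ∪ r) (by
        rintro f (hf | hf)
        · exact hC f hf
        · exact List.mem_cons_of_mem _ (hr' f hf)) hp
      have e : {f ∈ C ∪ r | f.rel ∈ x.sch} = {f ∈ C | f.rel ∈ x.sch} ∪ r := by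
        ext f
        have := hr' f
        simp only [Set.mem_union, Set.mem_ofPred_eq]
        tauto
      rw [e] at h1 h2
      refine ⟨(a, r) :: p', ⟨⟨ha, hw.2.1, fun hd q hq => hA (hw.2.2 hd q hq)⟩,
        fun f hf => ⟨⟨(hr hf).1, hr' f hf⟩, (hr hf).2⟩, h1⟩, h2⟩

theorem contained_iff (x : ContainmentInput .PQ) :
    x.Contained ↔ ¬ (reduction x).LongTermRelevant := by
  have hw : ∀ r : Set Fact, (∀ f ∈ r, f.rel = (reduction x).access.method.rel) → ∀ C a,
      WellFormedAccess (reduction x).acs (C ∪ r) a → WellFormedAccess (reduction x).acs C a :=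
    fun r hr C a h => ⟨h.1, h.2.1, fun hd p hp => adom_union hr (h.2.2 hd p hp)⟩
  rw [(reduction x).longTermRelevant_iff hw, ← not_iff_not, x.not_contained_iff, not_not]
  obtain ⟨-, Γ1, w1⟩ := x.q₁_boolean
  obtain ⟨-, Γ2, w2⟩ := x.q₂_boolean
  constructor
  · rintro ⟨I, hI, hC, C, ⟨p, hp, rfl⟩, h1, h2⟩
    have hsub := hp.run_subset hC
    -- The path lives on an instance of the old schema, so the disjunct with `A()` is false at its
    -- end.
    have hA : ⟨newRel x.sch, []⟩ ∉ run {f | f ∈ x.conf} p := fun h =>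
      newRel_notMem _ (hI.2 _ (hsub h)).1
    refine ⟨insert ⟨newRel x.sch, []⟩ I, ⟨hI.1.insert _, ?_⟩, hC.trans (Set.subset_insert _ _),
      {⟨newRel x.sch, []⟩}, ?_, _, ⟨p, hp.mono (List.subset_cons_self _ _) (Set.subset_insert _ _)
        subset_rfl, rfl⟩, ?_, ?_⟩
    · rintro f (rfl | hf)
      · exact ⟨by simp [reduction], .nil⟩
      · exact ⟨List.mem_cons_of_mem _ (hI.2 f hf).1, (hI.2 f hf).2⟩
    · rintro f rfl
      exact ⟨Set.mem_insert _ _, rfl, rfl⟩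
    · exact .inl ⟨.inr rfl, Query.Eval.mono Set.subset_union_left h1⟩
    · rintro (⟨h, -⟩ | h)
      · exact hA h
      · exact h2 h
  · rintro ⟨I, hI, hC, r, hr, C, ⟨p, hp, rfl⟩, h1, h2⟩
    obtain ⟨p', hp', e⟩ := reachable_restrict x (fun f hf => (hI.2 f (hC hf)).1) hp
    have hconf : {f ∈ {f | f ∈ x.conf} | f.rel ∈ x.sch} = {f | f ∈ x.conf} := by
      ext f
      exact ⟨fun h => h.1, fun h => ⟨h, (x.isConf.2 f h).1⟩⟩
    have hcr : {f ∈ {f | f ∈ (reduction x).conf} | f.rel ∈ x.sch} = {f | f ∈ x.conf} := hconf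
    rw [hcr] at hp' e
    have hev : ∀ f : Fact, f.rel ∈ x.sch →
        (f ∈ run {f | f ∈ (reduction x).conf} p ↔ f ∈ run {f | f ∈ x.conf} p') := by
      intro f hf
      rw [e]
      exact ⟨fun h => ⟨h, hf⟩, fun h => h.1⟩
    -- The response is over the new relation only, hence the old facts before and after it are the
    -- same.
    have hev' : ∀ f : Fact, f.rel ∈ x.sch →
        (f ∈ run {f | f ∈ (reduction x).conf} p ∪ r ↔ f ∈ run {f | f ∈ x.conf} p') := by
      intro f hf
      rw [← hev f hf]
      refine or_iff_left fun h => ?_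
      have h' : f.rel = newRel x.sch := (hr h).2.1
      exact newRel_notMem x.sch (h' ▸ hf)
    refine ⟨{f ∈ I | f.rel ∈ x.sch}, ⟨hI.1.subset fun f hf => hf.1,
      fun f hf => ⟨hf.2, (hI.2 f hf.1).2⟩⟩, fun f hf => ⟨hC hf, (x.isConf.2 f hf).1⟩, _,
      ⟨p', hp', rfl⟩, ?_, ?_⟩
    · rcases h1 with ⟨-, h⟩ | h
      · exact (w1.eval_congr hev' _).1 h
      · exact absurd (.inr ((w2.eval_congr hev _).2 ((w2.eval_congr hev' _).1 h))) h2
    · exact fun h => h2 (.inr ((w2.eval_congr hev _).2 h))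

theorem comp_reduction :
    Comp fun d : List Rel × List Method × List Fact × Query × Query =>
      (newRel d.1 :: d.1, newMethod d.1 :: d.2.1, d.2.2.1, Access.mk (newMethod d.1) [],
        newQuery d.1 d.2.2.2.1 d.2.2.2.2) := by
  have hs : Comp fun d : List Rel × List Method × List Fact × Query × Query => d.1 := .fst
  have h2 : Comp fun d : List Rel × List Method × List Fact × Query × Query => d.2 := .snd
  have h3 : Comp fun d : List Rel × List Method × List Fact × Query × Query => d.2.2 := .comp .snd h2
  have h4 : Comp fun d : List Rel × List Method × List Fact × Query × Query => d.2.2.2 :=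
    .comp .snd h3
  have hR : Comp fun d : List Rel × List Method × List Fact × Query × Query => newRel d.1 :=
    .rel ((Comp.const false).cons (.flatMap (g := fun _ R => R.name) hs (.relName .snd)))
      (.const [])
  have hM : Comp fun d : List Rel × List Method × List Fact × Query × Query => newMethod d.1 :=
    .method hR (.const []) (.const false)
  exact (hR.cons hs).pair ((hM.cons (.comp .fst h2)).pair ((Comp.comp .fst h3).pair
    ((hM.access (.const [])).pair
      ((((hR.atom (.const [])).and (.comp .fst h4))).or (.comp .snd h4)))))

theorem isReduction : IsReduction reduction := by
  have h : Comp fun x : ContainmentInput .PQ => (x.sch, x.acs, x.conf, x.q₁, x.q₂) :=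
    .of_enc_eq fun _ => rfl
  exact ⟨Comp.polyTime (.of_enc (comp_reduction.comp h) fun _ => rfl), contained_iff⟩

end PQ

/-! ### The reduction for conjunctive queries

Facts get a flag as an additional argument. For each relation there is a dummy fact with flag `zero`,
and constants are renamed so that the constant of the dummy facts is new. The query says that `q₁`
holds in the facts with flag `one`, and that the fact `A(one)` has been accessed, or `q₂` holds in
the facts with flag `one`, or some value is shared by a fact with flag `zero` and a fact with flag
`one`. Disjunctions are expressed with the table of the Boolean operation. -/

namespace CQ

/-- The empty string is outside the range of `lift`, so it can be both a flag and the value of all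
dummy facts. -/
def zero : Const := []
def one : Const := [true]

/-- The renaming of constants. -/
def lift (c : Const) : Const := true :: c

/-- The domain of the flags. -/
def bitDom : Domain := .finite [] one [zero]

/-- The domain with its constants renamed, and with `zero` as an additional value. -/
def dom : Domain → Domain
  | .infinite n => .infinite n
  | .finite n c cs => .finite n zero (lift c :: cs.map lift)

theorem lift_injective : Function.Injective lift := fun _ _ h => (List.cons.inj h).2

theorem lift_ne_zero (c : Const) : lift c ≠ zero := by simp [lift, zero]

theorem one_ne_zero : one ≠ zero := by simp [one, zero]

/-- Tracing a value back to the given problem requires that its new domain determines the old one.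
-/
theorem dom_injective : Function.Injective dom := by
  intro D E h
  cases D <;> cases E <;> simp_all [dom, lift_injective.eq_iff,
    (List.map_injective_iff.2 lift_injective).eq_iff]

/-- A translated finite domain lists `zero` first, while `bitDom` lists `one` first. Consequently
flags never justify a dependent access. -/
theorem dom_ne_bitDom (D : Domain) : dom D ≠ bitDom := by
  cases D <;> simp [dom, bitDom, one, zero]

theorem zero_mem_dom (D : Domain) : zero ∈ (dom D).values := by
  cases D
  · exact Set.mem_univ _
  · exact List.mem_cons_self

theorem lift_mem_dom {c : Const} {D : Domain} (h : c ∈ D.values) : lift c ∈ (dom D).values := by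
  cases D with
  | infinite n => exact Set.mem_univ _
  | finite n d cs =>
    refine List.mem_cons_of_mem _ ?_
    rw [← List.map_cons]
    exact List.mem_map_of_mem h

theorem zero_mem_bitDom : zero ∈ bitDom.values := by
  change zero ∈ [one, zero]; simp

theorem one_mem_bitDom : one ∈ bitDom.values := by
  change one ∈ [one, zero]; simp

/-- The relation with a flag as an additional attribute. -/
def rel (R : Rel) : Rel := ⟨true :: R.name, bitDom :: R.doms.map dom⟩

theorem rel_injective : Function.Injective rel := by
  rintro ⟨n, l⟩ ⟨n', l'⟩ h
  simpa [rel, (List.map_injective_iff.2 dom_injective).eq_iff] using h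

/-- The relation whose access is the input of the relevance problem. -/
def switchRel : Rel := ⟨[], [bitDom]⟩

/-- The relation for the table of disjunction. -/
def orRel : Rel := ⟨[false], [bitDom, bitDom, bitDom]⟩

/-- The relation for the values of constants: the constants if the flag is `one`, and the dummy if
the flag is `zero`. -/
def regRel (l : List (Const × Domain)) : Rel :=
  ⟨[false, false], bitDom :: l.map fun p => dom p.2⟩

/-- The flag is an output attribute, so bindings are as in the given problem, but facts with either
flag may be returned. -/
def method (m : Method) : Method := ⟨rel m.rel, false :: m.inputs, m.dependent⟩

def switchMethod : Method := ⟨switchRel, [true], false⟩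

def orTable : List (List Const) :=
  [[zero, zero, zero], [zero, one, one], [one, zero, one], [one, one, one]]

/-- The image of a fact, with flag `one`. -/
def up (f : Fact) : Fact := ⟨rel f.rel, one :: f.args.map lift⟩

/-- The dummy fact of a relation. -/
def dummy (R : Rel) : Fact := ⟨rel R, zero :: R.doms.map fun _ => zero⟩

/-! #### Variables -/

/-- `sVar` is the flag of a disjunct, `oVar` the disjunction of the earlier flags, and `tVar` an
intermediate value. In the names of all other variables the position of the first `true` tells their
kind. -/
def sVar : Name := []
def oVar : Name := [false]
def tVar : Name := [false, false]

/-- The variables of the given queries, renamed. -/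
def user (x : Name) : Name := true :: x

/-- The variables for the constants of the given query. -/
def reg (p : Const × Domain) : Name := false :: true :: code p

def zVar (k : Name) : Name := false :: false :: true :: k
def wVar (k : Name) : Name := false :: false :: false :: true :: k

theorem reg_injective : Function.Injective reg := fun p q h => by
  simp only [reg, List.cons.injEq, true_and] at h
  exact code_injective h

/-! #### Queries -/

def trTerm (ρ : Const × Domain → Term) : Term × Domain → Term
  | (.var x, _) => .var (user x)
  | (.const c, D) => ρ (c, D)

/-- The translation of a query, with the flag `σ` and with constants interpreted by `ρ`. -/
def tr (σ : Term) (ρ : Const × Domain → Term) : Query → Query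
  | .atom R ts => .atom (rel R) (σ :: (ts.zip R.doms).map (trTerm ρ))
  | .and φ ψ => .and (tr σ ρ φ) (tr σ ρ ψ)
  | .or φ ψ => .or (tr σ ρ φ) (tr σ ρ ψ)
  | .ex x φ => .ex (user x) (tr σ ρ φ)

/-- The constants of a term in an attribute with the given domain. -/
def termConsts : Term × Domain → List (Const × Domain)
  | (.var _, _) => []
  | (.const c, D) => [(c, D)]

/-- The occurrences of constants in a query, with the domains of their attributes. -/
def consts : Query → List (Const × Domain)
  | .atom R ts => (ts.zip R.doms).flatMap termConsts
  | .and φ ψ => consts φ ++ consts ψ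
  | .or φ ψ => consts φ ++ consts ψ
  | .ex _ φ => consts φ

/-- Quantification over a list of variables. -/
def exAll (l : List Name) (φ : Query) : Query := l.foldr .ex φ

/-- If the flag is `one`, then `q` holds in the facts with flag `one`. -/
def regQuery (q : Query) : Query :=
  exAll ((consts q).map reg) (.and
    (.atom (regRel (consts q)) (.var sVar :: (consts q).map fun p => .var (reg p)))
    (tr (.var sVar) (fun p => .var (reg p)) q))

/-- The attributes of a schema. -/
def cols (sch : List Rel) : List (Rel × Name × Domain) :=
  sch.flatMap fun R => ((numerals R.doms).zip R.doms).map fun p => (R, p)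

/-- If the flag is `one`, then a value is shared by a fact with flag `zero` and a fact with flag
`one`, at the given positions. -/
def shared (R S : Rel) (k l : Name) : Query :=
  exAll ((numerals R.doms).map zVar ++ (numerals S.doms).map wVar) (.and
    (.atom (rel R) (.const zero :: (numerals R.doms).map fun i => .var (zVar i)))
    (.atom (rel S) (.var sVar :: (numerals S.doms).map fun i =>
      .var (if decide (i = l) then zVar k else wVar i))))

instance : DecidableEq Domain := fun _ _ => decidable_of_iff _ code_injective.eq_iff

def sharedQueries (sch : List Rel) : List Query :=
  (cols sch).flatMap fun p => (cols sch).flatMap fun q =>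
    if decide (p.2.2 = q.2.2) then [shared p.1 q.1 p.2.1 q.2.1] else []

def orAtom (x y z : Term) : Query := .atom orRel [x, y, z]

/-- The disjunction of `oVar` and `sVar` is written to `tVar` and then copied to a rebound `oVar`,
as `t ∨ t = t`. So three variables serve chains of any length. -/
def chainStep (b φ : Query) : Query :=
  .ex sVar (.and b (.ex tVar (.and (orAtom (.var oVar) (.var sVar) (.var tVar))
    (.ex oVar (.and (orAtom (.var tVar) (.var tVar) (.var oVar)) φ)))))

/-- The value of `oVar` is `one`, or one of the queries holds with the flag `one`. -/
def chain (l : List Query) : Query :=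
  l.foldr chainStep (orAtom (.var oVar) (.var oVar) (.const one))

/-- The query `q₁` is outside the disjunction and has the fixed flag `one`, so its constants can be
renamed in place. Those of `q₂` must change with the flag and are read from the table `regRel`. -/
def newQuery (sch : List Rel) (q₁ q₂ : Query) : Query :=
  .and (tr (.const one) (fun p => .const (lift p.1)) q₁)
    (.ex oVar (.and (.atom switchRel [.var oVar]) (chain (regQuery q₂ :: sharedQueries sch))))

def newSch (sch : List Rel) (q₂ : Query) : List Rel :=
  switchRel :: orRel :: regRel (consts q₂) :: sch.map rel

def newAcs (acs : List Method) : List Method := switchMethod :: acs.map method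

/-- The facts of the new configuration that do not stem from the given one. -/
def baseFacts (sch : List Rel) (q₂ : Query) : List Fact :=
  ⟨switchRel, [zero]⟩ :: (orTable.map (Fact.mk orRel) ++
    (⟨regRel (consts q₂), one :: (consts q₂).map fun p => lift p.1⟩ ::
      ⟨regRel (consts q₂), zero :: (consts q₂).map fun _ => zero⟩ :: sch.map dummy))

def newConf (sch : List Rel) (conf : List Fact) (q₂ : Query) : List Fact :=
  baseFacts sch q₂ ++ conf.map up

/-! #### Well-typedness -/

/-- The function that is `f` on the renamed variables, and `g` elsewhere. -/
def override {α : Type} (f g : Name → α) : Name → α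
  | true :: x => f x
  | x => g x

theorem update_override {α : Type} (f g : Name → α) (x : Name) (a : α) :
    update (override f g) (user x) a = override (update f x a) g := by
  funext y
  by_cases h : y = user x
  · subst h; simp [user, override]
  · rw [Function.update_of_ne h]
    match y with
    | [] => rfl
    | false :: y => rfl
    | true :: y =>
      have : y ≠ x := fun e => h (by rw [e]; rfl)
      simp [override, this]

theorem dom_update (Γ : Name → Domain) (x : Name) (D : Domain) :
    (fun y => dom (update Γ x D y)) = update (fun y => dom (Γ y)) x (dom D) := by
  funext y
  by_cases h : y = x
  · subst h; simp
  · simp [h]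

/-- The term has the given domain. -/
def TermTyped (C : Set Fact) (Γ : Name → Domain) : Term → Domain → Prop
  | .var x, D => Γ x = D
  | .const c, D => (c, D) ∈ adom C

theorem wellTyped_atom {sch : List Rel} {C : Set Fact} {Γ : Name → Domain} {R : Rel}
    {ts : List Term} : (Query.atom R ts).WellTyped sch C Γ ↔
      R ∈ sch ∧ List.Forall₂ (TermTyped C Γ) ts R.doms := by
  refine and_congr_right fun _ => ?_
  constructor <;> refine fun h => h.imp fun t D ht => ?_ <;> cases t <;> exact ht

theorem wellTyped_exAll {sch : List Rel} {C : Set Fact} {l : List Name} :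
    ∀ {φ : Query} {Γ : Name → Domain}, φ.WellTyped sch C Γ → (exAll l φ).WellTyped sch C Γ := by
  induction l with
  | nil => exact fun h => h
  | cons x l ih =>
    intro φ Γ h
    exact ⟨Γ x, by rw [Function.update_eq_self]; exact ih h⟩

theorem freeVars_exAll {l : List Name} :
    ∀ {φ : Query}, (exAll l φ).freeVars = φ.freeVars \ {x | x ∈ l} := by
  induction l with
  | nil => intro φ; simp [exAll]
  | cons x l ih =>
    intro φ
    change (exAll l φ).freeVars \ {x} = _
    rw [ih]
    ext y
    simp only [Set.mem_sdiff, Set.mem_singleton_iff, Set.mem_ofPred_eq,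
      List.mem_cons]
    tauto

theorem isConjunctive_exAll {l : List Name} :
    ∀ {φ : Query}, φ.IsConjunctive → (exAll l φ).IsConjunctive := by
  induction l with
  | nil => exact fun h => h
  | cons x l ih => exact fun h => ih h

theorem isConjunctive_tr {σ : Term} {ρ : Const × Domain → Term} {φ : Query}
    (h : φ.IsConjunctive) : (tr σ ρ φ).IsConjunctive := by
  induction φ with
  | atom R ts => trivial
  | and φ ψ h1 h2 => exact ⟨h1 h.1, h2 h.2⟩
  | or φ ψ => exact h.elim
  | ex x φ ih => exact ih h

theorem consts_subset {sch : List Rel} {C : Set Fact} {φ : Query} :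
    ∀ {Γ : Name → Domain}, φ.WellTyped sch C Γ → ∀ p ∈ consts φ, p ∈ adom C := by
  induction φ with
  | atom R ts =>
    intro Γ h p hp
    obtain ⟨⟨t, D⟩, hq, hp⟩ := List.mem_flatMap.1 hp
    have := (List.forall₂_iff_zip.1 (wellTyped_atom.1 h).2).2 hq
    cases t with
    | var x => simp [termConsts] at hp
    | const c =>
      simp only [termConsts, List.mem_singleton] at hp
      exact hp ▸ this
  | and φ ψ h1 h2 => exact fun h p hp => (List.mem_append.1 hp).elim (h1 h.1 p) (h2 h.2 p)
  | or φ ψ h1 h2 => exact fun h p hp => (List.mem_append.1 hp).elim (h1 h.1 p) (h2 h.2 p)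
  | ex x φ ih => exact fun ⟨D, h⟩ => ih h

/-- Binders of the translated formula affect only the renamed variables, the first argument of
`override`. The conditions on `σ` and `ρ` are required for all `f`, so they survive below binders.
-/
theorem wellTyped_tr {sch sch' : List Rel} {C C' : Set Fact} (hs : ∀ R ∈ sch, rel R ∈ sch')
    {σ : Term} {ρ : Const × Domain → Term} {Δ : Name → Domain}
    (hσ : ∀ f, TermTyped C' (override f Δ) σ bitDom) {φ : Query} :
    ∀ {Γ : Name → Domain}, φ.WellTyped sch C Γ →
      (∀ p ∈ consts φ, ∀ f, TermTyped C' (override f Δ) (ρ p) (dom p.2)) →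
      (tr σ ρ φ).WellTyped sch' C' (override (fun x => dom (Γ x)) Δ) := by
  induction φ with
  | atom R ts =>
    intro Γ h hρ
    replace h := wellTyped_atom.1 h
    refine wellTyped_atom.2 ⟨hs R h.1, .cons (hσ _) ?_⟩
    simp only [consts] at hρ
    replace h := h.2
    generalize R.doms = Ds at h hρ
    induction h with
    | nil => exact .nil
    | @cons t D ts Ds ht _ ih =>
      simp only [List.zip_cons_cons, List.flatMap_cons, List.mem_append] at hρ
      refine .cons ?_ (ih fun p hp => hρ p (.inr hp))
      cases t with
      | var x => exact congrArg dom ht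
      | const c => exact hρ (c, D) (.inl (by simp [termConsts])) _
  | and φ ψ h1 h2 =>
    intro Γ h hρ
    simp only [consts, List.mem_append] at hρ
    exact ⟨h1 h.1 fun p hp => hρ p (.inl hp), h2 h.2 fun p hp => hρ p (.inr hp)⟩
  | or φ ψ h1 h2 =>
    intro Γ h hρ
    simp only [consts, List.mem_append] at hρ
    exact ⟨h1 h.1 fun p hp => hρ p (.inl hp), h2 h.2 fun p hp => hρ p (.inr hp)⟩
  | ex x φ ih =>
    rintro Γ ⟨D, h⟩ hρ
    refine ⟨dom D, ?_⟩
    rw [update_override, ← dom_update]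
    exact ih h hρ

theorem freeVars_tr {σ : Term} {ρ : Const × Domain → Term} {φ : Query} :
    ∀ x ∈ (tr σ ρ φ).freeVars, (∃ y ∈ φ.freeVars, x = user y) ∨ σ = .var x ∨
      ∃ p ∈ consts φ, ρ p = .var x := by
  induction φ with
  | atom R ts =>
    intro x hx
    rcases List.mem_cons.1 hx with h | h
    · exact .inr (.inl h.symm)
    · obtain ⟨⟨t, D⟩, hq, h⟩ := List.mem_map.1 h
      cases t with
      | var y =>
        simp only [trTerm, Term.var.injEq] at h
        exact .inl ⟨y, (List.of_mem_zip hq).1, h.symm⟩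
      | const c =>
        exact .inr (.inr ⟨(c, D), List.mem_flatMap.2 ⟨_, hq, by simp [termConsts]⟩, h⟩)
  | and φ ψ h1 h2 =>
    rintro x (hx | hx)
    · rcases h1 x hx with ⟨y, hy, e⟩ | h | ⟨p, hp, e⟩
      exacts [.inl ⟨y, .inl hy, e⟩, .inr (.inl h), .inr (.inr ⟨p, List.mem_append_left _ hp, e⟩)]
    · rcases h2 x hx with ⟨y, hy, e⟩ | h | ⟨p, hp, e⟩
      exacts [.inl ⟨y, .inr hy, e⟩, .inr (.inl h), .inr (.inr ⟨p, List.mem_append_right _ hp, e⟩)]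
  | or φ ψ h1 h2 =>
    rintro x (hx | hx)
    · rcases h1 x hx with ⟨y, hy, e⟩ | h | ⟨p, hp, e⟩
      exacts [.inl ⟨y, .inl hy, e⟩, .inr (.inl h), .inr (.inr ⟨p, List.mem_append_left _ hp, e⟩)]
    · rcases h2 x hx with ⟨y, hy, e⟩ | h | ⟨p, hp, e⟩
      exacts [.inl ⟨y, .inr hy, e⟩, .inr (.inl h), .inr (.inr ⟨p, List.mem_append_right _ hp, e⟩)]
  | ex z φ ih =>
    rintro x ⟨hx, hxz⟩
    rcases ih x hx with ⟨y, hy, rfl⟩ | h | h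
    · exact .inl ⟨y, ⟨hy, fun e => hxz (congrArg user e)⟩, rfl⟩
    · exact .inr (.inl h)
    · exact .inr (.inr h)

/-- Consistent because `reg` is injective. It is applied both to the domains and to the values of
the register variables. -/
theorem exists_regFun {α : Type} (f : Const × Domain → α) (a : α) :
    ∃ δ : Name → α, δ sVar = a ∧ ∀ p, δ (reg p) = f p := by
  classical
  refine ⟨fun x => if h : ∃ p, x = reg p then f h.choose else a,
    dif_neg fun ⟨_, h⟩ => List.cons_ne_nil _ _ h.symm, fun p => ?_⟩
  have h : ∃ q, reg p = reg q := ⟨p, rfl⟩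
  exact (dif_pos h).trans (congrArg f (reg_injective h.choose_spec).symm)

theorem freeVars_regQuery {q : Query} (hq : q.freeVars = ∅) :
    (regQuery q).freeVars ⊆ {sVar} := by
  intro x hx
  rw [regQuery, freeVars_exAll] at hx
  obtain ⟨h | h, hx⟩ := hx
  · rcases List.mem_cons.1 h with h | h
    · exact Term.var.inj h
    · obtain ⟨p, hp, h⟩ := List.mem_map.1 h
      exact absurd (List.mem_map.2 ⟨p, hp, Term.var.inj h⟩) hx
  · rcases freeVars_tr x h with ⟨y, hy, -⟩ | h | ⟨p, hp, h⟩
    · simp [hq] at hy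
    · exact (Term.var.inj h).symm
    · exact absurd (List.mem_map.2 ⟨p, hp, Term.var.inj h⟩) hx

theorem wellTyped_regQuery {sch sch' : List Rel} {C C' : Set Fact}
    (hs : ∀ R ∈ sch, rel R ∈ sch') {q : Query} (hr : regRel (consts q) ∈ sch')
    (hq : q.IsBooleanPQ sch C) {Γ : Name → Domain} (hΓ : Γ sVar = bitDom) :
    (regQuery q).WellTyped sch' C' Γ := by
  obtain ⟨h, Γ', w⟩ := hq
  obtain ⟨δ, h1, h2⟩ := exists_regFun (fun p => dom p.2) bitDom
  refine Query.WellTyped.congr (Γ := override (fun x => dom (Γ' x)) δ) ?_ ?_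
  · refine wellTyped_exAll ⟨wellTyped_atom.2 ⟨hr, .cons h1 ?_⟩,
      wellTyped_tr (σ := .var sVar) (Δ := δ) hs (fun _ => h1) w fun p _ _ => h2 p⟩
    rw [List.forall₂_map_left_iff, List.forall₂_map_right_iff, List.forall₂_same]
    exact fun p _ => h2 p
  · intro x hx
    rw [freeVars_regQuery h hx, hΓ]
    exact h1

theorem length_numerals {α : Type} (l : List α) : (numerals l).length = l.length := by
  simp [numerals]

theorem mem_zip_numerals {α : Type} {l : List α} {k : Name} {a : α} :
    (k, a) ∈ (numerals l).zip l ↔ ∃ i, k = List.replicate i true ∧ l[i]? = some a := by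
  rw [List.mem_iff_getElem?]
  refine exists_congr fun i => ?_
  rw [List.getElem?_zip_eq_some]
  constructor
  · rintro ⟨h1, h2⟩
    refine ⟨?_, h2⟩
    simp only [numerals, List.getElem?_map, Option.map_eq_some_iff] at h1
    obtain ⟨j, hj, rfl⟩ := h1
    rw [List.getElem?_range (by have := List.getElem?_eq_some_iff.1 h2; exact this.1)] at hj
    simp_all
  · rintro ⟨rfl, h⟩
    refine ⟨?_, h⟩
    have := (List.getElem?_eq_some_iff.1 h).1
    simp [numerals, List.getElem?_range this]

/-- Lists of the length of the list of numerals. -/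
theorem map_numerals {α β : Type} {l : List α} {l' : List β} (h : l.length = l'.length)
    {f : Name → β} (hf : ∀ (i : ℕ) (hi : i < l'.length), f (List.replicate i true) = l'[i]) :
    (numerals l).map f = l' := by
  refine List.ext_getElem (by simp [length_numerals, h]) fun i h1 h2 => ?_
  simp [numerals, hf i h2]

/-- Domains for the variables of `shared`. -/
def sharedDom (R S : Rel) : Name → Domain
  | false :: false :: true :: k => (R.doms.map dom).getD k.length bitDom
  | false :: false :: false :: true :: k => (S.doms.map dom).getD k.length bitDom
  | _ => bitDom

/-- The common variable `zVar k` in the second atom is bound because `k` is a position of `R`. -/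
theorem freeVars_shared {R S : Rel} {k l : Name} (hk : k ∈ numerals R.doms) :
    (shared R S k l).freeVars ⊆ {sVar} := by
  intro x hx
  rw [shared, freeVars_exAll] at hx
  obtain ⟨h | h, hx⟩ := hx
  · simp only [Query.freeVars, Set.mem_ofPred_eq, List.mem_cons, reduceCtorEq, false_or,
      List.mem_map] at h
    obtain ⟨i, hi, h⟩ := h
    exact absurd (List.mem_append_left _ (List.mem_map.2 ⟨i, hi, Term.var.inj h⟩)) hx
  · simp only [Query.freeVars, Set.mem_ofPred_eq, List.mem_cons, List.mem_map] at h
    obtain h | ⟨i, hi, h⟩ := h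
    · exact Term.var.inj h
    · refine absurd ?_ hx
      rw [← Term.var.inj h]
      split
      · exact List.mem_append_left _ (List.mem_map_of_mem hk)
      · exact List.mem_append_right _ (List.mem_map_of_mem hi)

theorem wellTyped_shared {sch' : List Rel} {C' : Set Fact} {R S : Rel} (hR : rel R ∈ sch')
    (hS : rel S ∈ sch') (h0 : (zero, bitDom) ∈ adom C') {k l : Name} {D : Domain}
    (hk : (k, D) ∈ (numerals R.doms).zip R.doms) (hl : (l, D) ∈ (numerals S.doms).zip S.doms)
    {Γ : Name → Domain} (hΓ : Γ sVar = bitDom) :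
    (shared R S k l).WellTyped sch' C' Γ := by
  refine Query.WellTyped.congr (Γ := sharedDom R S) ?_ ?_
  · refine wellTyped_exAll ⟨wellTyped_atom.2 ⟨hR, .cons h0 ?_⟩,
      wellTyped_atom.2 ⟨hS, .cons rfl ?_⟩⟩
    · rw [List.forall₂_map_left_iff, List.forall₂_iff_get]
      refine ⟨by simp [length_numerals], fun i h1 h2 => ?_⟩
      simp only [List.length_map] at h2
      simp [numerals, TermTyped, zVar, sharedDom, h2]
    · rw [List.forall₂_map_left_iff, List.forall₂_iff_get]
      refine ⟨by simp [length_numerals], fun i h1 h2 => ?_⟩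
      simp only [List.length_map] at h2
      obtain ⟨j, rfl, hj⟩ := mem_zip_numerals.1 hk
      obtain ⟨j', rfl, hj'⟩ := mem_zip_numerals.1 hl
      -- At position `j'` of `S` stands the variable for position `j` of `R`; both columns have the
      -- domain `D`.
      by_cases hi : i = j'
      · subst hi
        rw [List.getElem?_eq_getElem h2, Option.some_inj] at hj'
        simp [numerals, TermTyped, zVar, sharedDom, hj, hj']
      · have : List.replicate i true ≠ List.replicate j' true := fun e => hi (by
          simpa using congrArg List.length e)
        simp [numerals, TermTyped, wVar, sharedDom, h2, this]
  · intro x hx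
    rw [freeVars_shared (List.of_mem_zip hk).1 hx, hΓ]
    rfl

theorem mem_sharedQueries {sch : List Rel} {φ : Query} :
    φ ∈ sharedQueries sch ↔ ∃ R ∈ sch, ∃ S ∈ sch, ∃ k l D,
      (k, D) ∈ (numerals R.doms).zip R.doms ∧ (l, D) ∈ (numerals S.doms).zip S.doms ∧
      φ = shared R S k l := by
  have hc : ∀ p : Rel × Name × Domain,
      p ∈ cols sch ↔ p.1 ∈ sch ∧ p.2 ∈ (numerals p.1.doms).zip p.1.doms := by
    rintro ⟨R, p⟩
    simp only [cols, List.mem_flatMap, List.mem_map, Prod.mk.injEq]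
    constructor
    · rintro ⟨R, hR, p, hp, rfl, rfl⟩
      exact ⟨hR, hp⟩
    · exact fun h => ⟨R, h.1, p, h.2, rfl, rfl⟩
  simp only [sharedQueries, List.mem_flatMap]
  constructor
  · rintro ⟨⟨R, k, D⟩, hp, ⟨S, l, E⟩, hq, h⟩
    split at h
    · next e =>
      obtain rfl : D = E := by simpa using e
      exact ⟨R, ((hc _).1 hp).1, S, ((hc _).1 hq).1, k, l, D, ((hc _).1 hp).2, ((hc _).1 hq).2,
        by simpa using h⟩
    · simp at h
  · rintro ⟨R, hR, S, hS, k, l, D, hk, hl, rfl⟩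
    exact ⟨(R, k, D), (hc _).2 ⟨hR, hk⟩, (S, l, D), (hc _).2 ⟨hS, hl⟩, by simp⟩

theorem wellTyped_orAtom {sch' : List Rel} {C' : Set Fact} {Γ : Name → Domain}
    (h : orRel ∈ sch') {x y z : Term} (hx : TermTyped C' Γ x bitDom)
    (hy : TermTyped C' Γ y bitDom) (hz : TermTyped C' Γ z bitDom) :
    (orAtom x y z).WellTyped sch' C' Γ :=
  wellTyped_atom.2 ⟨h, .cons hx (.cons hy (.cons hz .nil))⟩

theorem chain_induction {P : Query → Prop}
    (h0 : P (orAtom (.var oVar) (.var oVar) (.const one))) {l : List Query}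
    (h1 : ∀ φ, P φ → ∀ b ∈ l, P (chainStep b φ)) : P (chain l) := by
  induction l with
  | nil => exact h0
  | cons b l ih => exact h1 _ (ih fun φ hφ b hb => h1 φ hφ b (by simp [hb])) b (by simp)

theorem wellTyped_chain {sch' : List Rel} {C' : Set Fact} (h : orRel ∈ sch')
    (h1 : (one, bitDom) ∈ adom C') {l : List Query}
    (hl : ∀ b ∈ l, ∀ Γ : Name → Domain, Γ sVar = bitDom → b.WellTyped sch' C' Γ) :
    ∀ {Γ : Name → Domain}, Γ oVar = bitDom → (chain l).WellTyped sch' C' Γ := by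
  refine chain_induction (P := fun φ => ∀ {Γ : Name → Domain}, Γ oVar = bitDom →
    φ.WellTyped sch' C' Γ) (fun hΓ => wellTyped_orAtom h hΓ hΓ h1) fun φ hφ b hb Γ hΓ => ?_
  refine ⟨bitDom, hl b hb _ (by simp), bitDom, wellTyped_orAtom h ?_ ?_ ?_, bitDom,
    wellTyped_orAtom h ?_ ?_ ?_, hφ (by simp)⟩ <;>
    simp_all [TermTyped, sVar, oVar, tVar, update]

theorem freeVars_chain {l : List Query} (hl : ∀ b ∈ l, b.freeVars ⊆ {sVar}) :
    (chain l).freeVars ⊆ {oVar} := by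
  refine chain_induction (P := fun φ => φ.freeVars ⊆ {oVar}) ?_ fun φ hφ b hb x hx => ?_
  · intro x hx
    simpa [Query.freeVars, orAtom] using hx
  · have h1 : x ∈ b.freeVars → x = sVar := fun h => hl b hb h
    have h2 : x ∈ φ.freeVars → x = oVar := fun h => hφ h
    simp only [chainStep, orAtom, Query.freeVars, Set.mem_sdiff, Set.mem_union,
      Set.mem_singleton_iff, Set.mem_ofPred_eq, List.mem_cons, Term.var.injEq, List.not_mem_nil] at hx ⊢
    tauto

theorem isConjunctive_chain {l : List Query} (hl : ∀ b ∈ l, b.IsConjunctive) :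
    (chain l).IsConjunctive :=
  chain_induction (P := Query.IsConjunctive) trivial
    fun _ hφ b hb => ⟨hl b hb, trivial, trivial, hφ⟩

theorem wellTyped_up {f : Fact} (h : f.WellTyped) : (up f).WellTyped := by
  refine .cons one_mem_bitDom ?_
  rw [List.forall₂_map_left_iff, List.forall₂_map_right_iff]
  exact h.imp fun c D => lift_mem_dom

theorem zip_map {α β γ δ : Type} (f : α → γ) (g : β → δ) (l : List α) (l' : List β) :
    (l.map f).zip (l'.map g) = (l.zip l').map fun p => (f p.1, g p.2) := by
  rw [List.zip_map]; rfl

theorem lift_mem_adom {C C' : Set Fact} (h : ∀ f ∈ C, up f ∈ C') {c : Const} {D : Domain}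
    (hc : (c, D) ∈ adom C) : (lift c, dom D) ∈ adom C' := by
  obtain ⟨f, hf, hc⟩ := hc
  refine ⟨up f, h f hf, List.mem_cons_of_mem _ ?_⟩
  change _ ∈ (f.args.map lift).zip (f.rel.doms.map dom)
  rw [zip_map]
  exact List.mem_map_of_mem (f := fun p : Const × Domain => (lift p.1, dom p.2)) hc

theorem base_mem {sch : List Rel} {conf : List Fact} {q : Query} {f : Fact}
    (h : f ∈ baseFacts sch q) : f ∈ newConf sch conf q :=
  List.mem_append_left _ h

theorem up_mem {sch : List Rel} {conf : List Fact} {q : Query} {f : Fact} (h : f ∈ conf) :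
    up f ∈ newConf sch conf q :=
  List.mem_append_right _ (List.mem_map_of_mem h)

theorem orTable_mem {sch : List Rel} {q : Query} {xs : List Const} (h : xs ∈ orTable) :
    ⟨orRel, xs⟩ ∈ baseFacts sch q :=
  List.mem_cons_of_mem _ (List.mem_append_left _ (List.mem_map_of_mem h))

theorem regOne_mem {sch : List Rel} {q : Query} :
    ⟨regRel (consts q), one :: (consts q).map fun p => lift p.1⟩ ∈ baseFacts sch q := by
  simp [baseFacts]

theorem regZero_mem {sch : List Rel} {q : Query} :
    ⟨regRel (consts q), zero :: (consts q).map fun _ => zero⟩ ∈ baseFacts sch q := by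
  simp [baseFacts]

theorem dummy_mem {sch : List Rel} {q : Query} {R : Rel} (h : R ∈ sch) :
    dummy R ∈ baseFacts sch q := by
  simp only [baseFacts, List.mem_cons, List.mem_append, List.mem_map]
  exact .inr (.inr (.inr (.inr ⟨R, h, rfl⟩)))

theorem rel_mem_newSch {sch : List Rel} {q : Query} {R : Rel} (h : R ∈ sch) :
    rel R ∈ newSch sch q := by
  simp only [newSch, List.mem_cons, List.mem_map]
  exact .inr (.inr (.inr ⟨R, h, rfl⟩))

theorem newSch_cases {sch : List Rel} {q : Query} {R : Rel} (h : R ∈ newSch sch q) :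
    R = switchRel ∨ R = orRel ∨ R = regRel (consts q) ∨ ∃ S ∈ sch, R = rel S := by
  simpa [newSch, eq_comm] using h

theorem mem_values_of_adom {C : Set Fact} (h : ∀ f ∈ C, f.WellTyped) {p : Const × Domain}
    (hp : p ∈ adom C) : p.1 ∈ p.2.values := by
  obtain ⟨f, hf, hp⟩ := hp
  exact (List.forall₂_iff_zip.1 (h f hf)).2 hp

theorem isInstance_newConf {sch : List Rel} {conf : List Fact} {q : Query}
    (hc : IsInstance sch {f | f ∈ conf}) (hq : q.IsBooleanPQ sch {f | f ∈ conf}) :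
    IsInstance (newSch sch q) {f | f ∈ newConf sch conf q} := by
  refine ⟨List.finite_toSet _, fun f hf => ?_⟩
  have hz := zero_mem_bitDom
  have ho := one_mem_bitDom
  rcases List.mem_append.1 hf with hf | hf
  · simp only [baseFacts, List.mem_cons, List.mem_append, List.mem_map] at hf
    rcases hf with rfl | ⟨l, hl, rfl⟩ | rfl | rfl | ⟨R, hR, rfl⟩
    · exact ⟨by simp [newSch], .cons hz .nil⟩
    · refine ⟨by simp [newSch], ?_⟩
      simp only [orTable, List.mem_cons, List.not_mem_nil, or_false] at hl
      rcases hl with rfl | rfl | rfl | rfl <;> simp [Fact.WellTyped, orRel, hz, ho]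
    · refine ⟨by simp [newSch], .cons ho ?_⟩
      rw [List.forall₂_map_left_iff, List.forall₂_map_right_iff, List.forall₂_same]
      obtain ⟨-, Γ, w⟩ := hq
      exact fun p hp => lift_mem_dom
        (mem_values_of_adom (fun f hf => (hc.2 f hf).2) (consts_subset w p hp))
    · refine ⟨by simp [newSch], .cons hz ?_⟩
      rw [List.forall₂_map_left_iff, List.forall₂_map_right_iff, List.forall₂_same]
      exact fun p _ => zero_mem_dom _
    · refine ⟨rel_mem_newSch hR, .cons hz ?_⟩
      rw [List.forall₂_map_left_iff, List.forall₂_map_right_iff, List.forall₂_same]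
      exact fun p _ => zero_mem_dom _
  · obtain ⟨f, h, rfl⟩ := List.mem_map.1 hf
    exact ⟨rel_mem_newSch (hc.2 f h).1, wellTyped_up (hc.2 f h).2⟩

/-- Names of translated relations begin with `true`; the three auxiliary names contain no `true` and
have different lengths. -/
theorem isSchema_newSch {sch : List Rel} {q : Query} (h : IsSchema sch) :
    IsSchema (newSch sch q) := by
  have e : (sch.map rel).map Rel.name = (sch.map Rel.name).map (List.cons true) := by
    simp [rel, Function.comp_def]
  simp only [IsSchema, newSch, List.map_cons, List.nodup_cons, e]
  refine ⟨by simp [switchRel, orRel, regRel], by simp [orRel, regRel], by simp [regRel], ?_⟩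
  exact h.map fun _ _ h => (List.cons.inj h).2

theorem bit_mem_adom {sch : List Rel} {conf : List Fact} {q : Query} :
    (zero, bitDom) ∈ adom {f | f ∈ newConf sch conf q} ∧
      (one, bitDom) ∈ adom {f | f ∈ newConf sch conf q} := by
  have h : ⟨orRel, [zero, one, one]⟩ ∈ newConf sch conf q :=
    base_mem (orTable_mem (by simp [orTable]))
  exact ⟨⟨_, h, by simp [orRel]⟩, ⟨_, h, by simp [orRel]⟩⟩

theorem freeVars_mem {sch : List Rel} {q : Query} (hq : q.freeVars = ∅) :
    ∀ b ∈ regQuery q :: sharedQueries sch, b.freeVars ⊆ {sVar} := by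
  intro b hb
  rcases List.mem_cons.1 hb with rfl | hb
  · exact freeVars_regQuery hq
  · obtain ⟨R, -, S, -, k, l, D, hk, -, rfl⟩ := mem_sharedQueries.1 hb
    exact freeVars_shared (List.of_mem_zip hk).1

theorem isBooleanPQ_newQuery {sch : List Rel} {conf : List Fact} {q₁ q₂ : Query}
    (h₁ : q₁.IsBooleanPQ sch {f | f ∈ conf}) (h₂ : q₂.IsBooleanPQ sch {f | f ∈ conf}) :
    (newQuery sch q₁ q₂).IsBooleanPQ (newSch sch q₂) {f | f ∈ newConf sch conf q₂} := by
  have hs : ∀ R ∈ sch, rel R ∈ newSch sch q₂ := fun R hR => rel_mem_newSch hR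
  constructor
  · rw [Set.eq_empty_iff_forall_notMem]
    rintro x (hx | ⟨hx | hx, hx'⟩)
    · rcases freeVars_tr x hx with ⟨y, hy, -⟩ | h | ⟨p, hp, h⟩
      · simp [h₁.1] at hy
      · simp at h
      · simp at h
    · exact hx' (by simpa [Query.freeVars] using hx)
    · exact hx' (freeVars_chain (freeVars_mem h₂.1) hx)
  · obtain ⟨-, Γ, w⟩ := h₁
    refine ⟨override (fun x => dom (Γ x)) fun _ => bitDom, ?_, bitDom, ?_, ?_⟩
    · exact wellTyped_tr (σ := .const one) hs (fun _ => bit_mem_adom.2) w fun p hp _ =>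
        lift_mem_adom (fun f hf => up_mem hf) (consts_subset w p hp)
    · exact wellTyped_atom.2 ⟨by simp [newSch], .cons (by simp [TermTyped]) .nil⟩
    · refine wellTyped_chain (by simp [newSch]) bit_mem_adom.2 (fun b hb Δ hΔ => ?_) (by simp)
      rcases List.mem_cons.1 hb with rfl | hb
      · exact wellTyped_regQuery hs (by simp [newSch]) h₂ hΔ
      · obtain ⟨R, hR, S, hS, k, l, D, hk, hl, rfl⟩ := mem_sharedQueries.1 hb
        exact wellTyped_shared (hs R hR) (hs S hS) bit_mem_adom.1 hk hl hΔ

theorem isConjunctive_newQuery {sch : List Rel} {q₁ q₂ : Query} (h₁ : q₁.IsConjunctive)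
    (h₂ : q₂.IsConjunctive) : (newQuery sch q₁ q₂).IsConjunctive := by
  refine ⟨isConjunctive_tr h₁, trivial, isConjunctive_chain fun b hb => ?_⟩
  rcases List.mem_cons.1 hb with rfl | hb
  · exact isConjunctive_exAll ⟨trivial, isConjunctive_tr h₂⟩
  · obtain ⟨R, -, S, -, k, l, D, -, -, rfl⟩ := mem_sharedQueries.1 hb
    exact isConjunctive_exAll ⟨trivial, trivial⟩

/-- The reduction for conjunctive queries. -/
def reduction (x : ContainmentInput .CQ) : RelevanceInput .CQ where
  sch := newSch x.sch x.q₂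
  acs := newAcs x.acs
  conf := newConf x.sch x.conf x.q₂
  access := ⟨switchMethod, [one]⟩
  q := newQuery x.sch x.q₁ x.q₂
  isSchema := isSchema_newSch x.isSchema
  areMethods m hm := by
    rcases List.mem_cons.1 hm with rfl | hm
    · exact ⟨by simp [switchMethod, newSch], rfl⟩
    · obtain ⟨m, h, rfl⟩ := List.mem_map.1 hm
      exact ⟨rel_mem_newSch (x.areMethods m h).1, by
        simp [method, rel, (x.areMethods m h).2]⟩
  isConf := isInstance_newConf x.isConf x.q₂_boolean
  access_wellFormed := ⟨by simp [newAcs], .cons one_mem_bitDom .nil, by simp [switchMethod]⟩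
  q_boolean := isBooleanPQ_newQuery x.q₁_boolean x.q₂_boolean
  q_mem := isConjunctive_newQuery x.q₁_mem x.q₂_mem

end CQ

/-! ### Truth depends only on the values of the free variables -/

theorem Query.eval_congr {I : Set Fact} {φ : Query} :
    ∀ {v w : Name → Const}, (∀ x ∈ φ.freeVars, v x = w x) → (φ.Eval I v ↔ φ.Eval I w) := by
  induction φ with
  | atom R ts =>
    intro v w h
    have : ts.map (Term.value v) = ts.map (Term.value w) := by
      refine List.map_congr_left fun t ht => ?_
      cases t with
      | var x => exact h x ht
      | const c => rfl
    rw [Eval, Eval, this]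
  | and φ ψ h1 h2 =>
    exact fun h => and_congr (h1 fun x hx => h x (.inl hx)) (h2 fun x hx => h x (.inr hx))
  | or φ ψ h1 h2 =>
    exact fun h => or_congr (h1 fun x hx => h x (.inl hx)) (h2 fun x hx => h x (.inr hx))
  | ex x φ ih =>
    refine fun h => exists_congr fun c => ih fun y hy => ?_
    by_cases e : y = x
    · simp [e]
    · simpa [e] using h y ⟨hy, e⟩

theorem Query.holds_iff {I : Set Fact} {φ : Query} (h : φ.freeVars = ∅) (v : Name → Const) :
    φ.Holds I ↔ φ.Eval I v :=
  Query.eval_congr (by simp [h])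

namespace CQ

/-! #### Truth of the queries -/

theorem eval_exAll {I : Set Fact} {l : List Name} :
    ∀ {φ : Query} {v : Name → Const}, φ.Eval I v → (exAll l φ).Eval I v := by
  induction l with
  | nil => exact fun h => h
  | cons x l ih => exact fun {φ v} h => ⟨v x, by rw [Function.update_eq_self]; exact ih h⟩

theorem exists_of_eval_exAll {I : Set Fact} {l : List Name} :
    ∀ {φ : Query} {v : Name → Const}, (exAll l φ).Eval I v →
      ∃ w, (∀ x ∉ l, w x = v x) ∧ φ.Eval I w := by
  induction l with
  | nil => exact fun {φ v} h => ⟨v, fun _ _ => rfl, h⟩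
  | cons x l ih =>
    intro φ v h
    obtain ⟨c, h⟩ := h
    obtain ⟨w, hw, h⟩ := ih h
    refine ⟨_, fun y hy => ?_, h⟩
    simp only [List.mem_cons, not_or] at hy
    rw [hw y hy.2, Function.update_of_ne hy.1]

theorem override_self {α : Type} (v : Name → α) : override (fun x => v (user x)) v = v := by
  funext x
  match x with
  | [] => rfl
  | false :: x => rfl
  | true :: x => rfl

/-- The two maps serve both directions: `k` is the identity when translated values are decoded by
`h`, and `h` is the identity when given values are encoded by `k`. -/
theorem map_trTerm {ρ : Const × Domain → Term} {h k : Const → Const} {u v : Name → Const}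
    (hv : ∀ x, h (v (user x)) = k (u x)) {Ds : List Domain} :
    ∀ {ts : List Term}, ts.length = Ds.length →
      (∀ p ∈ (ts.zip Ds).flatMap termConsts, h ((ρ p).value v) = k p.1) →
      ((ts.zip Ds).map (trTerm ρ)).map (fun t => h (t.value v)) =
        ts.map fun t => k (t.value u) := by
  induction Ds with
  | nil => intro ts hl _; simp [List.length_eq_zero_iff.1 hl]
  | cons D Ds ih =>
    rintro (_ | ⟨t, ts⟩) hl hρ
    · simp at hl
    · simp only [List.zip_cons_cons, List.flatMap_cons, List.mem_append] at hρ
      simp only [List.zip_cons_cons, List.map_cons]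
      rw [ih (by simpa using hl) fun p hp => hρ p (.inr hp)]
      congr 1
      cases t with
      | var x => exact hv x
      | const c => exact hρ (c, D) (.inl (by simp [termConsts]))

theorem length_of_wellTyped {sch : List Rel} {C : Set Fact} {Γ : Name → Domain} {R : Rel}
    {ts : List Term} (h : (Query.atom R ts).WellTyped sch C Γ) : ts.length = R.doms.length :=
  h.2.length_eq

/-- Positive existential formulas are preserved by homomorphisms, so `h` need not be injective. The
same applies to `e` in `eval_tr`, where even a constant map is of use. -/
theorem eval_of_tr {sch : List Rel} {C₀ C I : Set Fact} {σ : Term} {ρ : Const × Domain → Term}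
    {w : Name → Const} {g : Const} {h : Const → Const}
    (hC : ∀ R xs, ⟨rel R, g :: xs⟩ ∈ C → ⟨R, xs.map h⟩ ∈ I)
    (hσ : ∀ f, σ.value (override f w) = g) {φ : Query} :
    ∀ {Γ : Name → Domain}, φ.WellTyped sch C₀ Γ →
      (∀ p ∈ consts φ, ∀ f, h ((ρ p).value (override f w)) = p.1) →
      ∀ u, (tr σ ρ φ).Eval C (override u w) → φ.Eval I fun x => h (u x) := by
  induction φ with
  | atom R ts =>
    intro Γ hw hρ u hu
    rw [tr, Query.Eval, List.map_cons, hσ] at hu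
    have := hC _ _ hu
    rw [List.map_map] at this
    erw [map_trTerm (h := h) (k := id) (u := fun x => h (u x)) (fun x => rfl)
      (length_of_wellTyped hw) fun p hp => hρ p hp u] at this
    exact this
  | and φ ψ h1 h2 =>
    intro Γ hw hρ u hu
    simp only [consts, List.mem_append] at hρ
    exact ⟨h1 hw.1 (fun p hp => hρ p (.inl hp)) u hu.1, h2 hw.2 (fun p hp => hρ p (.inr hp)) u hu.2⟩
  | or φ ψ h1 h2 =>
    intro Γ hw hρ u hu
    simp only [consts, List.mem_append] at hρ
    exact hu.imp (h1 hw.1 (fun p hp => hρ p (.inl hp)) u) (h2 hw.2 (fun p hp => hρ p (.inr hp)) u)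
  | ex x φ ih =>
    rintro Γ ⟨D, hw⟩ hρ u ⟨c, hu⟩
    rw [update_override] at hu
    refine ⟨h c, ?_⟩
    have := ih hw hρ _ hu
    convert this using 1
    funext y
    by_cases e : y = x <;> simp [e]

theorem eval_tr {sch : List Rel} {C₀ C I : Set Fact} {σ : Term} {ρ : Const × Domain → Term}
    {w : Name → Const} {g : Const} {e : Const → Const}
    (hC : ∀ R ∈ sch, ∀ xs : List Const, xs.length = R.doms.length → ⟨R, xs⟩ ∈ I →
      ⟨rel R, g :: xs.map e⟩ ∈ C)
    (hσ : ∀ f, σ.value (override f w) = g) {φ : Query} :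
    ∀ {Γ : Name → Domain}, φ.WellTyped sch C₀ Γ →
      (∀ p ∈ consts φ, ∀ f, (ρ p).value (override f w) = e p.1) →
      ∀ u, φ.Eval I u → (tr σ ρ φ).Eval C (override (fun x => e (u x)) w) := by
  induction φ with
  | atom R ts =>
    intro Γ hw hρ u hu
    rw [tr, Query.Eval, List.map_cons, hσ]
    have := hC R hw.1 _ (by simpa using length_of_wellTyped hw) hu
    rw [List.map_map] at this
    erw [← map_trTerm (h := id) (k := e) (u := u) (v := override (fun x => e (u x)) w)
      (fun x => rfl) (length_of_wellTyped hw) fun p hp => hρ p hp _] at this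
    exact this
  | and φ ψ h1 h2 =>
    intro Γ hw hρ u hu
    simp only [consts, List.mem_append] at hρ
    exact ⟨h1 hw.1 (fun p hp => hρ p (.inl hp)) u hu.1, h2 hw.2 (fun p hp => hρ p (.inr hp)) u hu.2⟩
  | or φ ψ h1 h2 =>
    intro Γ hw hρ u hu
    simp only [consts, List.mem_append] at hρ
    exact hu.imp (h1 hw.1 (fun p hp => hρ p (.inl hp)) u) (h2 hw.2 (fun p hp => hρ p (.inr hp)) u)
  | ex x φ ih =>
    rintro Γ ⟨D, hw⟩ hρ u ⟨c, hu⟩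
    refine ⟨e c, ?_⟩
    rw [update_override]
    have := ih hw hρ _ hu
    convert this using 2
    funext y
    by_cases e : y = x <;> simp [e]

theorem eval_of_isConjunctive {sch : List Rel} {C : Set Fact} {φ : Query} :
    ∀ {Γ : Name → Domain}, φ.WellTyped sch C Γ → φ.IsConjunctive →
      ∀ v, φ.Eval {f | f.args.length = f.rel.doms.length} v := by
  induction φ with
  | atom R ts => exact fun hw _ v => by simpa [Query.Eval] using length_of_wellTyped hw
  | and φ ψ h1 h2 => exact fun hw h v => ⟨h1 hw.1 h.1 v, h2 hw.2 h.2 v⟩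
  | or φ ψ => exact fun _ h => h.elim
  | ex x φ ih => exact fun ⟨D, hw⟩ h v => ⟨[], ih hw h _⟩

/-- The register variables take their values from the row of `regRel` with flag `g`. -/
theorem eval_regQuery {sch : List Rel} {C₀ C I : Set Fact} {q : Query}
    (hq : q.IsBooleanPQ sch C₀) {g : Const} {e : Const → Const}
    (hC : ∀ R ∈ sch, ∀ xs : List Const, xs.length = R.doms.length → ⟨R, xs⟩ ∈ I →
      ⟨rel R, g :: xs.map e⟩ ∈ C)
    (hr : ⟨regRel (consts q), g :: (consts q).map fun p => e p.1⟩ ∈ C) (h : q.Holds I)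
    {v : Name → Const} (hv : v sVar = g) : (regQuery q).Eval C v := by
  obtain ⟨hf, Γ, w⟩ := hq
  obtain ⟨δ, h1, h2⟩ := exists_regFun (fun p => e p.1) g
  rw [Query.eval_congr (w := override (fun x => e ([] : Const)) δ)]
  · refine eval_exAll ⟨?_, eval_tr (σ := .var sVar) (ρ := fun p => .var (reg p)) hC (fun _ => h1) w
      (fun p _ _ => h2 p) _ h⟩
    rw [Query.Eval, List.map_cons, List.map_map]
    convert hr using 3
    · exact h1
    · exact List.map_congr_left fun p _ => h2 p
  · intro x hx
    rw [freeVars_regQuery hf hx, hv]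
    exact h1.symm

theorem eval_regQuery_zero {sch : List Rel} {C₀ C : Set Fact} {q : Query}
    (hq : q.IsBooleanPQ sch C₀) (hc : q.IsConjunctive) (hC : ∀ R ∈ sch, dummy R ∈ C)
    (hr : ⟨regRel (consts q), zero :: (consts q).map fun _ => zero⟩ ∈ C)
    {v : Name → Const} (hv : v sVar = zero) : (regQuery q).Eval C v := by
  -- In the set of all facts of the right arity every atom of `q` holds, and the constant map sends
  -- each such fact over the schema to a dummy fact.
  refine eval_regQuery (I := {f | f.args.length = f.rel.doms.length}) (e := fun _ => zero) hq
    (fun R hR xs hl _ => ?_) hr ?_ hv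
  · have := hC R hR
    rwa [dummy, List.map_const', ← hl, ← List.map_const'] at this
  · obtain ⟨-, Γ, w⟩ := hq
    exact eval_of_isConjunctive w hc _

theorem holds_of_eval_regQuery {sch : List Rel} {C₀ C I : Set Fact} {q : Query}
    (hq : q.IsBooleanPQ sch C₀) {g : Const} {h : Const → Const}
    (hC : ∀ R xs, ⟨rel R, g :: xs⟩ ∈ C → ⟨R, xs.map h⟩ ∈ I)
    (hr : ∀ xs, ⟨regRel (consts q), g :: xs⟩ ∈ C → xs.map h = (consts q).map fun p => p.1)
    {v : Name → Const} (hv : v sVar = g) (he : (regQuery q).Eval C v) : q.Holds I := by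
  obtain ⟨hf, Γ, w⟩ := hq
  obtain ⟨v', hv', h1, h2⟩ := exists_of_eval_exAll he
  have hs : v' sVar = g := by
    rw [hv' _ (by simp [reg, sVar]), hv]
  rw [Query.Eval, List.map_cons] at h1
  have hs' : Term.value v' (.var sVar) = g := hs
  rw [hs'] at h1
  have h3 := hr _ h1
  rw [List.map_map, List.map_map] at h3
  -- Entry by entry, the row of the table forces every register variable to decode to its constant.
  have h4 := List.map_inj_left.1 h3
  rw [← override_self v'] at h2
  exact (Query.holds_iff hf _).2 (eval_of_tr (σ := .var sVar) hC (fun _ => hs) w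
    (ρ := fun p => .var (reg p)) (fun p hp _ => h4 p hp) _ h2)

/-- A valuation for `shared`. -/
def sharedVal (s : Const) (xs ys : List Const) : Name → Const
  | false :: false :: true :: k => xs.getD k.length []
  | false :: false :: false :: true :: k => ys.getD k.length []
  | _ => s

theorem eval_shared {C : Set Fact} {R S : Rel} {s c : Const} {xs ys : List Const} {i j : ℕ}
    (hR : ⟨rel R, zero :: xs⟩ ∈ C) (hS : ⟨rel S, s :: ys⟩ ∈ C) (hxs : xs.length = R.doms.length)
    (hys : ys.length = S.doms.length) (hx : xs[i]? = some c) (hy : ys[j]? = some c)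
    {v : Name → Const} (hv : v sVar = s) :
    (shared R S (List.replicate i true) (List.replicate j true)).Eval C v := by
  obtain ⟨hi, hi'⟩ := List.getElem?_eq_some_iff.1 hx
  obtain ⟨hj, hj'⟩ := List.getElem?_eq_some_iff.1 hy
  rw [Query.eval_congr (w := sharedVal s xs ys)]
  · refine eval_exAll ⟨?_, ?_⟩
    · rw [Query.Eval, List.map_cons, List.map_map, map_numerals (l' := xs) hxs.symm]
      · exact hR
      · intro n hn
        simp [Term.value, sharedVal, zVar, hn]
    · rw [Query.Eval, List.map_cons, List.map_map, map_numerals (l' := ys) hys.symm]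
      · exact hS
      · intro n hn
        by_cases e : n = j
        · subst e
          simp [Term.value, sharedVal, zVar, hx, hj']
        · have : List.replicate n true ≠ List.replicate j true := fun h => e (by
            simpa using congrArg List.length h)
          simp [Term.value, sharedVal, wVar, hn, this]
  · intro x hx
    rw [freeVars_shared (by simp [numerals]; omega) hx, hv]
    rfl

theorem exists_of_eval_shared {C : Set Fact} {R S : Rel} {k l : Name} {D E : Domain}
    (hk : (k, D) ∈ (numerals R.doms).zip R.doms) (hl : (l, E) ∈ (numerals S.doms).zip S.doms)
    {v : Name → Const} (h : (shared R S k l).Eval C v) :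
    ∃ xs ys c, ⟨rel R, zero :: xs⟩ ∈ C ∧ ⟨rel S, v sVar :: ys⟩ ∈ C ∧ c ∈ xs ∧ c ∈ ys := by
  obtain ⟨w, hw, h1, h2⟩ := exists_of_eval_exAll h
  rw [Query.Eval, List.map_cons] at h1 h2
  have hs : Term.value w (.var sVar) = v sVar := hw _ (by simp [zVar, wVar, sVar])
  rw [hs] at h2
  refine ⟨_, _, w (zVar k), h1, h2, ?_, ?_⟩
  · rw [List.map_map]
    exact List.mem_map_of_mem (f := Term.value w ∘ fun i => .var (zVar i)) (List.of_mem_zip hk).1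
  · rw [List.map_map]
    refine List.mem_map.2 ⟨l, (List.of_mem_zip hl).1, ?_⟩
    simp [Term.value]

/-- Once the disjunction is `one`, the flag `zero` can be chosen for all remaining disjuncts. -/
theorem eval_chain_one {C : Set Fact} (hor : ∀ xs ∈ orTable, ⟨orRel, xs⟩ ∈ C) {l : List Query}
    (h0 : ∀ b ∈ l, ∀ v : Name → Const, v sVar = zero → b.Eval C v) :
    ∀ {v : Name → Const}, v oVar = one → (chain l).Eval C v := by
  refine chain_induction (P := fun φ => ∀ {v : Name → Const}, v oVar = one → φ.Eval C v) ?_ ?_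
  · intro v hv
    exact hor _ (by simp [Term.value, hv, orTable])
  · intro φ hφ b hb v hv
    refine ⟨zero, h0 b hb _ (by simp), one, hor _ ?_, one, hor _ ?_, hφ (by simp)⟩ <;>
    simp_all [Term.value, orTable, sVar, oVar, tVar, update]

/-- The flag `one` is chosen for `b`, and `zero` for the others. -/
theorem eval_chain_of_mem {C : Set Fact} (hor : ∀ xs ∈ orTable, ⟨orRel, xs⟩ ∈ C)
    {l : List Query} {b : Query} (hb : b ∈ l)
    (h0 : ∀ b ∈ l, ∀ v : Name → Const, v sVar = zero → b.Eval C v)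
    (h1 : ∀ v : Name → Const, v sVar = one → b.Eval C v) :
    ∀ {v : Name → Const}, v oVar = zero → (chain l).Eval C v := by
  induction l with
  | nil => simp at hb
  | cons b' l ih =>
    intro v hv
    rcases List.mem_cons.1 hb with rfl | hb
    · refine ⟨one, h1 _ (by simp), one, hor _ ?_, one, hor _ ?_,
        eval_chain_one hor (fun b hb => h0 b (by simp [hb])) (by simp)⟩ <;>
      simp_all [Term.value, orTable, sVar, oVar, tVar, update]
    · refine ⟨zero, h0 b' (by simp) _ (by simp), zero, hor _ ?_, zero, hor _ ?_,
        ih hb (fun b hb => h0 b (by simp [hb])) (by simp)⟩ <;>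
      simp_all [Term.value, orTable, sVar, oVar, tVar, update]

/-- Read backwards from its end, where the value is `one`: an output `one` of the table needs an
input `one`, either a flag or an earlier value. Here `orRel` must contain nothing beyond the table.
-/
theorem of_eval_chain {C : Set Fact} (hor : ∀ xs, ⟨orRel, xs⟩ ∈ C → xs ∈ orTable)
    {l : List Query} : ∀ {v : Name → Const}, (chain l).Eval C v →
      v oVar = one ∨ ∃ b ∈ l, ∃ v : Name → Const, v sVar = one ∧ b.Eval C v := by
  refine chain_induction (P := fun φ => ∀ {v : Name → Const}, φ.Eval C v →
    v oVar = one ∨ ∃ b ∈ l, ∃ v : Name → Const, v sVar = one ∧ b.Eval C v) ?_ ?_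
  · intro v hv
    have := hor _ hv
    simp [Term.value, orTable, one_ne_zero] at this
    tauto
  · rintro φ hφ b hb v ⟨s, h, t, h1, o, h2, h3⟩
    rcases hφ h3 with ho | h4
    · have e1 := hor _ h1
      have e2 := hor _ h2
      simp only [Function.update_self] at ho
      subst ho
      simp [Term.value, orTable, sVar, oVar, tVar, update, one_ne_zero] at e1 e2
      have hz := one_ne_zero
      by_cases hs : s = one
      · exact .inr ⟨b, hb, _, by simpa using hs, h⟩
      · left
        rcases e2 with ⟨rfl, e⟩ | ⟨rfl, e⟩ | rfl
        · exact absurd e.symm hz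
        · exact absurd e hz
        · simp [hs, hz, oVar] at e1 ⊢
          tauto
    · exact .inr h4

end CQ

/-! ### Projection of tuples onto input attributes -/

theorem select_map {α β : Type} (f : α → β) (mask : List Bool) (l : List α) :
    select mask (l.map f) = (select mask l).map f := by
  induction mask generalizing l with
  | nil => rfl
  | cons b mask ih =>
    cases l with
    | nil => rfl
    | cons a l => cases b <;> simpa [select] using ih l

theorem select_false_cons {α : Type} (mask : List Bool) (a : α) (l : List α) :
    select (false :: mask) (a :: l) = select mask l := by
  simp [select]

theorem select_zip {α β : Type} (mask : List Bool) (l : List α) (l' : List β) :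
    ∀ p ∈ (select mask l).zip (select mask l'), l.length = l'.length → p ∈ l.zip l' := by
  induction mask generalizing l l' with
  | nil => intro p hp; simp [select] at hp
  | cons b mask ih =>
    intro p hp hl
    match l, l' with
    | [], _ => simp [select] at hp
    | _ :: _, [] => simp at hl
    | a :: l, a' :: l' =>
      have hl' : l.length = l'.length := by simpa using hl
      cases b with
      | false =>
        rw [select_false_cons, select_false_cons] at hp
        exact List.mem_cons_of_mem _ (ih _ _ p hp hl')
      | true =>
        have e : ∀ (γ : Type) (c : γ) (k : List γ), select (true :: mask) (c :: k) =
            c :: select mask k := fun _ _ _ => by simp [select]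
        rw [e, e] at hp
        rcases List.mem_cons.1 hp with rfl | hp
        · exact List.mem_cons_self
        · exact List.mem_cons_of_mem _ (ih _ _ p hp hl')

theorem forall₂_select {α β : Type} {P : α → β → Prop} (mask : List Bool) {l : List α}
    {l' : List β} (h : List.Forall₂ P l l') :
    List.Forall₂ P (select mask l) (select mask l') := by
  induction mask generalizing l l' with
  | nil => exact .nil
  | cons b mask ih =>
    cases h with
    | nil => exact .nil
    | cons h1 h2 =>
      cases b with
      | false => simpa [select] using ih h2
      | true => simpa [select] using List.Forall₂.cons h1 (ih h2)

namespace CQ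

/-! #### The new configuration -/

theorem rel_ne_switchRel (R : Rel) : rel R ≠ switchRel := by simp [rel, switchRel]

theorem rel_ne_orRel (R : Rel) : rel R ≠ orRel := by simp [rel, orRel]

theorem rel_ne_regRel (R : Rel) (l : List (Const × Domain)) : rel R ≠ regRel l := by
  simp [rel, regRel]

theorem rel_mem_newSch_iff {sch : List Rel} {q : Query} {R : Rel} :
    rel R ∈ newSch sch q ↔ R ∈ sch := by
  simp [newSch, rel_ne_switchRel, rel_ne_orRel, rel_ne_regRel, rel_injective.eq_iff]

theorem mem_newConf {sch : List Rel} {conf : List Fact} {q : Query} {f : Fact} :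
    f ∈ newConf sch conf q ↔ f = ⟨switchRel, [zero]⟩ ∨ (∃ l ∈ orTable, f = ⟨orRel, l⟩) ∨
      f = ⟨regRel (consts q), one :: (consts q).map fun p => lift p.1⟩ ∨
      f = ⟨regRel (consts q), zero :: (consts q).map fun _ => zero⟩ ∨
      (∃ R ∈ sch, f = dummy R) ∨ ∃ g ∈ conf, f = up g := by
  simp only [newConf, baseFacts, List.mem_append, List.mem_cons, List.mem_map, or_assoc]
  simp only [eq_comm (b := f)]

theorem rel_mem_newConf {sch : List Rel} {conf : List Fact} {q : Query} {R : Rel}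
    {xs : List Const} (h : ⟨rel R, xs⟩ ∈ newConf sch conf q) :
    xs = zero :: (R.doms.map fun _ => zero) ∨
      ∃ f ∈ conf, f.rel = R ∧ xs = one :: f.args.map lift := by
  rcases mem_newConf.1 h with h | ⟨l, -, h⟩ | h | h | ⟨S, -, h⟩ | ⟨g, hg, h⟩ <;>
    simp only [dummy, up, Fact.mk.injEq] at h
  · exact absurd h.1 (rel_ne_switchRel R)
  · exact absurd h.1 (rel_ne_orRel R)
  · exact absurd h.1 (rel_ne_regRel R _)
  · exact absurd h.1 (rel_ne_regRel R _)
  · rw [rel_injective h.1]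
    exact .inl h.2
  · exact .inr ⟨g, hg, (rel_injective h.1).symm, h.2⟩

theorem orRel_mem_newConf {sch : List Rel} {conf : List Fact} {q : Query} {xs : List Const}
    (h : ⟨orRel, xs⟩ ∈ newConf sch conf q) : xs ∈ orTable := by
  rcases mem_newConf.1 h with h | ⟨l, hl, h⟩ | h | h | ⟨S, -, h⟩ | ⟨g, hg, h⟩ <;>
    simp only [dummy, up, Fact.mk.injEq] at h
  · simp [switchRel, orRel] at h
  · rwa [h.2]
  · simp [orRel, regRel] at h
  · simp [orRel, regRel] at h
  · exact absurd h.1.symm (rel_ne_orRel _)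
  · exact absurd h.1.symm (rel_ne_orRel _)

theorem switchRel_mem_newConf {sch : List Rel} {conf : List Fact} {q : Query} {xs : List Const}
    (h : ⟨switchRel, xs⟩ ∈ newConf sch conf q) : xs = [zero] := by
  rcases mem_newConf.1 h with h | ⟨l, hl, h⟩ | h | h | ⟨S, -, h⟩ | ⟨g, hg, h⟩ <;>
    simp only [dummy, up, Fact.mk.injEq] at h
  · exact h.2
  · simp [switchRel, orRel] at h
  · simp [switchRel, regRel] at h
  · simp [switchRel, regRel] at h
  · exact absurd h.1.symm (rel_ne_switchRel _)
  · exact absurd h.1.symm (rel_ne_switchRel _)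

theorem regRel_mem_newConf {sch : List Rel} {conf : List Fact} {q : Query} {xs : List Const}
    (h : ⟨regRel (consts q), xs⟩ ∈ newConf sch conf q) :
    xs = (one :: (consts q).map fun p => lift p.1) ∨
      xs = (zero :: (consts q).map fun _ => zero) := by
  rcases mem_newConf.1 h with h | ⟨l, hl, h⟩ | h | h | ⟨S, -, h⟩ | ⟨g, hg, h⟩ <;>
    simp only [dummy, up, Fact.mk.injEq] at h
  · simp [switchRel, regRel] at h
  · simp [orRel, regRel] at h
  · exact .inl h.2
  · exact .inr h.2
  · exact absurd h.1.symm (rel_ne_regRel _ _)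
  · exact absurd h.1.symm (rel_ne_regRel _ _)

theorem switch_mem {sch : List Rel} {conf : List Fact} {q : Query} :
    ⟨switchRel, [zero]⟩ ∈ newConf sch conf q := by
  simp [mem_newConf]

/-- The accessed relation does not provide values for dependent accesses. -/
theorem wellFormedAccess_of_union {acs : List Method} {C r : Set Fact}
    (hr : ∀ f ∈ r, f.rel = switchRel) {a : Access} (h : WellFormedAccess (newAcs acs) (C ∪ r) a) :
    WellFormedAccess (newAcs acs) C a := by
  refine ⟨h.1, h.2.1, fun hd p hp => ?_⟩
  rcases List.mem_cons.1 h.1 with ha | ha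
  · rw [ha] at hd
    simp [switchMethod] at hd
  · obtain ⟨m, -, ha⟩ := List.mem_map.1 ha
    obtain ⟨f, hf | hf, hpf⟩ := h.2.2 hd p hp
    · exact ⟨f, hf, hpf⟩
    · rw [hr f hf] at hpf
      have h1 : p.2 = bitDom := by simpa [switchRel] using (List.of_mem_zip hpf).2
      have h2 := (List.of_mem_zip hp).2
      rw [Access.inputDoms, ← ha] at h2
      simp only [method, rel, select_false_cons, select_map, List.mem_map] at h2
      obtain ⟨D, -, h2⟩ := h2
      exact absurd (h2.trans h1) (dom_ne_bitDom D)

theorem freeVars_trOne {q : Query} (hq : q.freeVars = ∅) :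
    (tr (.const one) (fun p => .const (lift p.1)) q).freeVars = ∅ := by
  rw [Set.eq_empty_iff_forall_notMem]
  intro x hx
  rcases freeVars_tr x hx with ⟨y, hy, -⟩ | h | ⟨p, -, h⟩
  · simp [hq] at hy
  · simp at h
  · simp at h

theorem holds_trOne {sch : List Rel} {C₀ C I : Set Fact} {q : Query}
    (hq : q.IsBooleanPQ sch C₀) {e : Const → Const}
    (hC : ∀ R ∈ sch, ∀ xs : List Const, xs.length = R.doms.length → ⟨R, xs⟩ ∈ I →
      ⟨rel R, one :: xs.map e⟩ ∈ C) (he : ∀ p ∈ consts q, lift p.1 = e p.1) (h : q.Holds I) :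
    (tr (.const one) (fun p => .const (lift p.1)) q).Holds C := by
  obtain ⟨hf, Γ, w⟩ := hq
  exact (Query.holds_iff (freeVars_trOne hf) _).2 (eval_tr (σ := .const one)
    (ρ := fun p => .const (lift p.1)) (w := fun _ => []) hC (fun _ => rfl) w
    (fun p hp _ => he p hp) _ h)

theorem holds_of_trOne {sch : List Rel} {C₀ C I : Set Fact} {q : Query}
    (hq : q.IsBooleanPQ sch C₀) {h : Const → Const}
    (hC : ∀ R xs, ⟨rel R, one :: xs⟩ ∈ C → ⟨R, xs.map h⟩ ∈ I)
    (he : ∀ p ∈ consts q, h (lift p.1) = p.1)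
    (hh : (tr (.const one) (fun p => .const (lift p.1)) q).Holds C) : q.Holds I := by
  obtain ⟨hf, Γ, w⟩ := hq
  exact (Query.holds_iff hf _).2 (eval_of_tr (σ := .const one)
    (ρ := fun p => .const (lift p.1)) (w := fun _ => []) hC (fun _ => rfl) w
    (fun p hp _ => he p hp) (fun _ => [])
    ((Query.holds_iff (freeVars_trOne hf) _).1 hh))

/-- The disjuncts are true if the flag is `zero`. -/
theorem eval_disjunct_zero {sch : List Rel} {C₀ C : Set Fact} {q : Query}
    (hq : q.IsBooleanPQ sch C₀) (hc : q.IsConjunctive) {conf : List Fact}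
    (hC : ∀ f ∈ newConf sch conf q, f ∈ C) :
    ∀ b ∈ regQuery q :: sharedQueries sch, ∀ v : Name → Const, v sVar = zero → b.Eval C v := by
  have hd : ∀ R ∈ sch, dummy R ∈ C := fun R hR => hC _ (base_mem (dummy_mem hR))
  intro b hb v hv
  rcases List.mem_cons.1 hb with rfl | hb
  · exact eval_regQuery_zero hq hc hd (hC _ (base_mem regZero_mem)) hv
  · obtain ⟨R, hR, S, hS, k, l, D, hk, hl, rfl⟩ := mem_sharedQueries.1 hb
    obtain ⟨i, rfl, hi⟩ := mem_zip_numerals.1 hk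
    obtain ⟨j, rfl, hj⟩ := mem_zip_numerals.1 hl
    -- With flag `zero` both atoms are matched by dummy facts, which have `zero` at all positions.
    exact eval_shared (c := zero) (hd R hR) (hd S hS) (by simp) (by simp)
      (by rw [List.getElem?_map, hi]; rfl) (by rw [List.getElem?_map, hj]; rfl) hv

/-! #### From a failure of containment to relevance -/

/-- The image of an access with a response. -/
def upAccess (a : Access × Set Fact) : Access × Set Fact :=
  (⟨method a.1.method, a.1.bind.map lift⟩, up '' a.2)

theorem inputDoms_method (m : Method) (l : List Const) :
    Access.inputDoms ⟨method m, l⟩ = (select m.inputs m.rel.doms).map dom := by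
  simp [Access.inputDoms, method, rel, select_false_cons, select_map]

theorem run_map_upAccess (B : Set Fact) (p : Path) :
    ∀ C, run (B ∪ up '' C) (p.map upAccess) = B ∪ up '' run C p := by
  induction p with
  | nil => exact fun _ => rfl
  | cons a p ih =>
    intro C
    change run (B ∪ up '' C ∪ up '' a.2) (p.map upAccess) = B ∪ up '' run (C ∪ a.2) p
    rw [Set.union_assoc, ← Set.image_union, ih]

theorem isPath_map_upAccess {acs : List Method} {I J : Set Fact} (hJ : up '' I ⊆ J)
    (B : Set Fact) {p : Path} :
    ∀ {C}, IsPath acs I C p → IsPath (newAcs acs) J (B ∪ up '' C) (p.map upAccess) := by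
  induction p with
  | nil => exact fun _ => trivial
  | cons a p ih =>
    rintro C ⟨⟨hm, hb, hd⟩, hr, hp⟩
    refine ⟨⟨?_, ?_, fun h p hp => ?_⟩, ?_, ?_⟩
    · exact List.mem_cons_of_mem _ (List.mem_map_of_mem hm)
    · rw [inputDoms_method,
        List.forall₂_map_left_iff, List.forall₂_map_right_iff]
      exact hb.imp fun c D => lift_mem_dom
    · rw [inputDoms_method, zip_map] at hp
      obtain ⟨p, hp', rfl⟩ := List.mem_map.1 hp
      exact lift_mem_adom (fun f hf => .inr ⟨f, hf, rfl⟩) (hd h p hp')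
    · rintro _ ⟨f, hf, rfl⟩
      obtain ⟨h1, h2, h3⟩ := hr hf
      refine ⟨hJ ⟨f, h1, rfl⟩, congrArg rel h2, ?_⟩
      simp [method, up, select_false_cons, select_map, ← h3]
    · rw [Set.union_assoc, ← Set.image_union]
      exact ih hp

/-- The translated path adds only facts with flag `one`, so the dummies are the only facts with flag
`zero` over translated relations and no value is shared. As `q₂` fails too, only the accessed flag
can make the chain true. -/
theorem longTermRelevant_of_not_contained {x : ContainmentInput .CQ} {I C : Set Fact}
    (hI : IsInstance x.sch I) (hc : {f | f ∈ x.conf} ⊆ I)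
    (hr : Reachable x.acs I {f | f ∈ x.conf} C) (h1 : x.q₁.Holds C) (h2 : ¬ x.q₂.Holds C) :
    ∃ I, IsInstance (newSch x.sch x.q₂) I ∧ {f | f ∈ newConf x.sch x.conf x.q₂} ⊆ I ∧
      ∃ r ⊆ matching I ⟨switchMethod, [one]⟩,
        ∃ C, Reachable (newAcs x.acs) I {f | f ∈ newConf x.sch x.conf x.q₂} C ∧
        (newQuery x.sch x.q₁ x.q₂).Holds (C ∪ r) ∧ ¬ (newQuery x.sch x.q₁ x.q₂).Holds C := by
  obtain ⟨p, hp, rfl⟩ := hr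
  set N : Set Fact := {f | f ∈ newConf x.sch x.conf x.q₂} with hN
  have hNi : IsInstance (newSch x.sch x.q₂) N := isInstance_newConf x.isConf x.q₂_boolean
  have hsub := hp.run_subset hc
  have hNu : N ∪ up '' {f | f ∈ x.conf} = N := by
    refine Set.union_eq_left.2 ?_
    rintro _ ⟨f, hf, rfl⟩
    exact up_mem hf
  set D : Set Fact := N ∪ up '' run {f | f ∈ x.conf} p with hD
  have hrel : ∀ R xs, ⟨rel R, one :: xs⟩ ∈ D →
      ∃ f ∈ run {f | f ∈ x.conf} p, f.rel = R ∧ xs = f.args.map lift := by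
    rintro R xs (h | ⟨f, hf, h⟩)
    · rcases rel_mem_newConf h with h | ⟨f, hf, h, e⟩
      · simp [one_ne_zero] at h
      · exact ⟨f, subset_run p _ hf, h, (List.cons.inj e).2⟩
    · simp only [up, Fact.mk.injEq, List.cons.injEq, true_and] at h
      exact ⟨f, hf, rel_injective h.1, h.2.symm⟩
  -- The auxiliary relations gain nothing along the path.
  have hother : ∀ f ∈ D, (∀ R, f.rel ≠ rel R) → f ∈ N := by
    rintro f (h | ⟨f, hf, rfl⟩) hR
    · exact h
    · exact absurd rfl (hR _)
  refine ⟨insert ⟨switchRel, [one]⟩ (N ∪ up '' I), ⟨(hNi.1.union (hI.1.image _)).insert _, ?_⟩,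
    Set.subset_union_left.trans (Set.subset_insert _ _), {⟨switchRel, [one]⟩}, ?_, D,
    ⟨p.map upAccess, ?_, ?_⟩, ⟨?_, ?_⟩, ?_⟩
  · rintro f (rfl | hf | ⟨f, hf, rfl⟩)
    · exact ⟨by simp [newSch], .cons one_mem_bitDom .nil⟩
    · exact hNi.2 f hf
    · exact ⟨rel_mem_newSch (hI.2 f hf).1, wellTyped_up (hI.2 f hf).2⟩
  · rintro f rfl
    exact ⟨Set.mem_insert _ _, rfl, rfl⟩
  · have := isPath_map_upAccess (J := insert ⟨switchRel, [one]⟩ (N ∪ up '' I))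
      (Set.subset_union_right.trans (Set.subset_insert _ _)) N hp
    rwa [hNu] at this
  · rw [← hNu, run_map_upAccess]
  · refine holds_trOne x.q₁_boolean (fun R _ xs _ h => ?_) (fun p _ => rfl) h1
    exact .inl (.inr ⟨_, h, rfl⟩)
  · refine ⟨one, .inr (by simp [Term.value]), eval_chain_one
      (fun xs h => .inl (.inl (base_mem (orTable_mem h)))) (fun b hb v hv => ?_) (by simp)⟩
    exact eval_disjunct_zero x.q₂_boolean x.q₂_mem (fun f hf => .inl (.inl hf)) b hb v hv
  · rintro ⟨-, o, ho, hch⟩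
    have e : o = zero := by
      have := hother _ ho fun R => (rel_ne_switchRel R).symm
      simpa [Term.value] using switchRel_mem_newConf this
    subst e
    rcases of_eval_chain (fun xs h => orRel_mem_newConf
      (hother _ h fun R => (rel_ne_orRel R).symm)) hch with h | ⟨b, hb, v, hv, h⟩
    · simp at h
      exact one_ne_zero h.symm
    rcases List.mem_cons.1 hb with rfl | hb
    · refine h2 (holds_of_eval_regQuery (h := List.tail) x.q₂_boolean (fun R xs h => ?_)
        (fun xs h => ?_) hv h)
      · obtain ⟨f, hf, rfl, rfl⟩ := hrel R xs h
        simpa [lift, Function.comp_def] using hf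
      · rcases regRel_mem_newConf (hother _ h fun R => (rel_ne_regRel R _).symm) with h | h
        · rw [(List.cons.inj h).2]
          simp [lift]
        · simp [one_ne_zero] at h
    -- The values of facts with flag `one` are in the range of `lift`, while those of facts with
    -- flag `zero` are `zero`.
    · obtain ⟨R, hR, S, hS, k, l, E, hk, hl, rfl⟩ := mem_sharedQueries.1 hb
      obtain ⟨xs, ys, c, hx, hy, hcx, hcy⟩ := exists_of_eval_shared hk hl h
      rw [hv] at hy
      obtain ⟨f, -, -, rfl⟩ := hrel S ys hy
      obtain ⟨c, -, rfl⟩ := List.mem_map.1 hcy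
      rcases hx with hx | ⟨f, -, hx⟩
      · rcases rel_mem_newConf hx with hx | ⟨f, -, -, hx⟩
        · rw [(List.cons.inj hx).2] at hcx
          simp [lift_ne_zero] at hcx
        · exact one_ne_zero (List.cons.inj hx).1.symm
      · simp only [up, Fact.mk.injEq, List.cons.injEq] at hx
        exact one_ne_zero hx.2.1

/-! #### From relevance to a failure of containment -/

/-- Values of infinite domains need not be in the range of `lift`. Strings `lift c` with `c ∈ L` are
decoded; all others are padded to a length beyond that of all members of `L`, which keeps the map
injective. -/
theorem exists_decode (L : List Const) :
    ∃ g : Const → Const, Function.Injective g ∧ ∀ c ∈ L, g (lift c) = c := by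
  classical
  obtain ⟨N, hN⟩ : ∃ N, ∀ c ∈ L, c.length < N :=
    ⟨(L.map List.length).sum + 1, fun c hc =>
      Nat.lt_succ_of_le (List.le_sum_of_mem (List.mem_map_of_mem hc))⟩
  let P : Const → Prop := fun d => ∃ c ∈ L, d = lift c
  refine ⟨fun d => if P d then d.tail else List.replicate N false ++ d, fun c d h => ?_,
    fun c hc => if_pos (⟨c, hc, rfl⟩ : P (lift c))⟩
  have key : ∀ c d : Const, P c → ¬ P d → c.tail ≠ List.replicate N false ++ d := by
    rintro _ d ⟨c, hc, rfl⟩ - h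
    have h1 := hN c hc
    have h2 : c = List.replicate N false ++ d := h
    rw [h2] at h1
    simp at h1
  dsimp only at h
  by_cases hc : P c <;> by_cases hd : P d
  · rw [if_pos hc, if_pos hd] at h
    obtain ⟨c, -, rfl⟩ := hc
    obtain ⟨d, -, rfl⟩ := hd
    exact congrArg lift h
  · rw [if_pos hc, if_neg hd] at h
    exact absurd h (key c d hc hd)
  · rw [if_neg hc, if_pos hd] at h
    exact absurd h.symm (key d c hd hc)
  · rw [if_neg hc, if_neg hd] at h
    exact List.append_cancel_left h

/-- Infinite domains yield nothing: every string is a value of theirs, so decoding cannot violate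
their typing. -/
def Domain.list : Domain → List Const
  | .infinite _ => []
  | .finite _ c cs => c :: cs

/-- The facts with flag `one`, decoded. -/
def dec (sch : List Rel) (g : Const → Const) (X : Set Fact) : Set Fact :=
  {f | f.rel ∈ sch ∧ ∃ ys : List Const, ⟨rel f.rel, one :: ys⟩ ∈ X ∧ f.args = ys.map g}

theorem dec_mono {sch : List Rel} {g : Const → Const} {X Y : Set Fact} (h : X ⊆ Y) :
    dec sch g X ⊆ dec sch g Y :=
  fun _ ⟨hf, ys, hy, e⟩ => ⟨hf, ys, h hy, e⟩

theorem dec_union {sch : List Rel} {g : Const → Const} {X Y : Set Fact} :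
    dec sch g (X ∪ Y) = dec sch g X ∪ dec sch g Y := by
  ext f
  constructor
  · rintro ⟨hf, ys, hy | hy, e⟩
    exacts [.inl ⟨hf, ys, hy, e⟩, .inr ⟨hf, ys, hy, e⟩]
  · rintro (⟨hf, ys, hy, e⟩ | ⟨hf, ys, hy, e⟩)
    exacts [⟨hf, ys, .inl hy, e⟩, ⟨hf, ys, .inr hy, e⟩]

theorem finite_dec {sch : List Rel} {g : Const → Const} {X : Set Fact} (h : X.Finite) :
    (dec sch g X).Finite := by
  have : Nonempty Rel := ⟨switchRel⟩
  refine (h.image fun f => (⟨Function.invFun rel f.rel, f.args.tail.map g⟩ : Fact)).subset ?_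
  rintro ⟨R, xs⟩ ⟨-, ys, hy, rfl⟩
  exact ⟨_, hy, by simp [Function.leftInverse_invFun rel_injective R]⟩

/-- A value is shared by facts with different flags. -/
def Sharing (sch : List Rel) (X : Set Fact) : Prop :=
  ∃ R ∈ sch, ∃ S ∈ sch, ∃ xs ys : List Const, ⟨rel R, zero :: xs⟩ ∈ X ∧ ⟨rel S, one :: ys⟩ ∈ X ∧
    ∃ p, p ∈ xs.zip R.doms ∧ p ∈ ys.zip S.doms

theorem eval_shared_of_sharing {sch : List Rel} {X : Set Fact} (h : Sharing sch X)
    (hX : ∀ f ∈ X, f.WellTyped) :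
    ∃ b ∈ sharedQueries sch, ∀ v : Name → Const, v sVar = one → b.Eval X v := by
  obtain ⟨R, hR, S, hS, xs, ys, hx, hy, ⟨c, D⟩, hp, hq⟩ := h
  obtain ⟨i, hi⟩ := List.mem_iff_getElem?.1 hp
  obtain ⟨j, hj⟩ := List.mem_iff_getElem?.1 hq
  rw [List.getElem?_zip_eq_some] at hi hj
  have hx' := (hX _ hx).length_eq
  have hy' := (hX _ hy).length_eq
  simp only [rel, List.length_cons, List.length_map, Nat.add_right_cancel_iff] at hx' hy'
  exact ⟨_, mem_sharedQueries.2 ⟨R, hR, S, hS, _, _, D, mem_zip_numerals.2 ⟨i, rfl, hi.2⟩,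
    mem_zip_numerals.2 ⟨j, rfl, hj.2⟩, rfl⟩, fun v hv => eval_shared hx hy hx' hy' hi.1 hj.1 hv⟩

/-- The properties of the configurations that are decoded, with the function `g`. -/
structure Decodable (sch : List Rel) (conf : List Fact) (q : Query) (g : Const → Const)
    (X : Set Fact) : Prop where
  isInstance : IsInstance (newSch sch q) X
  newConf_subset : ∀ f ∈ newConf sch conf q, f ∈ X
  reg : ∀ xs, ⟨regRel (consts q), xs⟩ ∈ X → ⟨regRel (consts q), xs⟩ ∈ newConf sch conf q
  not_sharing : ¬ Sharing sch X

section

variable {sch : List Rel} {conf : List Fact} {q : Query} {g : Const → Const} {X : Set Fact}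

theorem Decodable.rel_mem (h : Decodable sch conf q g X) {R : Rel} {xs : List Const}
    (hf : ⟨rel R, xs⟩ ∈ X) : R ∈ sch :=
  rel_mem_newSch_iff.1 (h.isInstance.2 _ hf).1

/-- Such a value would be shared with the dummy fact of the same relation. -/
theorem Decodable.zero_notMem (h : Decodable sch conf q g X) {R : Rel} {ys : List Const}
    (hf : ⟨rel R, one :: ys⟩ ∈ X) (D : Domain) : (zero, D) ∉ ys.zip R.doms := by
  intro hD
  have hR := h.rel_mem hf
  refine h.not_sharing ⟨R, hR, R, hR, _, ys, h.newConf_subset _ (base_mem (dummy_mem hR)), hf,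
    (zero, D), ?_, hD⟩
  have := List.mem_map_of_mem (f := fun D : Domain => (zero, D)) (List.of_mem_zip hD).2
  rwa [show R.doms.map (fun D => (zero, D)) = (R.doms.map fun _ => zero).zip (R.doms.map id) from
    List.zip_map'.symm, List.map_id] at this

/-- A value of a translated finite domain is `zero`, which is excluded, or a renamed value, which
`g` restores. -/
theorem Decodable.wellTyped (h : Decodable sch conf q g X)
    (hg : ∀ R ∈ sch, ∀ D ∈ R.doms, ∀ c ∈ Domain.list D, g (lift c) = c) {R : Rel}
    {ys : List Const} (hf : ⟨rel R, one :: ys⟩ ∈ X) :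
    (⟨R, ys.map g⟩ : Fact).WellTyped := by
  have hw := (h.isInstance.2 _ hf).2
  have hw' : List.Forall₂ (fun c D => c ∈ Domain.values D) ys (R.doms.map dom) :=
    (List.forall₂_cons.1 hw).2
  rw [List.forall₂_map_right_iff, List.forall₂_iff_zip] at hw'
  rw [Fact.WellTyped, List.forall₂_map_left_iff, List.forall₂_iff_zip]
  refine ⟨hw'.1, fun {c D} hc => ?_⟩
  have h1 := hw'.2 hc
  have h2 := hg R (h.rel_mem hf) D (List.of_mem_zip hc).2
  cases D with
  | infinite n => exact Set.mem_univ _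
  | finite n d ds =>
    rcases List.mem_cons.1 h1 with rfl | h1
    · exact absurd hc (h.zero_notMem hf _)
    · rw [← List.map_cons] at h1
      obtain ⟨c', hc', rfl⟩ := List.mem_map.1 h1
      rw [h2 c' hc']
      exact hc'

theorem conf_subset_dec (hconf : IsInstance sch {f | f ∈ conf})
    (hg : ∀ f ∈ conf, ∀ c ∈ f.args, g (lift c) = c) (h : ∀ f ∈ newConf sch conf q, f ∈ X) :
    {f | f ∈ conf} ⊆ dec sch g X := by
  refine fun f hf => ⟨(hconf.2 f hf).1, _, h _ (up_mem hf), ?_⟩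
  rw [List.map_map]
  conv_lhs => rw [← List.map_id f.args]
  exact List.map_congr_left fun c hc => (hg f hf c hc).symm

theorem dec_newConf (hconf : IsInstance sch {f | f ∈ conf})
    (hg : ∀ f ∈ conf, ∀ c ∈ f.args, g (lift c) = c) :
    dec sch g {f | f ∈ newConf sch conf q} = {f | f ∈ conf} := by
  refine Set.Subset.antisymm ?_ (conf_subset_dec hconf hg fun f hf => hf)
  rintro ⟨R, xs⟩ ⟨hR, ys, hy, rfl⟩
  rcases rel_mem_newConf hy with h | ⟨f, hf, rfl, h⟩
  · simp [one_ne_zero] at h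
  · rw [(List.cons.inj h).2, List.map_map]
    have : f.args.map (g ∘ lift) = f.args := by
      conv_rhs => rw [← List.map_id f.args]
      exact List.map_congr_left fun c hc => hg f hf c hc
    rw [this]
    exact hf

/-- A value of a fact with flag `one` comes from another such fact. -/
theorem Decodable.mem_adom {Y : Set Fact} (h : Decodable sch conf q g Y)
    (hconf : IsInstance sch {f | f ∈ conf}) (hq : q.IsBooleanPQ sch {f | f ∈ conf})
    (hg : ∀ f ∈ conf, ∀ c ∈ f.args, g (lift c) = c) (hXY : X ⊆ Y)
    (hX : ∀ f ∈ newConf sch conf q, f ∈ X) {S : Rel} {ys : List Const}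
    (hS : ⟨rel S, one :: ys⟩ ∈ Y) {b : Const} {D : Domain} (hb : (b, D) ∈ ys.zip S.doms)
    (ha : (b, dom D) ∈ adom X) : (g b, D) ∈ adom (dec sch g X) := by
  obtain ⟨⟨R, xs⟩, hf, hp⟩ := ha
  have hw := h.isInstance.2 _ (hXY hf)
  have hbit : ∀ x, (b, dom D) ≠ (x, bitDom) := fun x e => dom_ne_bitDom D (Prod.ext_iff.1 e).2
  rcases newSch_cases hw.1 with e | e | e | ⟨R, hR, e⟩ <;> dsimp only at e <;> subst e
  · exact absurd (by simpa [switchRel] using (List.of_mem_zip hp).2) (dom_ne_bitDom D)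
  · exact absurd (by simpa [orRel] using (List.of_mem_zip hp).2) (dom_ne_bitDom D)
  -- The row with flag `one` holds renamed constants of `q`, which occur in the given configuration;
  -- the other row holds only `zero`, which `ys` cannot contain in a column of the schema.
  · rcases regRel_mem_newConf (h.reg _ (hXY hf)) with rfl | rfl
    · rcases List.mem_cons.1 hp with hp | hp
      · exact absurd hp (hbit _)
      · change _ ∈ ((consts q).map _).zip ((consts q).map _) at hp
        rw [List.zip_map'] at hp
        obtain ⟨p, hp, e⟩ := List.mem_map.1 hp
        simp only [Prod.mk.injEq] at e
        obtain ⟨-, Γ, w⟩ := hq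
        obtain ⟨f, hf, hp⟩ := consts_subset w p hp
        rw [← e.1, ← dom_injective e.2, hg f hf _ (List.of_mem_zip hp).1]
        exact ⟨f, conf_subset_dec hconf hg hX hf, hp⟩
    · rcases List.mem_cons.1 hp with hp | hp
      · exact absurd hp (hbit _)
      · have hz : b = zero := by
          have := (List.of_mem_zip hp).1
          simp only [List.mem_map] at this
          obtain ⟨-, -, e⟩ := this
          exact e.symm
        subst hz
        exact absurd hb (h.zero_notMem hS _)
  · cases xs with
    | nil => simp at hp
    | cons x xs =>
      rcases List.mem_cons.1 hp with hp | hp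
      · exact absurd hp (hbit _)
      · have hp' : (b, D) ∈ xs.zip R.doms := by
          have : (b, dom D) ∈ xs.zip (R.doms.map dom) := hp
          rw [List.zip_map_right] at this
          obtain ⟨p, hp, e⟩ := List.mem_map.1 this
          simp only [Prod.map, id, Prod.mk.injEq] at e
          rwa [← e.1, ← dom_injective e.2]
        have hx : x = one ∨ x = zero := by
          have : x ∈ bitDom.values := (List.forall₂_cons.1 hw.2).1
          simpa [bitDom, Domain.values] using this
        rcases hx with rfl | rfl
        · refine ⟨⟨R, xs.map g⟩, ⟨hR, xs, hf, rfl⟩, ?_⟩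
          change _ ∈ (xs.map g).zip R.doms
          rw [List.zip_map_left]
          exact List.mem_map.2 ⟨_, hp', rfl⟩
        -- A fact with flag `zero` as the source of `b` is what the disjuncts in `sharedQueries`
        -- rule out.
        · exact absurd ⟨R, hR, S, h.rel_mem hS, xs, ys, hXY hf, hS, _, hp', hb⟩ h.not_sharing

/-- Accesses that return no decodable fact are deleted, as they do not change the decoded
configuration. For the others, a returned fact with flag `one` proves that the decoded binding is
well typed and, by `Decodable.mem_adom`, that inputs of dependent methods have a source among the
decoded facts. -/
theorem exists_path_dec {acs : List Method} {I Y : Set Fact}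
    (h : Decodable sch conf q g Y)
    (hconf : IsInstance sch {f | f ∈ conf}) (hq : q.IsBooleanPQ sch {f | f ∈ conf})
    (hg : ∀ f ∈ conf, ∀ c ∈ f.args, g (lift c) = c)
    (hg' : ∀ R ∈ sch, ∀ D ∈ R.doms, ∀ c ∈ Domain.list D, g (lift c) = c) {p : Path} :
    ∀ {X : Set Fact}, (∀ f ∈ newConf sch conf q, f ∈ X) → run X p = Y →
      IsPath (newAcs acs) I X p →
      ∃ p', IsPath acs (dec sch g Y) (dec sch g X) p' ∧ run (dec sch g X) p' = dec sch g Y := by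
  induction p with
  | nil =>
    rintro X - rfl -
    exact ⟨[], trivial, rfl⟩
  | cons a p ih =>
    obtain ⟨a, r⟩ := a
    rintro X hX hY ⟨hw, hr, hp⟩
    obtain ⟨p', h1, h2⟩ := ih (X := X ∪ r) (fun f hf => .inl (hX f hf)) hY hp
    rw [dec_union] at h1 h2
    have hsub : X ∪ r ⊆ Y := hY ▸ subset_run p (X ∪ r)
    rcases (dec sch g r).eq_empty_or_nonempty with hd | ⟨⟨R, _⟩, hR, ys, hy, rfl⟩
    · rw [hd, Set.union_empty] at h1 h2
      exact ⟨p', h1, h2⟩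
    · dsimp only at hR hy
      obtain ⟨-, hy2, hy3⟩ := hr hy
      obtain ⟨m, bd⟩ := a
      rcases List.mem_cons.1 hw.1 with e | e
      · dsimp only at e
        subst e
        exact absurd hy2 (rel_ne_switchRel R)
      · obtain ⟨m, hm, e⟩ := List.mem_map.1 e
        dsimp only at e
        subst e
        obtain rfl : R = m.rel := rel_injective hy2
        have hbd : bd = select m.inputs ys := by
          rw [← select_false_cons]
          exact hy3.symm
        subst hbd
        have hyY := hsub (.inr hy)
        refine ⟨(⟨m, (select m.inputs ys).map g⟩, dec sch g r) :: p',
          ⟨⟨hm, ?_, fun hdep pr hpr => ?_⟩, ?_, h1⟩, h2⟩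
        · rw [← select_map]
          exact forall₂_select _ (h.wellTyped hg' hyY)
        · change pr ∈ ((select m.inputs ys).map g).zip (select m.inputs m.rel.doms) at hpr
          rw [List.zip_map_left] at hpr
          obtain ⟨⟨b, D⟩, hz, rfl⟩ := List.mem_map.1 hpr
          refine h.mem_adom hconf hq hg (Set.subset_union_left.trans hsub) hX hyY
            (select_zip _ _ _ _ hz ?_) (hw.2.2 hdep _ ?_)
          · simpa [rel] using (h.isInstance.2 _ hyY).2.length_eq
          · rw [inputDoms_method, List.zip_map_right]
            exact List.mem_map.2 ⟨_, hz, rfl⟩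
        · rintro ⟨R, _⟩ ⟨hR, zs, hz, rfl⟩
          refine ⟨dec_mono (Set.subset_union_right.trans hsub) ⟨hR, zs, hz, rfl⟩, ?_, ?_⟩
          · exact rel_injective (hr hz).2.1
          · dsimp only
            rw [select_map, ← select_false_cons m.inputs one zs]
            exact congrArg _ (hr hz).2.2

/-- No method accesses the table of constants. -/
theorem regRel_mem_of_run {acs : List Method} {I : Set Fact} {p : Path} {xs : List Const} :
    ∀ {X : Set Fact}, IsPath (newAcs acs) I X p → ⟨regRel (consts q), xs⟩ ∈ run X p →
      ⟨regRel (consts q), xs⟩ ∈ X := by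
  induction p with
  | nil => exact fun _ h => h
  | cons a p ih =>
    rintro X ⟨hw, hr, hp⟩ h
    refine (ih hp h).resolve_right fun h => ?_
    have := (hr h).2.1
    rcases List.mem_cons.1 hw.1 with e | e
    · rw [e] at this
      simp [regRel, switchMethod, switchRel] at this
    · obtain ⟨m, -, e⟩ := List.mem_map.1 e
      rw [← e] at this
      exact rel_ne_regRel _ _ this.symm

end

/-- The response is over `switchRel` only, so the part for `q₁` holds at `C` already. Since the
whole query fails there, all disjuncts fail with flag `one`: no value is shared, hence `C` can be
decoded, and `q₂` fails after decoding. -/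
theorem not_contained_of_longTermRelevant {x : ContainmentInput .CQ} {I r C : Set Fact}
    (hI : IsInstance (newSch x.sch x.q₂) I) (hc : {f | f ∈ newConf x.sch x.conf x.q₂} ⊆ I)
    (hr : r ⊆ matching I ⟨switchMethod, [one]⟩)
    (hC : Reachable (newAcs x.acs) I {f | f ∈ newConf x.sch x.conf x.q₂} C)
    (h1 : (newQuery x.sch x.q₁ x.q₂).Holds (C ∪ r))
    (h2 : ¬ (newQuery x.sch x.q₁ x.q₂).Holds C) :
    ∃ I, IsInstance x.sch I ∧ {f | f ∈ x.conf} ⊆ I ∧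
      ∃ C, Reachable x.acs I {f | f ∈ x.conf} C ∧ x.q₁.Holds C ∧ ¬ x.q₂.Holds C := by
  obtain ⟨p, hp, hpC⟩ := hC
  have hsub : C ⊆ I := hpC ▸ hp.run_subset hc
  have hNC : ∀ f ∈ newConf x.sch x.conf x.q₂, f ∈ C := fun f hf => hpC ▸ subset_run p _ hf
  obtain ⟨g, hgi, hgL⟩ := exists_decode (x.conf.flatMap Fact.args ++
    x.sch.flatMap fun R => R.doms.flatMap Domain.list)
  simp only [List.mem_append, List.mem_flatMap] at hgL
  have hg : ∀ f ∈ x.conf, ∀ c ∈ f.args, g (lift c) = c := fun f hf c hc =>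
    hgL c (.inl ⟨f, hf, hc⟩)
  have hg' : ∀ R ∈ x.sch, ∀ D ∈ R.doms, ∀ c ∈ Domain.list D, g (lift c) = c :=
    fun R hR D hD c hc => hgL c (.inr ⟨R, hR, D, hD, hc⟩)
  have hgc : ∀ q : Query, q.IsBooleanPQ x.sch {f | f ∈ x.conf} → ∀ p ∈ consts q,
      g (lift p.1) = p.1 := by
    rintro q ⟨-, Γ, w⟩ p hp
    obtain ⟨f, hf, hp⟩ := consts_subset w p hp
    exact hg f hf _ (List.of_mem_zip hp).1
  have hrel : ∀ R xs, ⟨rel R, one :: xs⟩ ∈ C ∪ r → ⟨R, xs.map g⟩ ∈ dec x.sch g C := by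
    rintro R xs (h | h)
    · exact ⟨rel_mem_newSch_iff.1 (hI.2 _ (hsub h)).1, xs, h, rfl⟩
    · exact absurd (hr h).2.1 (rel_ne_switchRel R)
  -- Injectivity of `g` serves to carry truth of `q₁` and `q₂` from the decoded configuration back
  -- to `C`.
  have hinv : Function.LeftInverse (Function.invFun g) g := Function.leftInverse_invFun hgi
  have hrel' : ∀ R ∈ x.sch, ∀ xs : List Const, xs.length = R.doms.length →
      ⟨R, xs⟩ ∈ dec x.sch g C → ⟨rel R, one :: xs.map (Function.invFun g)⟩ ∈ C := by
    rintro R - xs - ⟨-, ys, hy, e⟩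
    dsimp only at hy e
    rwa [e, List.map_map, hinv.id, List.map_id]
  have hinvc : ∀ q : Query, q.IsBooleanPQ x.sch {f | f ∈ x.conf} → ∀ p ∈ consts q,
      lift p.1 = Function.invFun g p.1 := fun q hq p hp => by
    conv_rhs => rw [← hgc q hq p hp]
    exact (hinv _).symm
  have hq1 : x.q₁.Holds (dec x.sch g C) :=
    holds_of_trOne x.q₁_boolean hrel (hgc _ x.q₁_boolean) h1.1
  have hno : ∀ b ∈ regQuery x.q₂ :: sharedQueries x.sch,
      ¬ ∀ v : Name → Const, v sVar = one → b.Eval C v := by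
    intro b hb h
    -- The fact over `switchRel` with flag `zero` is in the initial configuration, so one disjunct
    -- that is true with flag `one` suffices for the query.
    refine h2 ⟨holds_trOne x.q₁_boolean hrel' (hinvc _ x.q₁_boolean) hq1, zero,
      hNC _ (by simpa [Term.value] using switch_mem), ?_⟩
    exact eval_chain_of_mem (fun xs hx => hNC _ (base_mem (orTable_mem hx))) hb
      (eval_disjunct_zero x.q₂_boolean x.q₂_mem hNC) h (by simp)
  have hCI := hI.subset hsub
  have hdec : Decodable x.sch x.conf x.q₂ g C := by
    refine ⟨hCI, hNC, fun xs hx => regRel_mem_of_run hp (hpC ▸ hx), fun hs => ?_⟩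
    obtain ⟨b, hb, h⟩ := eval_shared_of_sharing hs fun f hf => (hCI.2 f hf).2
    exact hno b (List.mem_cons_of_mem _ hb) h
  obtain ⟨p', hp', e⟩ := exists_path_dec hdec x.isConf x.q₂_boolean hg hg'
    (X := {f | f ∈ newConf x.sch x.conf x.q₂}) (fun f hf => hf) hpC hp
  rw [dec_newConf x.isConf hg] at hp' e
  refine ⟨dec x.sch g C, ⟨finite_dec hCI.1, ?_⟩, conf_subset_dec x.isConf hg hNC,
    dec x.sch g C, ⟨p', hp', e⟩, hq1, fun hq2 => ?_⟩
  · rintro ⟨R, _⟩ ⟨hR, ys, hy, rfl⟩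
    exact ⟨hR, hdec.wellTyped hg' hy⟩
  · refine hno _ List.mem_cons_self fun v hv =>
      eval_regQuery x.q₂_boolean hrel' (hNC _ ?_) hq2 hv
    rw [List.map_congr_left fun p hp => (hinvc _ x.q₂_boolean p hp).symm]
    exact base_mem regOne_mem

theorem contained_iff (x : ContainmentInput .CQ) :
    x.Contained ↔ ¬ (reduction x).LongTermRelevant := by
  rw [(reduction x).longTermRelevant_iff fun r hr C a => wellFormedAccess_of_union hr,
    ← not_iff_not, x.not_contained_iff, not_not]
  constructor
  · rintro ⟨I, hI, hc, C, hr, h1, h2⟩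
    exact longTermRelevant_of_not_contained hI hc hr h1 h2
  · rintro ⟨I, hI, hc, r, hr, C, hC, h1, h2⟩
    exact not_contained_of_longTermRelevant hI hc hr hC h1 h2

end CQ

/-! ### Maps over lists and construction of tokens in polynomial time -/

section

variable {α β γ δ : Type} [Encoded α] [Encoded β] [Parse α] [Parse β]

theorem Comp.mapList {f : α → β} (hf : Comp f) : Comp fun l : List α => l.map f :=
  Comp.map (l := fun l => l) (g := fun _ => f) .id (hf.comp .snd)

theorem Comp.flatMapList {f : α → List β} (hf : Comp f) : Comp fun l : List α => l.flatMap f :=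
  Comp.flatMap (l := fun l => l) (g := fun _ => f) .id (hf.comp .snd)

omit [Parse α] in
theorem Comp.tokEx {f : α → Name} (hf : Comp f) : Comp fun x => Tok.ex (f x) :=
  (Comp.of_enc_append (g := Tok.ex) [.ex] fun x => by simp [enc_tok, Tok.word]).comp hf

theorem Comp.tokAtom {f : α → Rel} {g : α → List Term} (hf : Comp f) (hg : Comp g) :
    Comp fun x => Tok.atom (f x, g x) :=
  (Comp.of_enc_append (g := Tok.atom) [.atom] fun x => by simp [enc_tok, Tok.word]).comp
    (hf.pair hg)

end

namespace CQ

/-! #### Computation of the reduction -/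

theorem comp_dom : Comp dom := by
  have h : Comp fun p : Domain × Unit => dom p.1 := by
    refine .domainCases (f := fun p => .infinite p.1)
      (g := fun p => .finite p.1.1 zero (p.1.2.1 :: p.1.2.2 |>.map lift)) (.infinite .fst)
      (.finite (.comp .fst .fst) (.const _) ?_) (fun _ _ => rfl) (fun _ _ _ _ => rfl)
    have hl : Comp lift := .cons (.const true) .id
    have h2 : Comp fun p : (Name × Const × List Const) × Unit => p.1.2 := .comp .snd .fst
    exact hl.mapList.comp (.cons (.comp .fst h2) (.comp .snd h2))
  exact h.comp (.pair .id (.const ()))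

theorem comp_rel : Comp rel :=
  .rel (.cons (.const true) (.relName .id))
    (.cons (.const bitDom) (comp_dom.mapList.comp (.relDoms .id)))

theorem comp_method : Comp method := by
  have h := Comp.methodData (δ := Method) .id
  have h1 : Comp Method.rel := Comp.fst.comp h
  have h2 := Comp.snd.comp h
  have h3 : Comp Method.inputs := Comp.fst.comp h2
  have h4 : Comp Method.dependent := Comp.snd.comp h2
  exact .method (comp_rel.comp h1) (.cons (.const false) h3) h4

theorem comp_lift : Comp lift := .cons (.const true) .id

theorem comp_up : Comp up :=
  .fact (comp_rel.comp (.factRel .id))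
    (.cons (.const one) (comp_lift.mapList.comp (.factArgs .id)))

theorem comp_dummy : Comp dummy :=
  .fact comp_rel (.cons (.const zero)
    ((Comp.const (α := Domain) zero).mapList.comp (.relDoms .id)))

theorem comp_reg : Comp reg := .cons (.const false) (.cons (.const true) .code)

theorem comp_zVar : Comp zVar := .cons (.const false) (.cons (.const false) (.cons (.const true) .id))

theorem comp_wVar : Comp wVar :=
  .cons (.const false) (.cons (.const false) (.cons (.const false) (.cons (.const true) .id)))

theorem comp_trTerm {ρ : Const × Domain → Term} (hρ : Comp ρ) : Comp (trTerm ρ) :=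
  .termCases (f := fun p => .var (user p.1)) (.var (.cons (.const true) .fst)) hρ
    (fun _ _ => rfl) (fun _ _ => rfl)

def trTok (σ : Term) (ρ : Const × Domain → Term) : Tok → Tok
  | .atom p => .atom (rel p.1, σ :: (p.2.zip p.1.doms).map (trTerm ρ))
  | .conj => .conj
  | .disj => .disj
  | .ex x => .ex (user x)

/-- The translation keeps the shape of a formula, so it acts on each token separately. -/
theorem toks_tr (σ : Term) (ρ : Const × Domain → Term) (φ : Query) :
    (tr σ ρ φ).toks = φ.toks.map (trTok σ ρ) := by
  induction φ with
  | atom R ts => rfl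
  | and φ ψ h1 h2 => simp [tr, Query.toks, trTok, h1, h2]
  | or φ ψ h1 h2 => simp [tr, Query.toks, trTok, h1, h2]
  | ex x φ ih => simp [tr, Query.toks, trTok, ih]

theorem comp_atomTerms : Comp fun p : Rel × List Term => p.2.zip p.1.doms :=
  .zip .snd (.relDoms .fst)

theorem comp_tr (σ : Term) {ρ : Const × Domain → Term} (hρ : Comp ρ) : Comp (tr σ ρ) := by
  have h : Comp (trTok σ ρ) :=
    .tokCases (f := fun p => .atom (rel p.1, σ :: (p.2.zip p.1.doms).map (trTerm ρ)))
      (g := fun x => .ex (user x)) (u := fun _ => .conj) (v := fun _ => .disj)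
      (.tokAtom (comp_rel.comp .fst)
        (.cons (.const σ) ((comp_trTerm hρ).mapList.comp comp_atomTerms)))
      (.tokEx (.cons (.const true) .id)) (.const _) (.const _)
      (fun _ => rfl) (fun _ => rfl) rfl rfl
  exact .of_toks ((h.mapList.comp .toks).congr fun φ => (toks_tr σ ρ φ).symm)

def tokConsts : Tok → List (Const × Domain)
  | .atom p => (p.2.zip p.1.doms).flatMap termConsts
  | _ => []

theorem consts_eq (φ : Query) : consts φ = φ.toks.flatMap tokConsts := by
  induction φ with
  | atom R ts => simp [consts, Query.toks, tokConsts]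
  | and φ ψ h1 h2 => simp [consts, Query.toks, tokConsts, h1, h2]
  | or φ ψ h1 h2 => simp [consts, Query.toks, tokConsts, h1, h2]
  | ex x φ ih => simp [consts, Query.toks, tokConsts, ih]

theorem comp_consts : Comp consts := by
  have ht : Comp termConsts :=
    .termCases (f := fun _ => []) (g := fun p => [p]) (.const _) (.cons .id (.const []))
      (fun _ _ => rfl) (fun _ _ => rfl)
  have h : Comp tokConsts :=
    .tokCases (f := fun p => (p.2.zip p.1.doms).flatMap termConsts)
      (g := fun _ => []) (u := fun _ => []) (v := fun _ => [])
      (ht.flatMapList.comp comp_atomTerms) (.const _) (.const _) (.const _)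
      (fun _ => rfl) (fun _ => rfl) rfl rfl
  exact (h.flatMapList.comp .toks).congr fun φ => (consts_eq φ).symm

theorem comp_exAll {α : Type} [Encoded α] [Parse α] {l : α → List Name} {f : α → Query}
    (hl : Comp l) (hf : Comp f) : Comp fun x => exAll (l x) (f x) := by
  have e : ∀ (l : List Name) (φ : Query), (exAll l φ).toks = l.map Tok.ex ++ φ.toks := by
    intro l φ
    induction l with
    | nil => rfl
    | cons x l ih =>
      change Tok.ex x :: (exAll l φ).toks = _
      rw [ih]
      rfl
  exact .of_toks (((Comp.tokEx .id).mapList.comp hl |>.append (.comp .toks hf)).congr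
    fun x => (e _ _).symm)

theorem comp_regRel : Comp regRel := by
  have h : Comp fun p : Const × Domain => dom p.2 := comp_dom.comp .snd
  exact .rel (.const _) (.cons (.const bitDom) h.mapList)

theorem comp_regQuery : Comp regQuery := by
  have hv : Comp fun p : Const × Domain => Term.var (reg p) := .var comp_reg
  exact comp_exAll (comp_reg.mapList.comp comp_consts)
    (.and (.atom (comp_regRel.comp comp_consts)
      (.cons (.const _) (hv.mapList.comp comp_consts))) (comp_tr _ hv))

theorem comp_cols : Comp cols := by
  have h : Comp fun R : Rel => ((numerals R.doms).zip R.doms).map fun p => (R, p) :=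
    .map (.zip (Comp.numerals.comp (.relDoms .id)) (.relDoms .id)) (.pair .fst .snd)
  exact h.flatMapList

theorem comp_shared : Comp fun p : (Rel × Name × Domain) × Rel × Name × Domain =>
    shared p.1.1 p.2.1 p.1.2.1 p.2.2.1 := by
  have hR : Comp fun p : (Rel × Name × Domain) × Rel × Name × Domain => p.1.1 := .comp .fst .fst
  have hS : Comp fun p : (Rel × Name × Domain) × Rel × Name × Domain => p.2.1 := .comp .fst .snd
  have hk : Comp fun p : (Rel × Name × Domain) × Rel × Name × Domain => p.1.2.1 :=
    .comp .fst (.comp .snd .fst)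
  have hl : Comp fun p : (Rel × Name × Domain) × Rel × Name × Domain => p.2.2.1 :=
    .comp .fst (.comp .snd .snd)
  have nR := Comp.numerals.comp (.relDoms hR)
  have nS := Comp.numerals.comp (.relDoms hS)
  refine comp_exAll (.append (comp_zVar.mapList.comp nR) (comp_wVar.mapList.comp nS))
    (.and (.atom (comp_rel.comp hR) (.cons (.const _) ?_))
      (.atom (comp_rel.comp hS) (.cons (.const _) ?_)))
  · exact (Comp.var comp_zVar).mapList.comp nR
  · exact .map nS (.var (.ite (.eq .snd (hl.comp .fst)) (comp_zVar.comp (hk.comp .fst))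
      (comp_wVar.comp .snd)))

theorem comp_sharedQueries : Comp sharedQueries := by
  have h2 : Comp fun p : Rel × Name × Domain => p.2.2 := .comp .snd .snd
  refine .flatMap comp_cols (.flatMap (comp_cols.comp .fst) (.ite (.eq ?_ ?_) ?_ (.const [])))
  · exact h2.comp (.comp .snd .fst)
  · exact h2.comp .snd
  · exact .cons (comp_shared.comp (.pair (.comp .snd .fst) .snd)) (.const [])

/-- In prefix notation a step of the chain only writes tokens in front of the rest, so the nested
formula is a concatenation. -/
theorem comp_chain : Comp chain := by
  let u : Query → List Tok := fun b => [.ex sVar, .conj] ++ b.toks ++ [.ex tVar, .conj] ++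
    (orAtom (.var oVar) (.var sVar) (.var tVar)).toks ++ [.ex oVar, .conj] ++
    (orAtom (.var tVar) (.var tVar) (.var oVar)).toks
  let w : List Tok := (orAtom (.var oVar) (.var oVar) (.const one)).toks
  have e : ∀ l : List Query, (chain l).toks = l.flatMap u ++ w := by
    intro l
    induction l with
    | nil => rfl
    | cons b l ih =>
      change (chainStep b (chain l)).toks = _
      simp [chainStep, Query.toks, ih, u]
  have hu : Comp u := .append (.append (.append (.append (.append (.const _) .toks) (.const _))
    (.const _)) (.const _)) (.const _)
  exact .of_toks ((hu.flatMapList.append (.const w)).congr fun l => (e l).symm)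

theorem comp_reduction :
    Comp fun d : List Rel × List Method × List Fact × Query × Query =>
      (newSch d.1 d.2.2.2.2, newAcs d.2.1, newConf d.1 d.2.2.1 d.2.2.2.2,
        Access.mk switchMethod [one], newQuery d.1 d.2.2.2.1 d.2.2.2.2) := by
  have hs : Comp fun d : List Rel × List Method × List Fact × Query × Query => d.1 := .fst
  have h2 : Comp fun d : List Rel × List Method × List Fact × Query × Query => d.2 := .snd
  have ha : Comp fun d : List Rel × List Method × List Fact × Query × Query => d.2.1 :=
    .comp .fst h2
  have h3 : Comp fun d : List Rel × List Method × List Fact × Query × Query => d.2.2 := .comp .snd h2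
  have hc : Comp fun d : List Rel × List Method × List Fact × Query × Query => d.2.2.1 :=
    .comp .fst h3
  have h4 : Comp fun d : List Rel × List Method × List Fact × Query × Query => d.2.2.2 :=
    .comp .snd h3
  have hq : Comp fun d : List Rel × List Method × List Fact × Query × Query => d.2.2.2.1 :=
    .comp .fst h4
  have hk : Comp fun d : List Rel × List Method × List Fact × Query × Query => consts d.2.2.2.2 :=
    comp_consts.comp (.comp .snd h4)
  have hr := comp_regRel.comp hk
  have h1 : Comp fun p : Const × Domain => lift p.1 := comp_lift.comp .fst
  refine .pair ?_ (.pair ?_ (.pair (.append ?_ (comp_up.mapList.comp hc)) (.pair (.const _) ?_)))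
  · exact .cons (.const _) (.cons (.const _) (.cons hr (comp_rel.mapList.comp hs)))
  · exact .cons (.const _) (comp_method.mapList.comp ha)
  · exact .cons (.const _) (.append (.const _) (.cons (.fact hr (.cons (.const _)
      (h1.mapList.comp hk))) (.cons (.fact hr (.cons (.const _)
        ((Comp.const (α := Const × Domain) zero).mapList.comp hk))) (comp_dummy.mapList.comp hs))))
  · exact .and ((comp_tr _ (.constTerm h1)).comp hq) (.ex (.const _) (.and (.const _)
      (comp_chain.comp (.cons (comp_regQuery.comp (.comp .snd h4)) (comp_sharedQueries.comp hs)))))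

theorem isReduction : IsReduction reduction := by
  have h : Comp fun x : ContainmentInput .CQ => (x.sch, x.acs, x.conf, x.q₁, x.q₂) :=
    .of_enc_eq fun _ => rfl
  exact ⟨Comp.polyTime (.of_enc (comp_reduction.comp h) fun _ => rfl), contained_iff⟩

end CQ

end LimitedAccess

theorem mainTheorem6 :
    (∃ f : LimitedAccess.ContainmentInput .CQ → LimitedAccess.RelevanceInput .CQ,
      LimitedAccess.IsReduction f) ∧
    (∃ f : LimitedAccess.ContainmentInput .PQ → LimitedAccess.RelevanceInput .PQ,
      LimitedAccess.IsReduction f ∧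
      ∀ x : LimitedAccess.ContainmentInput .PQ, (f x).conf = x.conf) :=
  ⟨⟨LimitedAccess.CQ.reduction, LimitedAccess.CQ.isReduction⟩,
    LimitedAccess.PQ.reduction, LimitedAccess.PQ.isReduction, fun _ => rfl⟩
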